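/- Let $\mathbb F=\mathbb Q(q^{1/2},t^{1/2})$ with $q^{1/2},t^{1/2}$ independent indeterminates, $p=q/t$, and $$G^\pm(z)=(1-q^{\pm1}z)(1-t^{\mp1}z)(1-q^{\mp1}t^{\pm1}z),\qquad g(z)=G^+(z)/G^-(z).$$ The Ding–Iohara algebra $\mathcal U(q,t)$ is the unital associative $\mathbb F$-algebra generated by the coefficients of the currents $x^\pm(z)=\sum_{n\in\mathbb Z}x^\pm_nz^{-n}$, $\psi^\pm(z)=\sum_{\pm n\ge0}\psi^\pm_nz^{-n}$ and by central mutually inverse elements $\gamma^{\pm1/2}$, with the relations $$\psi^\pm(z)\psi^\pm(w)=\psi^\pm(w)\psi^\pm(z),\qquad \psi^+(z)\psi^-(w)=\frac{g(\gamma w/z)}{g(\gamma^{-1}w/z)}\psi^-(w)\psi^+(z),$$ $$\psi^+(z)x^\pm(w)=g(\gamma^{\mp1/2}w/z)^{\mp1}x^\pm(w)\psi^+(z),\qquad \psi^-(z)x^\pm(w)=g(\gamma^{\mp1/2}z/w)^{\pm1}x^\pm(w)\psi^-(z),$$ $$[x^+(z),x^-(w)]=\frac{(1-q)(1-1/t)}{1-p}\Big(\delta(\gamma^{-1}z/w)\psi^+(\gamma^{1/2}w)-\delta(\gamma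 z/w)\psi^-(\gamma^{-1/2}w)\Big),$$ $$G^\mp(z/w)x^\pm(z)x^\pm(w)=G^\pm(z/w)x^\pm(w)x^\pm(z),$$ where $\delta(u)=\sum_{n\in\mathbb Z}u^n$, and $g(u)^{\pm1}$ and the quotient of $g$'s are expanded in nonnegative powers of the displayed argument ($w/z$ or $z/w$). Give $x^\pm_n,\psi^\pm_n$ degree $n$ and $\gamma^{\pm1/2}$ degree $0$. Let $V$ be any representation of $\mathcal U(q,t)$ over $\mathbb F$ such that every vector is annihilated by all products of generators of sufficiently large total degree, and such that $\psi^\pm_0$ and $\gamma^n-\gamma^{-n}$ ($n\ge1$) act invertibly. All identities below are identities of formal series, in $z^{\pm1},w^{\pm1}$, of operators on $V$. Here $1/(\gamma^n-\gamma^{-n})$ and $1/(1-\gamma^{-2n})$ denote the inverse operators (which are the sums $\sum_{i\ge0}\gamma^{-(2i+1)n}$ and $\sum_{i\ge0}\gamma^{-2in}$ whenever the latter make sense). Define $b_n$ ($n\neq0$) by $$\psi^+(z)=\psi^+_0\exp\Big(\sum_{n>0}b_n\gamma^{n/2}z^{-n}\Big),\qquad \psi^-(z)=\psi^-_0\exp\Big(-\sum_{n>0}b_{-n}\gamma^{n/2}z^{n}\Big),$$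 and put $$\alpha(z)=\exp\Big(-\sum_{n\ge1}\frac{b_{-n}z^n}{\gamma^n-\gamma^{-n}}\Big),\qquad \beta(z)=\exp\Big(\sum_{n\ge1}\frac{b_nz^{-n}}{\gamma^n-\gamma^{-n}}\Big),$$ $$t(z)=\alpha(z)x^+(z)\beta(z),\qquad t^*(z)=\alpha(p^{-1}z)^{-1}x^-(p^{-1}\gamma^{-1}z)\beta(\gamma^{-2}p^{-1}z)^{-1},$$ $$t^{(2)}(z)=\alpha(pz)\alpha(z)\,x^+(pz)x^+(z)\,\beta(pz)\beta(z),$$ $$t^{*(2)}(z)=\alpha(p^{-2}z)^{-1}\alpha(p^{-1}z)^{-1}\,x^-(\gamma^{-1}p^{-2}z)x^-(\gamma^{-1}p^{-1}z)\,\beta(\gamma^{-2}p^{-2}z)^{-1}\beta(\gamma^{-2}p^{-1}z)^{-1}.$$ In the last two formulas, the product $x(cz)x(z)$ (with $x=x^+$, $c=p$, or $x=x^-$, $c=p^{-1}$) denotes the specialization of the product of currents understood as a rational function: the coefficient of $z^{-n}$ in $x(cz)x(z)v$ is the value at $u=c^{-1}$ of the rational function whose expansion at $u=0$ is $\sum_{m}u^m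 x_mx_{n-m}v$. Put $$A(z)=\exp\Big(\sum_{n\ge1}\frac1n\frac{(1-q^n)(1-t^{-n})(1-p^{-n}\gamma^{-2n})}{1-\gamma^{-2n}}z^n\Big),$$ $$B(z)=\exp\Big(\sum_{n\ge1}\frac1n\frac{(1-q^n)(1-t^{-n})(p^{-2n}\gamma^{-2n}-p^{-n}\gamma^{-2n})}{1-\gamma^{-2n}}z^n\Big).$$ Then all these objects are well defined: the two rational functions exist and are regular at the points in question, and all other infinite sums that occur are finite on each vector of $V$. Moreover: (1) $[t(z),\alpha(w)]=[t(z),\beta(w)]=[t^*(z),\alpha(w)]=[t^*(z),\beta(w)]=0$ and $[t(z),\psi^\pm(w)]=[t^*(z),\psi^\pm(w)]=0$. (2) $$A(\tfrac wz)t(z)t(w)-A(\tfrac zw)t(w)t(z)=\frac{(1-q)(1-t^{-1})}{1-p}\Big[\delta(p^{-1}\tfrac wz)t^{(2)}(z)-\delta(p\tfrac wz)t^{(2)}(w)\Big],$$ $$A(\tfrac wz)t^*(z)t^*(w)-A(\tfrac zw)t^*(w)t^*(z)=\frac{(1-q^{-1})(1-t)}{1-p^{-1}}\Big[\delta(p\tfrac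 wz)t^{*(2)}(z)-\delta(p^{-1}\tfrac wz)t^{*(2)}(w)\Big].$$ (3) $$B(\tfrac wz)t(z)t^*(w)-B(\gamma^2p^2\tfrac zw)t^*(w)t(z)=\frac{(1-q)(1-t^{-1})}{1-p}\Big[\delta(p^{-1}\tfrac wz)\psi_0^+-\delta(\gamma^{-2}p^{-1}\tfrac wz)\psi_0^-\Big].$$ -/

import Mathlib

noncomputable section

namespace DingIohara

/-! ### The base field and the structure functions -/

/-- The base field `ℚ(q^{1/2}, t^{1/2})` of rational functions in two independent indeterminates. -/
abbrev F : Type := FractionRing (MvPolynomial (Fin 2) ℚ)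

/-- The indeterminate `q^{1/2}`. -/
def qHalf : F := algebraMap (MvPolynomial (Fin 2) ℚ) F (MvPolynomial.X 0)

/-- The indeterminate `t^{1/2}`. -/
def tHalf : F := algebraMap (MvPolynomial (Fin 2) ℚ) F (MvPolynomial.X 1)

def q : F := qHalf ^ 2

def t : F := tHalf ^ 2

/-- `p = q / t`. -/
def p : F := q / t

theorem qHalf_ne_zero : qHalf ≠ 0 := by
  simp [qHalf]

theorem tHalf_ne_zero : tHalf ≠ 0 := by
  simp [tHalf]

theorem p_ne_zero : p ≠ 0 :=
  div_ne_zero (pow_ne_zero 2 qHalf_ne_zero) (pow_ne_zero 2 tHalf_ne_zero)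

/-- `G⁺(z) = (1 - q z)(1 - t⁻¹ z)(1 - q⁻¹ t z)`. -/
def Gplus : Polynomial F :=
  (1 - Polynomial.C q * Polynomial.X) * (1 - Polynomial.C t⁻¹ * Polynomial.X) *
    (1 - Polynomial.C (q⁻¹ * t) * Polynomial.X)

/-- `G⁻(z) = (1 - q⁻¹ z)(1 - t z)(1 - q t⁻¹ z)`. -/
def Gminus : Polynomial F :=
  (1 - Polynomial.C q⁻¹ * Polynomial.X) * (1 - Polynomial.C t * Polynomial.X) *
    (1 - Polynomial.C (q * t⁻¹) * Polynomial.X)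

/-- `g(z) = G⁺(z) / G⁻(z)`, expanded as a power series in `z`. -/
def g : PowerSeries F := (Gplus : PowerSeries F) * (Gminus : PowerSeries F)⁻¹

/-! ### The algebra `U(q,t)` -/

/-- The generators. -/
inductive Gen : Type
  /-- `x⁺_n` -/
  | xp (n : ℤ)
  /-- `x⁻_n` -/
  | xm (n : ℤ)
  /-- `ψ⁺_n`, `n ≥ 0` -/
  | psip (n : ℕ)
  /-- `ψ⁻_{-n}`, `n ≥ 0` -/
  | psim (n : ℕ)
  /-- `γ^{1/2}` -/
  | gam
  /-- `γ^{-1/2}` -/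
  | gamInv

abbrev Free : Type := FreeAlgebra F Gen

namespace Free

def xp (n : ℤ) : Free := FreeAlgebra.ι F (Gen.xp n)
def xm (n : ℤ) : Free := FreeAlgebra.ι F (Gen.xm n)
def psip (n : ℕ) : Free := FreeAlgebra.ι F (Gen.psip n)
def psim (n : ℕ) : Free := FreeAlgebra.ι F (Gen.psim n)
def gam : Free := FreeAlgebra.ι F Gen.gam
def gamInv : Free := FreeAlgebra.ι F Gen.gamInv

/-- `γ^{k/2}` for an integer `k`. -/
def gamPow (k : ℤ) : Free := if 0 ≤ k then gam ^ k.toNat else gamInv ^ (-k).toNat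

/-- `ψ⁺_n` for an integer `n`; it is `0` for `n < 0`. -/
def psipZ (n : ℤ) : Free := if 0 ≤ n then psip n.toNat else 0

/-- `ψ⁻_n` for an integer `n`; it is `0` for `n > 0`. -/
def psimZ (n : ℤ) : Free := if n ≤ 0 then psim (-n).toNat else 0

/-- The coefficient of `u^k` in `g(γ u) / g(γ⁻¹ u)`. -/
def gRatio (k : ℕ) : Free :=
  ∑ i ∈ Finset.range (k + 1),
    (PowerSeries.coeff i g * PowerSeries.coeff (k - i) g⁻¹) •
      gamPow (2 * (i : ℤ) - 2 * ((k : ℤ) - (i : ℤ)))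

end Free

open Free in
/-- The defining relations, coefficient by coefficient. The currents are
`x^±(z) = ∑ x^±_n z^{-n}`, `ψ⁺(z) = ∑_{n ≥ 0} ψ⁺_n z^{-n}`, `ψ⁻(z) = ∑_{n ≥ 0} ψ⁻_{-n} z^n`. -/
inductive Rel : Free → Free → Prop
  | gam_gamInv : Rel (gam * gamInv) 1
  | gamInv_gam : Rel (gamInv * gam) 1
  | gam_central (a : Gen) : Rel (gam * FreeAlgebra.ι F a) (FreeAlgebra.ι F a * gam)
  /-- `ψ⁺(z) ψ⁺(w) = ψ⁺(w) ψ⁺(z)` -/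
  | psip_psip (m n : ℕ) : Rel (psip m * psip n) (psip n * psip m)
  /-- `ψ⁻(z) ψ⁻(w) = ψ⁻(w) ψ⁻(z)` -/
  | psim_psim (m n : ℕ) : Rel (psim m * psim n) (psim n * psim m)
  /-- `ψ⁺(z) ψ⁻(w) = (g(γ w/z) / g(γ⁻¹ w/z)) ψ⁻(w) ψ⁺(z)` -/
  | psip_psim (m n : ℕ) :
      Rel (psip m * psim n)
        (∑ k ∈ Finset.range (min m n + 1), gRatio k * (psim (n - k) * psip (m - k)))
  /-- `ψ⁺(z) x⁺(w) = g(γ^{-1/2} w/z)⁻¹ x⁺(w) ψ⁺(z)` -/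
  | psip_xp (m : ℕ) (n : ℤ) :
      Rel (psip m * xp n)
        (∑ k ∈ Finset.range (m + 1),
          PowerSeries.coeff k g⁻¹ • (gamPow (-(k : ℤ)) * (xp (n + k) * psip (m - k))))
  /-- `ψ⁺(z) x⁻(w) = g(γ^{1/2} w/z) x⁻(w) ψ⁺(z)` -/
  | psip_xm (m : ℕ) (n : ℤ) :
      Rel (psip m * xm n)
        (∑ k ∈ Finset.range (m + 1),
          PowerSeries.coeff k g • (gamPow (k : ℤ) * (xm (n + k) * psip (m - k))))
  /-- `ψ⁻(z) x⁺(w) = g(γ^{-1/2} z/w) x⁺(w) ψ⁻(z)` -/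
  | psim_xp (m : ℕ) (n : ℤ) :
      Rel (psim m * xp n)
        (∑ k ∈ Finset.range (m + 1),
          PowerSeries.coeff k g • (gamPow (-(k : ℤ)) * (xp (n - k) * psim (m - k))))
  /-- `ψ⁻(z) x⁻(w) = g(γ^{1/2} z/w)⁻¹ x⁻(w) ψ⁻(z)` -/
  | psim_xm (m : ℕ) (n : ℤ) :
      Rel (psim m * xm n)
        (∑ k ∈ Finset.range (m + 1),
          PowerSeries.coeff k g⁻¹ • (gamPow (k : ℤ) * (xm (n - k) * psim (m - k))))
  /-- `[x⁺(z), x⁻(w)] = (1-q)(1-1/t)/(1-q/t) (δ(γ⁻¹ z/w) ψ⁺(γ^{1/2} w) - δ(γ z/w) ψ⁻(γ^{-1/2} w))` -/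
  | xp_xm (m n : ℤ) :
      Rel (xp m * xm n - xm n * xp m)
        (((1 - q) * (1 - t⁻¹) / (1 - p)) •
          (gamPow (m - n) * psipZ (m + n) - gamPow (n - m) * psimZ (m + n)))
  /-- `G⁻(z/w) x⁺(z) x⁺(w) = G⁺(z/w) x⁺(w) x⁺(z)` -/
  | xp_xp (m n : ℤ) :
      Rel (∑ k ∈ Finset.range 4, Gminus.coeff k • (xp (m + k) * xp (n - k)))
        (∑ k ∈ Finset.range 4, Gplus.coeff k • (xp (n - k) * xp (m + k)))
  /-- `G⁺(z/w) x⁻(z) x⁻(w) = G⁻(z/w) x⁻(w) x⁻(z)` -/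
  | xm_xm (m n : ℤ) :
      Rel (∑ k ∈ Finset.range 4, Gplus.coeff k • (xm (m + k) * xm (n - k)))
        (∑ k ∈ Finset.range 4, Gminus.coeff k • (xm (n - k) * xm (m + k)))

/-- The Ding–Iohara algebra `U(q,t)`. -/
abbrev U : Type := RingQuot Rel

/-- The image of a generator in `U(q,t)`. -/
def gen (a : Gen) : U := RingQuot.mkAlgHom F Rel (FreeAlgebra.ι F a)

/-- The central unit `γ^{1/2}` of `U(q,t)`. -/
def gamHalf : Uˣ where
  val := gen Gen.gam
  inv := gen Gen.gamInv
  val_inv := by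
    have h := RingQuot.mkAlgHom_rel F Rel.gam_gamInv
    rwa [map_mul, map_one] at h
  inv_val := by
    have h := RingQuot.mkAlgHom_rel F Rel.gamInv_gam
    rwa [map_mul, map_one] at h

/-- The degree: `x^±_n`, `ψ^±_n` have degree `n`, and `γ^{±1/2}` has degree `0`. -/
def Gen.deg : Gen → ℤ
  | .xp n => n
  | .xm n => n
  | .psip n => n
  | .psim n => -n
  | .gam => 0
  | .gamInv => 0

/-! ### Power series with operator coefficients -/

section Series

variable {E : Type*} [Ring E] [Algebra F E]

/-- `exp f = ∑ f^k / k!` for a power series `f` without constant term. -/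
def pexp (f : PowerSeries E) : PowerSeries E :=
  PowerSeries.mk fun n =>
    ∑ k ∈ Finset.range (n + 1), ((k.factorial : F)⁻¹) • PowerSeries.coeff n (f ^ k)

/-- `log f = ∑_{k ≥ 1} (-1)^{k+1} (f - 1)^k / k` for a power series `f` with constant term `1`. -/
def plog (f : PowerSeries E) : PowerSeries E :=
  PowerSeries.mk fun n =>
    ∑ k ∈ Finset.Icc 1 n, ((-1 : F) ^ (k + 1) / (k : F)) • PowerSeries.coeff n ((f - 1) ^ k)

/-- The power series `∑_{n ≥ 1} c n u^n`. -/
def posSeries (c : ℕ → E) : PowerSeries E :=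
  PowerSeries.mk fun n => if n = 0 then 0 else c n

/-- The power series `f(c u)`, for a central unit `c`. -/
def dil (c : Eˣ) (f : PowerSeries E) : PowerSeries E :=
  PowerSeries.mk fun n => ((c ^ n : Eˣ) : E) * PowerSeries.coeff n f

end Series

/-! ### Sums of rational series -/

section RationalSum

variable {V : Type*} [AddCommGroup V] [Module F V]

/-- On coefficient families `(a_m)` this is multiplication of `∑ a_m u^m` by `u`. -/
def shift : Module.End F (ℤ → V) := LinearMap.funLeft F V fun m => m - 1

/-- The family of coefficients of `P(u) ∑ a_m u^m`. -/
def polyMul (P : Polynomial F) (a : ℤ → V) : ℤ → V := Polynomial.aeval shift P a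

/-- The Laurent series `∑ a_m u^m` is the expansion at `u = 0` of a rational function
`N(u) / P(u)`, with `N` a Laurent polynomial and `P(c) ≠ 0`, whose value at `u = c` is `s`. -/
def HasRationalSum (c : F) (a : ℤ → V) (s : V) : Prop :=
  (∃ M : ℤ, ∀ m < M, a m = 0) ∧
  ∃ P : Polynomial F, P.eval c ≠ 0 ∧ (Function.support (polyMul P a)).Finite ∧
    s = (P.eval c)⁻¹ • ∑ᶠ m : ℤ, c ^ m • polyMul P a m

theorem polyMul_mul (P Q : Polynomial F) (a : ℤ → V) :
    polyMul (P * Q) a = polyMul P (polyMul Q a) := by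
  simp [polyMul]

theorem shift_sum (c : F) (hc : c ≠ 0) (f : ℤ → V) :
    ∑ᶠ m : ℤ, c ^ m • shift f m = c • ∑ᶠ m : ℤ, c ^ m • f m := by
  rw [smul_finsum]
  rw [← finsum_comp_equiv (Equiv.addRight (1 : ℤ))]
  refine finsum_congr fun m => ?_
  simp only [shift, LinearMap.funLeft_apply, Equiv.coe_addRight, add_sub_cancel_right]
  rw [zpow_add_one₀ hc, smul_smul, mul_comm]

theorem shift_support (f : ℤ → V) (hf : (Function.support f).Finite) :
    (Function.support (shift f)).Finite := by
  have h : Function.support (shift f) ⊆ (fun m : ℤ => m + 1) '' Function.support f := by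
    intro m hm
    exact ⟨m - 1, hm, by simp⟩
  exact (hf.image _).subset h

theorem polyMul_sum (c : F) (hc : c ≠ 0) (P : Polynomial F) :
    ∀ f : ℤ → V, (Function.support f).Finite →
      (Function.support (polyMul P f)).Finite ∧
        ∑ᶠ m : ℤ, c ^ m • polyMul P f m = P.eval c • ∑ᶠ m : ℤ, c ^ m • f m := by
  have smulsup : ∀ f : ℤ → V, (Function.support f).Finite →
      (Function.support fun m : ℤ => c ^ m • f m).Finite := fun f hf =>
    hf.subset fun m hm h => hm (by simp [h])
  induction P using Polynomial.induction_on' with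
  | add P Q hP hQ =>
    intro f hf
    obtain ⟨h1, h2⟩ := hP f hf
    obtain ⟨h3, h4⟩ := hQ f hf
    have e : polyMul (P + Q) f = polyMul P f + polyMul Q f := by simp [polyMul]
    rw [e]
    refine ⟨(h1.union h3).subset (Function.support_add _ _), ?_⟩
    simp only [Pi.add_apply, smul_add]
    rw [finsum_add_distrib (smulsup _ h1) (smulsup _ h3), h2, h4, Polynomial.eval_add, add_smul]
  | monomial n r =>
    intro f hf
    have e : polyMul (Polynomial.monomial n r) f = r • (shift ^ n : Module.End F (ℤ → V)) f := by
      simp [polyMul, Polynomial.aeval_monomial]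
    rw [e]
    have key : (Function.support ((shift ^ n : Module.End F (ℤ → V)) f)).Finite ∧
        ∑ᶠ m : ℤ, c ^ m • ((shift ^ n : Module.End F (ℤ → V)) f) m
          = c ^ n • ∑ᶠ m : ℤ, c ^ m • f m := by
      induction n with
      | zero => simpa using hf
      | succ n ih =>
        have ih' := ih (by simp [polyMul, Polynomial.aeval_monomial])
        rw [pow_succ', Module.End.mul_apply]
        refine ⟨shift_support _ ih'.1, ?_⟩
        rw [shift_sum c hc, ih'.2, smul_smul, pow_succ']
    refine ⟨key.1.subset (Function.support_const_smul_subset _ _), ?_⟩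
    have e2 : ∀ m : ℤ, c ^ m • (r • (shift ^ n : Module.End F (ℤ → V)) f) m
        = r • (c ^ m • ((shift ^ n : Module.End F (ℤ → V)) f) m) := fun m => by
      rw [Pi.smul_apply, smul_comm]
    rw [finsum_congr e2, ← smul_finsum, key.2, smul_smul, Polynomial.eval_monomial]

/-- The value of a rational series does not depend on the chosen denominator. -/
theorem HasRationalSum.unique {c : F} (hc : c ≠ 0) {a : ℤ → V} {s s' : V}
    (h : HasRationalSum c a s) (h' : HasRationalSum c a s') : s = s' := by
  obtain ⟨-, P, hP, fP, rfl⟩ := h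
  obtain ⟨-, Q, hQ, fQ, rfl⟩ := h'
  have h1 := (polyMul_sum c hc Q _ fP).2
  have h2 := (polyMul_sum c hc P _ fQ).2
  rw [← polyMul_mul] at h1 h2
  rw [mul_comm, h2] at h1
  rw [inv_smul_eq_iff₀ hP, smul_comm, eq_inv_smul_iff₀ hQ]
  exact h1.symm

open Classical in
/-- The value at `u = c` of the rational function with expansion `∑ a_m u^m`. -/
def ratSum (c : F) (a : ℤ → V) : V :=
  if h : ∃ s, HasRationalSum c a s then h.choose else 0

end RationalSum

/-! ### Currents acting on a representation -/

/-- A current `f(z) = ∑ f_n z^{-n}` of operators on `V`; `f n` is the coefficient of `z^{-n}`. -/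
abbrev Cur (V : Type*) : Type _ := ℤ → V → V

section Rep

variable {V : Type*} [AddCommGroup V] [Module F V]

/-- `f(c z)`, for a central unit `c`. -/
def Cur.subst (c : (Module.End F V)ˣ) (f : Cur V) : Cur V :=
  fun n v => ((c ^ (-n) : (Module.End F V)ˣ) : Module.End F V) (f n v)

/-- The current with the single coefficient `T`, in degree `0`. -/
def Cur.const (T : Module.End F V) : Cur V := fun n v => if n = 0 then T v else 0

/-- The summand with indices `(i, j)` in the coefficient of `z^{-n}` of `a(z) x(z) b(z) v`, where
`a(z) = ∑ a_i z^i` and `b(z) = ∑ b_j z^{-j}`. -/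
def dressTerm (a : PowerSeries (Module.End F V)) (x : Cur V) (b : PowerSeries (Module.End F V))
    (n : ℤ) (v : V) (ij : ℕ × ℕ) : V :=
  PowerSeries.coeff ij.1 a (x (n + ij.1 - ij.2) (PowerSeries.coeff ij.2 b v))

/-- The current `a(z) x(z) b(z)`, where `a` is a series in `z` and `b` a series in `z⁻¹`. -/
def dress (a : PowerSeries (Module.End F V)) (x : Cur V) (b : PowerSeries (Module.End F V)) :
    Cur V :=
  fun n v => ∑ᶠ ij : ℕ × ℕ, dressTerm a x b n v ij

/-- The coefficients of `x(c z) x(z)` are `∑_m c^{-m} x_m x_{n-m}`. The sum over `m` is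
understood as the value at `u = c⁻¹` of the rational function `∑_m u^m x_m x_{n-m} v`. -/
def curSq (c : F) (x : Cur V) : Cur V :=
  fun n v => ratSum c⁻¹ fun m => x m (x (n - m) v)

/-- The `k`-th summand in the coefficient of `z^{-m} w^{-n}` of `a(w/z) f(z) h(w) v`. -/
def exchTerm (a : PowerSeries (Module.End F V)) (f h : Cur V) (m n : ℤ) (v : V) (k : ℕ) : V :=
  PowerSeries.coeff k a (f (m - k) (h (n + k) v))

/-- The coefficient of `z^{-m} w^{-n}` in `a(w/z) f(z) h(w)`, for a power series `a`.
With `m` and `n` exchanged it is the coefficient of `z^{-m} w^{-n}` in `a(z/w) f(w) h(z)`. -/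
def exch (a : PowerSeries (Module.End F V)) (f h : Cur V) (m n : ℤ) (v : V) : V :=
  ∑ᶠ k : ℕ, exchTerm a f h m n v k

/-- The coefficient of `z^{-m} w^{-n}` in `δ(c w/z) f(z)`, where `δ(u) = ∑_{j ∈ ℤ} u^j` and `c`
is a central unit: only `j = -n` contributes. -/
def deltaZ (c : (Module.End F V)ˣ) (f : Cur V) (m n : ℤ) (v : V) : V :=
  ((c ^ (-n) : (Module.End F V)ˣ) : Module.End F V) (f (m + n) v)

/-- The coefficient of `z^{-m} w^{-n}` in `δ(c w/z) f(w)`: only `j = m` contributes. -/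
def deltaW (c : (Module.End F V)ˣ) (f : Cur V) (m n : ℤ) (v : V) : V :=
  ((c ^ m : (Module.End F V)ˣ) : Module.End F V) (f (m + n) v)

/-- All coefficients of the current `f` commute with the operator `T`. -/
def CommutesWith (f : Cur V) (T : Module.End F V) : Prop := ∀ n v, f n (T v) = T (f n v)

/-- The scalar `p` as a unit of `End V`. -/
def pU : (Module.End F V)ˣ :=
  Units.map (algebraMap F (Module.End F V)).toMonoidHom (Units.mk0 p p_ne_zero)

variable (ρ : U →ₐ[F] Module.End F V)

/-- Every vector is killed by all products of generators of sufficiently large total degree. -/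
def Admissible : Prop :=
  ∀ v : V, ∃ N : ℤ, ∀ l : List Gen, N < (l.map Gen.deg).sum → ρ ((l.map gen).prod) v = 0

/-- `γ^{1/2}` on `V`. -/
def gh : (Module.End F V)ˣ := Units.map (ρ : U →* Module.End F V) gamHalf

/-- `γ` on `V`. -/
def gamma : (Module.End F V)ˣ := gh ρ ^ 2

/-- `γ^n - γ^{-n}` on `V`. -/
def gammaDiff (n : ℕ) : Module.End F V :=
  ((gamma ρ ^ n : (Module.End F V)ˣ) : Module.End F V) -
    (((gamma ρ)⁻¹ ^ n : (Module.End F V)ˣ) : Module.End F V)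

def xP : Cur V := fun n v => ρ (gen (Gen.xp n)) v

def xM : Cur V := fun n v => ρ (gen (Gen.xm n)) v

/-- `ψ⁺(z)`, as a power series in `z⁻¹`. -/
def psiP : PowerSeries (Module.End F V) := PowerSeries.mk fun n => ρ (gen (Gen.psip n))

/-- `ψ⁻(z)`, as a power series in `z`. -/
def psiM : PowerSeries (Module.End F V) := PowerSeries.mk fun n => ρ (gen (Gen.psim n))

/-- `ψ⁺_0` on `V`. -/
def psiP0 : Module.End F V := ρ (gen (Gen.psip 0))

/-- `ψ⁻_0` on `V`. -/
def psiM0 : Module.End F V := ρ (gen (Gen.psim 0))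

/-- `b_n` (`n ≥ 1`), from `ψ⁺(z) = ψ⁺_0 exp(∑_{n>0} b_n γ^{n/2} z^{-n})`. -/
def bP (n : ℕ) : Module.End F V :=
  PowerSeries.coeff n (plog (PowerSeries.C (Ring.inverse (psiP0 ρ)) * psiP ρ)) *
    (((gh ρ)⁻¹ ^ n : (Module.End F V)ˣ) : Module.End F V)

/-- `b_{-n}` (`n ≥ 1`), from `ψ⁻(z) = ψ⁻_0 exp(-∑_{n>0} b_{-n} γ^{n/2} z^n)`. -/
def bM (n : ℕ) : Module.End F V :=
  -(PowerSeries.coeff n (plog (PowerSeries.C (Ring.inverse (psiM0 ρ)) * psiM ρ)) *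
    (((gh ρ)⁻¹ ^ n : (Module.End F V)ˣ) : Module.End F V))

/-- `α(z) = exp(-∑_{n ≥ 1} b_{-n} z^n / (γ^n - γ^{-n}))`, as a power series in `z`. -/
def alpha : PowerSeries (Module.End F V) :=
  pexp (posSeries fun n => -(Ring.inverse (gammaDiff ρ n) * bM ρ n))

/-- `β(z) = exp(∑_{n ≥ 1} b_n z^{-n} / (γ^n - γ^{-n}))`, as a power series in `z⁻¹`. -/
def beta : PowerSeries (Module.End F V) :=
  pexp (posSeries fun n => Ring.inverse (gammaDiff ρ n) * bP ρ n)

/-- `α(c z)`, as a power series in `z`. -/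
def alphaAt (c : (Module.End F V)ˣ) : PowerSeries (Module.End F V) := dil c (alpha ρ)

/-- `β(c z)`, as a power series in `z⁻¹`. -/
def betaAt (c : (Module.End F V)ˣ) : PowerSeries (Module.End F V) := dil c⁻¹ (beta ρ)

/-- A series `a(z)` in `z`, a current `x(z)` and a series `b(z)` in `z⁻¹`: the data of a dressed
current `a(z) x(z) b(z)`. -/
structure DressData (V : Type*) [AddCommGroup V] [Module F V] where
  left : PowerSeries (Module.End F V)
  mid : Cur V
  right : PowerSeries (Module.End F V)

/-- The current `a(z) x(z) b(z)` of such data. -/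
def DressData.cur (D : DressData V) : Cur V := dress D.left D.mid D.right

/-- The sums defining the coefficients of `a(z) x(z) b(z)` are finite on every vector. -/
def DressData.Finite (D : DressData V) : Prop :=
  ∀ n v, (Function.support (dressTerm D.left D.mid D.right n v)).Finite

/-- `t(z) = α(z) x⁺(z) β(z)` -/
def tData : DressData V := ⟨alpha ρ, xP ρ, beta ρ⟩

/-- `t*(z) = α(p⁻¹z)⁻¹ x⁻(p⁻¹γ⁻¹z) β(γ⁻²p⁻¹z)⁻¹` -/
def tStarData : DressData V :=
  ⟨Ring.inverse (alphaAt ρ pU⁻¹),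
    (xM ρ).subst (pU⁻¹ * (gamma ρ)⁻¹),
    Ring.inverse (betaAt ρ ((gamma ρ)⁻¹ ^ 2 * pU⁻¹))⟩

/-- `t⁽²⁾(z) = α(pz) α(z) x⁺(pz) x⁺(z) β(pz) β(z)` -/
def t2Data : DressData V :=
  ⟨alphaAt ρ pU * alpha ρ, curSq p (xP ρ), betaAt ρ pU * beta ρ⟩

/-- `t*⁽²⁾(z) =
  α(p⁻²z)⁻¹ α(p⁻¹z)⁻¹ x⁻(γ⁻¹p⁻²z) x⁻(γ⁻¹p⁻¹z) β(γ⁻²p⁻²z)⁻¹ β(γ⁻²p⁻¹z)⁻¹` -/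
def tStar2Data : DressData V :=
  ⟨Ring.inverse (alphaAt ρ (pU⁻¹ ^ 2)) * Ring.inverse (alphaAt ρ pU⁻¹),
    (curSq p⁻¹ (xM ρ)).subst ((gamma ρ)⁻¹ * pU⁻¹),
    Ring.inverse (betaAt ρ ((gamma ρ)⁻¹ ^ 2 * pU⁻¹ ^ 2)) *
      Ring.inverse (betaAt ρ ((gamma ρ)⁻¹ ^ 2 * pU⁻¹))⟩

/-- `t(z)` -/
def tCur : Cur V := (tData ρ).cur

/-- `t*(z)` -/
def tStar : Cur V := (tStarData ρ).cur

/-- `t⁽²⁾(z)` -/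
def t2 : Cur V := (t2Data ρ).cur

/-- `t*⁽²⁾(z)` -/
def tStar2 : Cur V := (tStar2Data ρ).cur

/-- `A(z) = exp(∑_{n ≥ 1} (1/n) (1-q^n)(1-t^{-n})(1-p^{-n}γ^{-2n})/(1-γ^{-2n}) z^n)`. -/
def Aser : PowerSeries (Module.End F V) :=
  pexp (posSeries fun n =>
    ((1 - q ^ n) * (1 - t⁻¹ ^ n) / (n : F)) •
      ((1 - p⁻¹ ^ n • (((gamma ρ)⁻¹ ^ (2 * n) : (Module.End F V)ˣ) : Module.End F V)) *
        Ring.inverse (1 - (((gamma ρ)⁻¹ ^ (2 * n) : (Module.End F V)ˣ) : Module.End F V))))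

/-- `B(z) = exp(∑_{n ≥ 1} (1/n)
  (1-q^n)(1-t^{-n})(p^{-2n}γ^{-2n}-p^{-n}γ^{-2n})/(1-γ^{-2n}) z^n)`. -/
def Bser : PowerSeries (Module.End F V) :=
  pexp (posSeries fun n =>
    ((1 - q ^ n) * (1 - t⁻¹ ^ n) / (n : F)) •
      (((p⁻¹ ^ (2 * n) - p⁻¹ ^ n) •
          (((gamma ρ)⁻¹ ^ (2 * n) : (Module.End F V)ˣ) : Module.End F V)) *
        Ring.inverse (1 - (((gamma ρ)⁻¹ ^ (2 * n) : (Module.End F V)ˣ) : Module.End F V))))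

/-- `B(γ²p² z)` -/
def Bdil : PowerSeries (Module.End F V) := dil (gamma ρ ^ 2 * pU ^ 2) (Bser ρ)

/-- Every infinite sum that enters the exchange relations makes sense: the products
`x⁺(pz)x⁺(z)` and `x⁻(p⁻¹z)x⁻(z)` exist as values of rational functions, and all the other sums
are finite on every vector. -/
def AllSumsDefined : Prop :=
  (∀ n v, ∃ s, HasRationalSum p⁻¹ (fun m => xP ρ m (xP ρ (n - m) v)) s) ∧
  (∀ n v, ∃ s, HasRationalSum p (fun m => xM ρ m (xM ρ (n - m) v)) s) ∧
  (tData ρ).Finite ∧ (tStarData ρ).Finite ∧ (t2Data ρ).Finite ∧ (tStar2Data ρ).Finite ∧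
  (∀ m n v, (Function.support (exchTerm (Aser ρ) (tCur ρ) (tCur ρ) m n v)).Finite) ∧
  (∀ m n v, (Function.support (exchTerm (Aser ρ) (tStar ρ) (tStar ρ) m n v)).Finite) ∧
  (∀ m n v, (Function.support (exchTerm (Bser ρ) (tCur ρ) (tStar ρ) m n v)).Finite) ∧
  (∀ m n v, (Function.support (exchTerm (Bdil ρ) (tStar ρ) (tCur ρ) m n v)).Finite)

end Rep

end DingIohara

end

open DingIohara

/-! The theorem is a vertex operator computation: `x⁺` and `x⁻` are dressed by exponentials of
Heisenberg generators so that the dressed currents commute with the Heisenberg algebra, and the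
exchange relations are read off after normal ordering.

Write `P` and `M` for the logarithms of the right and left dressings. In logarithmic form the
relations of `ψ^±` with the currents say `[P_k, x_n] = -c_k x_{n+k}` and `[M_k, x_n] = c_k x_{n-k}`,
and the relation of `ψ⁺` with `ψ⁻` says `[P_k, M_l] = δ_{kl} c_k`. The same central `c_k` occurs
three times (`IsDressing`, verified in `isDressing_t` and `isDressing_star`), so in the bracket of
`P_k` or `M_k` with the dressed current two contributions cancel. This gives (1). The passage
between exponentials and logarithms is made by `IsExp.shift_iff` and `IsExp.heisenberg_iff`.

Because of (1), a product of two dressed currents is normal ordered at the cost of one central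
factor `f(w/z)` (`dress_dress`). The series `A` and `B` are made to meet this factor. For two copies
of `t` or of `t*`, `A f` no longer contains `γ`; it equals `(1 - a u)(1 - b u) / ((1 - u)(1 - a b
u))` with `(a, b) = (q, t⁻¹)` or `(q⁻¹, t)`. In the mixed case `B f = 1`, and likewise in the
opposite order.

Relation (2) thus becomes a statement about the bare currents, `cross_reflection`. By the cubic
relation, the cubic times a matrix element of `x(z)x(w)` is an antisymmetric Laurent polynomial.
What remains is a rational function with poles at `1`, `r` and `1/r`, where `r = a b`, and the
difference of its two expansions is a sum of delta functions at the poles. Antisymmetry removes the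
pole at `1` and expresses the other two through the value `x(rz)x(z)`.

Relation (3) becomes the bracket of `x⁺` with the rescaled `x⁻`. On the support of each delta
function the dressings cancel `ψ^±` except for the zero mode (`mixed_relation`).

Two devices run throughout. A filtration of `V` by degree makes every sum finite on each vector, and
the double commutant of the representation contains all operators that occur, including the inverses
adjoined by hypothesis. -/

noncomputable section

set_option linter.unusedSectionVars false

namespace DingIohara

open PowerSeries Finset


/-! ### Exponentials and logarithms of power series over a noncommutative algebra -/

section Exponentials

variable {E : Type*} [Ring E] [Algebra F E]

theorem nsmul_cancel {n : ℕ} (hn : n ≠ 0) {a b : E} (h : n • a = n • b) : a = b := by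
  have h2 : ((n : F)⁻¹) • ((n : F) • a) = ((n : F)⁻¹) • ((n : F) • b) := by
    rw [Nat.cast_smul_eq_nsmul, Nat.cast_smul_eq_nsmul, h]
  rwa [inv_smul_smul₀ (Nat.cast_ne_zero.2 hn), inv_smul_smul₀ (Nat.cast_ne_zero.2 hn)] at h2

/-- The Euler operator `u d/du`. -/
def euler (f : PowerSeries E) : PowerSeries E := PowerSeries.mk fun n => n • coeff n f

@[simp] theorem coeff_euler (f : PowerSeries E) (n : ℕ) :
    coeff n (euler f) = n • coeff n f := by simp [euler]

theorem euler_add (f h : PowerSeries E) : euler (f + h) = euler f + euler h := by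
  ext n; simp

theorem euler_neg (f : PowerSeries E) : euler (-f) = -euler f := by
  ext n; simp

theorem euler_sub (f h : PowerSeries E) : euler (f - h) = euler f - euler h := by
  ext n; simp [smul_sub]

theorem euler_mul (f h : PowerSeries E) : euler (f * h) = euler f * h + f * euler h := by
  ext n
  simp only [coeff_euler, coeff_mul, map_add, smul_sum, ← sum_add_distrib]
  refine sum_congr rfl fun ij hij => ?_
  rw [← mem_antidiagonal.1 hij, smul_mul_assoc, mul_smul_comm, add_smul]

theorem euler_one : euler (1 : PowerSeries E) = 0 := by
  ext n
  rcases n with _ | n <;> simp [coeff_one]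

theorem euler_C (a : E) : euler (C a) = 0 := by
  ext n
  rcases n with _ | n <;> simp [coeff_C]

theorem euler_pow_succ {f : PowerSeries E} (h : Commute f (euler f)) (k : ℕ) :
    euler (f ^ (k + 1)) = (k + 1) • (euler f * f ^ k) := by
  induction k with
  | zero => simp
  | succ k ih =>
    rw [pow_succ, euler_mul, ih, smul_mul_assoc, mul_assoc, ← pow_succ, ← (h.pow_left (k + 1)).eq]
    rw [add_smul (k + 1) 1, one_smul, (h.pow_left (k + 1)).eq]

/-- The coefficients of `f` and `h` commute. -/
def CoeffCommute (f h : PowerSeries E) : Prop := ∀ i j, Commute (coeff i f) (coeff j h)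

theorem CoeffCommute.symm {f h : PowerSeries E} (H : CoeffCommute f h) : CoeffCommute h f :=
  fun i j => (H j i).symm

theorem CoeffCommute.commute {f h : PowerSeries E} (H : CoeffCommute f h) : Commute f h := by
  ext n
  rw [coeff_mul, coeff_mul, ← Finset.Nat.sum_antidiagonal_swap]
  exact sum_congr rfl fun ij _ => (H _ _).eq

theorem CoeffCommute.euler_left {f h : PowerSeries E} (H : CoeffCommute f h) :
    CoeffCommute (euler f) h := fun i j => by
  rw [coeff_euler]; exact (H i j).smul_left i

theorem CoeffCommute.euler_right {f h : PowerSeries E} (H : CoeffCommute f h) :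
    CoeffCommute f (euler h) := H.symm.euler_left.symm

/-- Writing `f = X e` with `X` central exhibits the order of vanishing. It makes the truncations in
`pexp` and `plog` harmless. -/
theorem coeff_pow_mul_eq_zero {f : PowerSeries E} (hf : coeff 0 f = 0) (h : PowerSeries E)
    {n k : ℕ} (hnk : n < k) : coeff n (h * f ^ k) = 0 := by
  have hX : ∃ e : PowerSeries E, f = PowerSeries.X * e := by
    have := (PowerSeries.X_dvd_iff (φ := f)).2 (by simpa using hf)
    exact this
  obtain ⟨e, rfl⟩ := hX
  have hc : Commute (PowerSeries.X : PowerSeries E) e := PowerSeries.commute_X _ |>.symm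
  rw [hc.mul_pow, ← mul_assoc, (PowerSeries.commute_X_pow h k).eq, mul_assoc,
    PowerSeries.coeff_X_pow_mul', if_neg (by omega)]

theorem coeff_pow_eq_zero' {f : PowerSeries E} (hf : coeff 0 f = 0)
    {n k : ℕ} (hnk : n < k) : coeff n (f ^ k) = 0 := by
  simpa using coeff_pow_mul_eq_zero hf 1 hnk

/-- `Φ = exp(b)`, in the form `Φ(0) = 1` and `u Φ' = (u b') Φ`; the constant term of `b` is
irrelevant. -/
structure IsExp (b Φ : PowerSeries E) : Prop where
  zero : coeff 0 Φ = 1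
  eq : euler Φ = euler b * Φ

/-- A single truncation serves all coefficients up to `m`, so that the Euler operator can be applied
to a finite sum. -/
theorem coeff_pexp_of_le {f : PowerSeries E} (hf : coeff 0 f = 0) {n m : ℕ} (h : n ≤ m) :
    coeff n (pexp f) = coeff n (∑ k ∈ range (m + 1), ((k.factorial : F)⁻¹) • f ^ k) := by
  rw [pexp, coeff_mk, map_sum]
  simp only [PowerSeries.coeff_smul]
  refine sum_subset (range_subset_range.2 (by omega)) fun k _ hk => ?_
  rw [coeff_pow_eq_zero' hf (by simpa using hk), smul_zero]

theorem coeff_plog_of_le {f : PowerSeries E} (hf : coeff 0 f = 1) {n m : ℕ} (h : n ≤ m) :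
    coeff n (plog f)
      = coeff n (∑ k ∈ range m, ((-1 : F) ^ k / ((k + 1 : ℕ) : F)) • (f - 1) ^ (k + 1)) := by
  have h0 : coeff 0 (f - 1) = 0 := by rw [map_sub, hf, PowerSeries.coeff_zero_one, sub_self]
  rw [plog, coeff_mk, map_sum]
  simp only [PowerSeries.coeff_smul]
  have e : ∑ k ∈ Icc 1 n, ((-1 : F) ^ (k + 1) / (k : F)) • coeff n ((f - 1) ^ k)
      = ∑ k ∈ range n, ((-1 : F) ^ k / ((k + 1 : ℕ) : F)) • coeff n ((f - 1) ^ (k + 1)) := by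
    have := sum_Ico_add' (fun k : ℕ => ((-1 : F) ^ (k + 1) / (k : F)) • coeff n ((f - 1) ^ k))
      0 n 1
    rw [range_eq_Ico, show Icc 1 n = Ico (0 + 1) (n + 1) by ext; simp, ← this]
    exact sum_congr rfl fun k _ => by rw [pow_succ (-1 : F), pow_succ (-1 : F)]; simp
  rw [e]
  refine sum_subset (range_subset_range.2 h) fun k _ hk => ?_
  rw [coeff_pow_eq_zero' h0 (by simp at hk; omega), smul_zero]

theorem coeff_mul_congr {f h h' : PowerSeries E} {n : ℕ}
    (H : ∀ m ≤ n, coeff m h = coeff m h') : coeff n (f * h) = coeff n (f * h') := by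
  rw [coeff_mul, coeff_mul]
  exact sum_congr rfl fun ij hij => by rw [H _ (by have := mem_antidiagonal.1 hij; omega)]

theorem coeff_mul_congr_left {f h h' : PowerSeries E} {n : ℕ}
    (H : ∀ m ≤ n, coeff m h = coeff m h') : coeff n (h * f) = coeff n (h' * f) := by
  rw [coeff_mul, coeff_mul]
  exact sum_congr rfl fun ij hij => by rw [H _ (by have := mem_antidiagonal.1 hij; omega)]

theorem euler_smul (a : F) (f : PowerSeries E) : euler (a • f) = a • euler f := by
  ext n; simp [smul_comm]

theorem euler_sum {ι : Type*} (s : Finset ι) (f : ι → PowerSeries E) :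
    euler (∑ i ∈ s, f i) = ∑ i ∈ s, euler (f i) := by
  ext n; simp [smul_sum]

theorem isExp_pexp {f : PowerSeries E} (hf : coeff 0 f = 0) (hc : CoeffCommute f f) :
    IsExp f (pexp f) := by
  constructor
  · simp [pexp]
  · ext n
    -- The left side is truncated one term later than the right, because `euler` turns `f ^ (k + 1)`
    -- into a multiple of `f ^ k`.
    rw [coeff_mul_congr (fun m hm => coeff_pexp_of_le hf hm), coeff_euler,
      coeff_pexp_of_le hf (Nat.le_succ n), ← coeff_euler, euler_sum, sum_range_succ']
    have hcom := hc.euler_right.commute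
    simp only [euler_smul, euler_pow_succ hcom, pow_zero, euler_one, smul_zero, add_zero, mul_sum,
      mul_smul_comm]
    congr 1
    refine sum_congr rfl fun k _ => ?_
    rw [← Nat.cast_smul_eq_nsmul F, smul_smul, Nat.factorial_succ, Nat.cast_mul, mul_inv,
      mul_comm, ← mul_assoc, mul_inv_cancel₀ (Nat.cast_ne_zero.2 k.succ_ne_zero), one_mul]

theorem isExp_plog {f : PowerSeries E} (hf : coeff 0 f = 1) (hc : CoeffCommute f f) :
    IsExp (plog f) f := by
  refine ⟨hf, ?_⟩
  have h0 : coeff 0 (f - 1) = 0 := by rw [map_sub, hf, PowerSeries.coeff_zero_one, sub_self]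
  have he : euler (f - 1) = euler f := by rw [euler_sub, euler_one, sub_zero]
  have hcom : Commute (f - 1) (euler (f - 1)) := by
    rw [he]; exact hc.euler_right.commute.sub_left (Commute.one_left _)
  ext n
  have h1 : ∀ m ≤ n, coeff m (euler (plog f)) = coeff m (euler
      (∑ k ∈ range n, ((-1 : F) ^ k / ((k + 1 : ℕ) : F)) • (f - 1) ^ (k + 1))) := fun m hm => by
    rw [coeff_euler, coeff_plog_of_le hf hm, coeff_euler]
  rw [coeff_mul_congr_left h1, euler_sum]
  simp only [euler_smul, euler_pow_succ hcom]
  -- Since `f = 1 + (f - 1)`, multiplying the alternating geometric sum by `f` telescopes to `euler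
  -- f` and a remainder in `(f - 1) ^ N`.
  have h2 : ∀ N : ℕ, (∑ k ∈ range N, ((-1 : F) ^ k / ((k + 1 : ℕ) : F)) •
      ((k + 1) • (euler (f - 1) * (f - 1) ^ k))) * f
        = euler f - (-1 : F) ^ N • (euler (f - 1) * (f - 1) ^ N) := by
    intro N
    induction N with
    | zero => simp [he]
    | succ N ih =>
      rw [sum_range_succ, add_mul, ih, ← Nat.cast_smul_eq_nsmul F, smul_smul,
        div_mul_cancel₀ _ (Nat.cast_ne_zero.2 N.succ_ne_zero), pow_succ, pow_succ]
      have h4 : euler (f - 1) * (f - 1) ^ N * f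
          = euler (f - 1) * ((f - 1) ^ N * (f - 1)) + euler (f - 1) * (f - 1) ^ N := by
        noncomm_ring
      rw [smul_mul_assoc, h4, smul_add]
      simp
  rw [h2, map_sub, PowerSeries.coeff_smul]
  -- The truncation `N = n` suffices: `euler (f - 1)` has no constant term, so the remainder starts
  -- in degree `n + 1`.
  have h3 : coeff n (euler (f - 1) * (f - 1) ^ n) = 0 := by
    rw [coeff_mul]
    refine sum_eq_zero fun ij hij => ?_
    rcases Nat.eq_zero_or_pos ij.1 with h | h
    · rw [h, coeff_euler, zero_smul, zero_mul]
    · rw [coeff_pow_eq_zero' h0 (by have := mem_antidiagonal.1 hij; omega), mul_zero]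
  rw [h3, smul_zero, sub_zero]

theorem coeff_zero_plog (f : PowerSeries E) : coeff 0 (plog f) = 0 := by simp [plog]

/-- The coefficient of `u^n` reads `n Δ_n = ∑_{i ≥ 1} i b_i Δ_{n-i}`, so the constant term
determines the series. Uniqueness of exponentials and both commutation criteria reduce to this
recursion. -/
theorem eq_zero_of_euler_eq {b Δ : PowerSeries E} (h0 : coeff 0 Δ = 0)
    (h : euler Δ = euler b * Δ) : Δ = 0 := by
  ext n
  induction n using Nat.strong_induction_on with
  | _ n ih =>
    rcases Nat.eq_zero_or_pos n with rfl | hn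
    · simpa using h0
    · refine nsmul_cancel hn.ne' ?_
      rw [← coeff_euler, h, coeff_mul, map_zero, smul_zero]
      refine sum_eq_zero fun ij hij => ?_
      rcases Nat.eq_zero_or_pos ij.1 with h | h
      · rw [h, coeff_euler, zero_smul, zero_mul]
      · rw [ih _ (by have := mem_antidiagonal.1 hij; omega), map_zero, mul_zero]

namespace IsExp

variable {b b' Φ Φ' : PowerSeries E}

theorem unique (h : IsExp b Φ) (h' : IsExp b Φ') : Φ = Φ' := by
  refine sub_eq_zero.1 (eq_zero_of_euler_eq (b := b) ?_ ?_)
  · rw [map_sub, h.zero, h'.zero, sub_self]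
  · rw [euler_sub, h.eq, h'.eq, mul_sub]

theorem congr_log (h : IsExp b Φ) (hb : ∀ n, 1 ≤ n → coeff n b = coeff n b') : IsExp b' Φ := by
  refine ⟨h.zero, ?_⟩
  rw [h.eq]
  congr 1
  ext n
  rcases Nat.eq_zero_or_pos n with rfl | hn
  · simp
  · rw [coeff_euler, coeff_euler, hb n hn]

theorem one : IsExp (0 : PowerSeries E) 1 := by
  refine ⟨by simp, ?_⟩
  rw [euler_one]
  ext n; simp [euler]

/-- Commutation of `b'` with `Φ` is what the Leibniz rule needs in order to move `euler b'` to the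
left of `Φ`. -/
theorem mul (h : IsExp b Φ) (h' : IsExp b' Φ') (hc : CoeffCommute b' Φ) :
    IsExp (b + b') (Φ * Φ') := by
  constructor
  · have := h.zero; have := h'.zero
    simp_all
  · rw [euler_mul, h.eq, h'.eq, euler_add, add_mul, mul_assoc, ← mul_assoc Φ,
      ← hc.euler_left.commute.eq, mul_assoc]

/-- Graded submodules stable under multiplication contain the coefficients of `b` if and only if
they contain those of `exp(b)`. -/
theorem mem_of_log_mem (h : IsExp b Φ) (S : ℕ → Submodule F E) (h1 : 1 ∈ S 0)
    (hmul : ∀ i j x y, x ∈ S i → y ∈ S j → x * y ∈ S (i + j))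
    (hb : ∀ n, 1 ≤ n → coeff n b ∈ S n) (n : ℕ) : coeff n Φ ∈ S n := by
  induction n using Nat.strong_induction_on with
  | _ n ih =>
    rcases Nat.eq_zero_or_pos n with rfl | hn
    · rw [h.zero]; exact h1
    · have key : n • coeff n Φ ∈ S n := by
        rw [← coeff_euler, h.eq, coeff_mul]
        refine sum_mem fun ij hij => ?_
        have hij' := mem_antidiagonal.1 hij
        rcases Nat.eq_zero_or_pos ij.1 with h | h
        · rw [h, coeff_euler, zero_smul, zero_mul]; exact zero_mem _
        · rw [← hij']
          exact hmul _ _ _ _ (by rw [coeff_euler]; exact nsmul_mem (hb _ h) _) (ih _ (by omega))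
      have := (S n).smul_mem ((n : F)⁻¹) key
      rwa [← Nat.cast_smul_eq_nsmul F, inv_smul_smul₀ (Nat.cast_ne_zero.2 hn.ne')] at this

/-- The recursion for `Φ` is solved for `n b_n`: as `Φ_0 = 1`, this is the only term involving
`b_n`, and the remaining terms are controlled by induction. -/
theorem log_mem_of_mem (h : IsExp b Φ) (S : ℕ → Submodule F E)
    (hmul : ∀ i j x y, x ∈ S i → y ∈ S j → x * y ∈ S (i + j))
    (hΦ : ∀ n, coeff n Φ ∈ S n) (n : ℕ) (hn : 1 ≤ n) : coeff n b ∈ S n := by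
  induction n using Nat.strong_induction_on with
  | _ n ih =>
    have key : n • coeff n b ∈ S n := by
      have e : n • coeff n Φ
          = n • coeff n b + ∑ ij ∈ (antidiagonal n).erase (n, 0),
              coeff ij.1 (euler b) * coeff ij.2 Φ := by
        rw [← coeff_euler, h.eq, coeff_mul, ← add_sum_erase _ _ (a := (n, 0)) (by simp)]
        simp only [h.zero, mul_one, coeff_euler]
      rw [← sub_eq_iff_eq_add] at e
      rw [← e]
      refine sub_mem (nsmul_mem (hΦ n) _) (sum_mem fun ij hij => ?_)
      have h1 := mem_antidiagonal.1 (mem_of_mem_erase hij)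
      have h2 : ij.2 ≠ 0 := fun h2 => (ne_of_mem_erase hij) (Prod.ext (by simp; omega) h2)
      rcases Nat.eq_zero_or_pos ij.1 with h | h
      · rw [h, coeff_euler, zero_smul, zero_mul]; exact zero_mem _
      · rw [← h1]
        exact hmul _ _ _ _ (by rw [coeff_euler]; exact nsmul_mem (ih _ (by omega) h) _) (hΦ _)
    have := (S n).smul_mem ((n : F)⁻¹) key
    rwa [← Nat.cast_smul_eq_nsmul F, inv_smul_smul₀ (Nat.cast_ne_zero.2 (by omega))] at this

theorem mem_subalgebra (h : IsExp b Φ) (S : Subalgebra F E) (hb : ∀ n, 1 ≤ n → coeff n b ∈ S)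
    (n : ℕ) : coeff n Φ ∈ S :=
  h.mem_of_log_mem (fun _ => Subalgebra.toSubmodule S) S.one_mem
    (fun _ _ _ _ hx hy => S.mul_mem hx hy) hb n

theorem log_mem_subalgebra (h : IsExp b Φ) (S : Subalgebra F E) (hΦ : ∀ n, coeff n Φ ∈ S)
    (n : ℕ) (hn : 1 ≤ n) : coeff n b ∈ S :=
  h.log_mem_of_mem (fun _ => Subalgebra.toSubmodule S)
    (fun _ _ _ _ hx hy => S.mul_mem hx hy) hΦ n hn

/-- Centralizers are subalgebras, so commutation can be tested on logarithms. -/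
theorem commute_of_log (h : IsExp b Φ) {a : E} (hb : ∀ n, 1 ≤ n → Commute a (coeff n b)) (n : ℕ) :
    Commute a (coeff n Φ) := by
  have := h.mem_subalgebra (Subalgebra.centralizer F {a})
    (fun n hn => by rw [Subalgebra.mem_centralizer_iff]; rintro _ rfl; exact hb n hn) n
  rw [Subalgebra.mem_centralizer_iff] at this
  exact this a rfl

theorem commute_log (h : IsExp b Φ) {a : E} (hΦ : ∀ n, Commute a (coeff n Φ)) (n : ℕ)
    (hn : 1 ≤ n) : Commute a (coeff n b) := by
  have := h.log_mem_subalgebra (Subalgebra.centralizer F {a})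
    (fun n => by rw [Subalgebra.mem_centralizer_iff]; rintro _ rfl; exact hΦ n) n hn
  rw [Subalgebra.mem_centralizer_iff] at this
  exact this a rfl

theorem mul_eq_one (h : IsExp b Φ) (h' : IsExp (-b) Φ')
    (hb : CoeffCommute b Φ) : Φ * Φ' = 1 := by
  have h1 := h.mul h' (fun i j => by rw [map_neg]; exact (hb i j).neg_left)
  rw [add_neg_cancel] at h1
  exact h1.unique one

end IsExp

end Exponentials


/-! ### Exchange relations in exponential and in logarithmic form -/

section ExponentialCommutation

variable {E : Type*} [Ring E] [Algebra F E] {b d Φ φ : PowerSeries E}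

theorem eq_zero_of_mul_eq_zero' {f : PowerSeries E} (h0 : coeff 0 Φ = 1) (e : f * Φ = 0) :
    f = 0 := by
  ext n
  induction n using Nat.strong_induction_on with
  | _ n ih =>
    have h1 := congrArg (coeff n) e
    rw [coeff_mul, ← add_sum_erase _ _ (a := (n, 0)) (by simp), sum_eq_zero] at h1
    · simpa [h0] using h1
    · intro ij hij
      have h1 := mem_antidiagonal.1 (mem_of_mem_erase hij)
      have h2 : ij.2 ≠ 0 := fun h2 => (ne_of_mem_erase hij) (Prod.ext (by simp; omega) h2)
      rw [ih _ (by omega), map_zero, zero_mul]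

/-- The exchange relation `Φ(u) x_i Φ(u)⁻¹ = ∑ φ_k u^k x_{i+k}` is the exponential of `[b_k, x_i] =
d_k x_{i+k}`. The defect of the former satisfies a linear Euler equation whose source is a
combination of the defects `ε` of the latter. -/
theorem IsExp.shift_iff (hΦ : IsExp b Φ) (hφ : IsExp d φ) (h1 : CoeffCommute b φ)
    (h2 : CoeffCommute d φ) (x : ℕ → E) :
    (∀ m i, coeff m Φ * x i
      = ∑ kl ∈ antidiagonal m, coeff kl.1 φ * x (i + kl.1) * coeff kl.2 Φ) ↔
    ∀ k, 1 ≤ k → ∀ i, coeff k b * x i = x i * coeff k b + coeff k d * x (i + k) := by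
  set W : ℕ → PowerSeries E := fun i => PowerSeries.mk fun k => coeff k φ * x (i + k) with hW
  set ε : ℕ → ℕ → E := fun i k => coeff k b * x i - x i * coeff k b - coeff k d * x (i + k)
    with hε
  set N : ℕ → PowerSeries E := fun i => PowerSeries.mk fun n =>
    ∑ kr ∈ antidiagonal n, kr.1 • (coeff kr.2 φ * ε (i + kr.2) kr.1) with hN
  have hmid : ∀ i, euler b * W i - W i * euler b - euler (W i) = N i := by
    intro i
    ext n
    have e1 : coeff n (euler (W i))
        = ∑ kr ∈ antidiagonal n, kr.1 • (coeff kr.2 φ * (coeff kr.1 d * x (i + n))) := by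
      rw [coeff_euler, hW, coeff_mk, ← smul_mul_assoc, ← coeff_euler, hφ.eq, coeff_mul, sum_mul]
      refine sum_congr rfl fun kr _ => ?_
      rw [coeff_euler, smul_mul_assoc, smul_mul_assoc, (h2 _ _).eq, mul_assoc]
    rw [map_sub, map_sub, e1, coeff_mul, coeff_mul,
      ← Finset.Nat.sum_antidiagonal_swap (f := fun p => coeff p.1 (W i) * coeff p.2 (euler b)), hN, coeff_mk,
      ← sum_sub_distrib, ← sum_sub_distrib]
    refine sum_congr rfl fun kr hkr => ?_
    have hkr := mem_antidiagonal.1 hkr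
    simp only [Prod.fst_swap, Prod.snd_swap, hW, coeff_mk, coeff_euler, hε]
    rw [show i + kr.2 + kr.1 = i + n by omega, smul_mul_assoc, mul_smul_comm, ← smul_sub,
      ← smul_sub, ← mul_assoc (coeff kr.1 b), (h1 _ _).eq]
    congr 1
    noncomm_ring
  -- If the source `N i` vanishes, the defect solves a homogeneous equation with zero initial value.
  -- If the defect vanishes, so does `N i`, since `Φ` can be cancelled.
  have hΔ : ∀ i, euler (Φ * C (x i) - W i * Φ)
      = euler b * (Φ * C (x i) - W i * Φ) + N i * Φ := by
    intro i
    rw [← hmid, euler_sub, euler_mul, euler_mul, euler_C, hΦ.eq]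
    noncomm_ring
  have hst : (∀ m i, coeff m Φ * x i
      = ∑ kl ∈ antidiagonal m, coeff kl.1 φ * x (i + kl.1) * coeff kl.2 Φ) ↔
      ∀ i, Φ * C (x i) - W i * Φ = 0 := by
    rw [forall_comm]
    refine forall_congr' fun i => ?_
    rw [sub_eq_zero, PowerSeries.ext_iff]
    refine forall_congr' fun m => ?_
    rw [coeff_mul_C, coeff_mul]
    simp only [hW, coeff_mk]
  rw [hst]
  constructor
  · intro h
    have hN0 : ∀ i, N i = 0 := fun i => by
      have := hΔ i
      rw [h i, mul_zero, zero_add] at this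
      refine eq_zero_of_mul_eq_zero' hΦ.zero (this.symm.trans ?_)
      ext n; simp
    -- The coefficient of `u^n` in `N i` is `n ε i n` plus terms in `ε _ l` with `l < n`, so the
    -- defects vanish by induction.
    have key : ∀ n, 1 ≤ n → ∀ i, ε i n = 0 := by
      intro n
      induction n using Nat.strong_induction_on with
      | _ n ih =>
        intro hn i
        have h3 := congrArg (coeff n) (hN0 i)
        rw [hN, coeff_mk, ← add_sum_erase _ _ (a := (n, 0)) (by simp), sum_eq_zero] at h3
        · rw [hφ.zero, one_mul, add_zero, add_zero, map_zero] at h3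
          exact nsmul_cancel (n := n) (by omega) (h3.trans (smul_zero n).symm)
        · intro ij hij
          have h1 := mem_antidiagonal.1 (mem_of_mem_erase hij)
          have h2 : ij.2 ≠ 0 := fun h2 => (ne_of_mem_erase hij) (Prod.ext (by simp; omega) h2)
          rcases Nat.eq_zero_or_pos ij.1 with h | h
          · rw [h, zero_smul]
          · rw [ih _ (by omega) h, mul_zero, smul_zero]
    intro k hk i
    have := key k hk i
    rw [hε] at this
    simp only at this
    rwa [sub_sub, sub_eq_zero] at this
  · intro h i
    have hN0 : N i = 0 := by
      ext n
      rw [hN, coeff_mk, map_zero]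
      refine sum_eq_zero fun kr _ => ?_
      rcases Nat.eq_zero_or_pos kr.1 with h' | h'
      · rw [h', zero_smul]
      · have : ε (i + kr.2) kr.1 = 0 := by
          rw [hε]
          simp only
          rw [sub_sub, sub_eq_zero]
          exact h _ h' _
        rw [this, mul_zero, smul_zero]
    refine eq_zero_of_euler_eq (b := b) ?_ ?_
    · rw [map_sub, coeff_mul_C, coeff_mul, Finset.Nat.antidiagonal_zero, sum_singleton, hΦ.zero, hW,
        coeff_mk, hφ.zero]
      simp
    · rw [hΔ, hN0, zero_mul, add_zero]

/-- `[D, b_l] = δ_{l,k} e` with `e` central amounts to `[D, Φ_n] = e Φ_{n-k}`. -/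
theorem IsExp.heisenberg_iff (hΦ : IsExp b Φ) (D e : E) {k : ℕ} (hk : 1 ≤ k)
    (he : ∀ n, Commute e (coeff n b)) :
    (∀ n, D * coeff n Φ = coeff n Φ * D + if k ≤ n then e * coeff (n - k) Φ else 0) ↔
    ∀ l, 1 ≤ l → D * coeff l b = coeff l b * D + if l = k then e else 0 := by
  -- The inhomogeneous term `e Φ_{n-k}` is the coefficient of `u^n` in `e u^k Φ`. The method of
  -- `IsExp.shift_iff` is applied to the defect `D Φ - Φ D - e u^k Φ`.
  set R : PowerSeries E := C e * PowerSeries.X ^ k with hR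
  have hRc : ∀ n, coeff n R = if n = k then e else 0 := fun n => by
    rw [hR, coeff_C_mul, coeff_X_pow]; split_ifs <;> simp
  have hRΦ : ∀ n, coeff n (R * Φ) = if k ≤ n then e * coeff (n - k) Φ else 0 := fun n => by
    rw [hR, mul_assoc, coeff_C_mul, coeff_X_pow_mul']; split_ifs <;> simp
  set ε : PowerSeries E := C D * b - b * C D - R with hε
  have hRb : R * euler b = euler b * R := by
    refine (CoeffCommute.commute fun i j => ?_).eq
    rw [hRc, coeff_euler]
    split_ifs
    · exact (he j).smul_right _
    · exact Commute.zero_left _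
  have hΔ : euler (C D * Φ - Φ * C D - R * Φ)
      = euler b * (C D * Φ - Φ * C D - R * Φ) + euler ε * Φ := by
    rw [hε]
    simp only [euler_sub, euler_mul, euler_C, hΦ.eq]
    have : R * (euler b * Φ) = euler b * (R * Φ) := by rw [← mul_assoc, hRb, mul_assoc]
    rw [this]
    noncomm_ring
  have hst : (∀ n, D * coeff n Φ = coeff n Φ * D + if k ≤ n then e * coeff (n - k) Φ else 0) ↔
      C D * Φ - Φ * C D - R * Φ = 0 := by
    rw [sub_sub, sub_eq_zero, PowerSeries.ext_iff]
    refine forall_congr' fun n => ?_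
    rw [map_add, coeff_C_mul, coeff_mul_C, hRΦ]
  have hst2 : (∀ l, 1 ≤ l → D * coeff l b = coeff l b * D + if l = k then e else 0) ↔
      euler ε = 0 := by
    rw [PowerSeries.ext_iff]
    refine forall_congr' fun n => ?_
    rcases Nat.eq_zero_or_pos n with rfl | hn
    · simp
    · rw [coeff_euler, map_zero, hε, map_sub, map_sub, coeff_C_mul, coeff_mul_C, hRc, sub_sub,
        ← sub_eq_zero]
      refine ⟨fun h => by rw [h hn, smul_zero], fun h _ => nsmul_cancel (n := n) (by omega) ?_⟩
      rw [h, smul_zero]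
  rw [hst, hst2]
  constructor
  · intro h
    rw [h, mul_zero, zero_add] at hΔ
    refine eq_zero_of_mul_eq_zero' hΦ.zero (hΔ.symm.trans ?_)
    ext n; simp
  · intro h
    refine eq_zero_of_euler_eq (b := b) ?_ ?_
    · rw [map_sub, map_sub, coeff_C_mul, coeff_mul_C, hRΦ, if_neg (by omega), hΦ.zero]
      simp
    · rw [hΔ, h, zero_mul, add_zero]

end ExponentialCommutation

/-! ### Dilation and inversion of exponentials -/

section ExponentialOperations

variable {E : Type*} [Ring E] [Algebra F E] {b b' Φ Φ' : PowerSeries E}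

@[simp] theorem coeff_dil (c : Eˣ) (f : PowerSeries E) (n : ℕ) :
    coeff n (dil c f) = ((c ^ n : Eˣ) : E) * coeff n f := by simp [dil]

theorem euler_dil (c : Eˣ) (f : PowerSeries E) : euler (dil c f) = dil c (euler f) := by
  ext n; simp only [coeff_euler, coeff_dil, mul_smul_comm]

theorem dil_mul {c : Eˣ} {f : PowerSeries E} (hc : ∀ n, Commute (c : E) (coeff n f))
    (h : PowerSeries E) : dil c (f * h) = dil c f * dil c h := by
  ext n
  simp only [coeff_dil, coeff_mul, mul_sum]
  refine sum_congr rfl fun ij hij => ?_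
  rw [← mem_antidiagonal.1 hij, pow_add, Units.val_mul]
  have := ((hc ij.1).pow_left ij.2).eq
  rw [← Units.val_pow_eq_pow_val] at this
  rw [mul_assoc, ← mul_assoc _ (coeff ij.1 f), this]
  simp only [mul_assoc]

theorem dil_dil (c c' : Eˣ) (h : Commute c c') (f : PowerSeries E) :
    dil c (dil c' f) = dil (c * c') f := by
  ext n
  rw [coeff_dil, coeff_dil, coeff_dil, ← mul_assoc, h.mul_pow, Units.val_mul]

theorem dil_neg (c : Eˣ) (f : PowerSeries E) : dil c (-f) = -dil c f := by
  ext n; simp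

theorem IsExp.dil (h : IsExp b Φ) {c : Eˣ} (hc : ∀ n, Commute (c : E) (coeff n b)) :
    IsExp (dil c b) (DingIohara.dil c Φ) := by
  constructor
  · rw [coeff_dil, h.zero]; simp
  · rw [euler_dil, euler_dil, h.eq, dil_mul]
    intro n
    rw [coeff_euler]
    exact (hc n).smul_right _

theorem IsExp.of_mul_eq_one (h : IsExp b Φ) (h1 : Φ * Φ' = 1) (hb : CoeffCommute b Φ) :
    IsExp (-b) Φ' := by
  have h1' : coeff 0 Φ' = 1 := by
    have := congrArg (coeff 0) h1
    rw [coeff_mul, Finset.Nat.antidiagonal_zero, sum_singleton, h.zero, one_mul] at this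
    simpa using this
  refine ⟨h1', ?_⟩
  have e := congrArg euler h1
  rw [euler_mul, h.eq, euler_one, mul_assoc, h1, mul_one] at e
  have e2 : Φ * (euler b * Φ' + euler Φ') = 0 := by
    rw [mul_add, ← mul_assoc, ← hb.euler_left.commute.eq, mul_assoc, h1, mul_one, e]
  -- A right inverse with constant term `1` can be cancelled on the right, hence it is two-sided.
  have e3 : Φ' * Φ = 1 := by
    have : (Φ' * Φ - 1) * Φ' = 0 := by rw [sub_mul, mul_assoc, h1]; simp
    exact sub_eq_zero.1 (eq_zero_of_mul_eq_zero' h1' this)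
  have e4 := congrArg (Φ' * ·) e2
  simp only [← mul_assoc, e3, one_mul, mul_zero] at e4
  rw [euler_neg, neg_mul]
  exact eq_neg_of_add_eq_zero_right e4

theorem IsExp.coeffCommute (h : IsExp b Φ) (hb : CoeffCommute b b) : CoeffCommute b Φ :=
  fun i j => h.commute_of_log (fun n _ => hb i n) j

/-- The inverse is the exponential of `-b`, whose constant term is removed first because
`isExp_pexp` requires it to vanish. Being a unit ensures that `Ring.inverse` is a true inverse and
not the default value `0`. -/
theorem IsExp.exists_inverse (h : IsExp b Φ) (hb : CoeffCommute b b) :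
    IsUnit Φ ∧ IsExp (-b) (Ring.inverse Φ) := by
  set b0 : PowerSeries E := PowerSeries.mk fun n => if n = 0 then 0 else -coeff n b with hb0
  have hcc : CoeffCommute b0 b0 := fun i j => by
    simp only [hb0, coeff_mk]
    split_ifs <;> simp [hb i j]
  have h' : IsExp (-b) (pexp b0) := (isExp_pexp (by simp [hb0]) hcc).congr_log fun n hn => by
    rw [hb0, coeff_mk, if_neg (by omega), map_neg]
  have hb' : CoeffCommute (-b) (-b) := fun i j => by
    rw [map_neg, map_neg]; exact (hb i j).neg_left.neg_right
  have e1 := h.mul_eq_one h' (h.coeffCommute hb)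
  have e2 := h'.mul_eq_one (by rwa [neg_neg]) (h'.coeffCommute hb')
  have hu : IsUnit Φ := ⟨⟨Φ, pexp b0, e1, e2⟩, rfl⟩
  refine ⟨hu, h.of_mul_eq_one (Ring.mul_inverse_cancel _ hu) (h.coeffCommute hb)⟩

theorem IsExp.isUnit (h : IsExp b Φ) (hb : CoeffCommute b b) : IsUnit Φ :=
  (h.exists_inverse hb).1

theorem IsExp.inverse (h : IsExp b Φ) (hb : CoeffCommute b b) : IsExp (-b) (Ring.inverse Φ) :=
  (h.exists_inverse hb).2

theorem IsExp.map {b Φ : PowerSeries F} (h : IsExp b Φ) :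
    IsExp (PowerSeries.map (algebraMap F E) b) (PowerSeries.map (algebraMap F E) Φ) := by
  have he : ∀ f : PowerSeries F, euler (PowerSeries.map (algebraMap F E) f)
      = PowerSeries.map (algebraMap F E) (euler f) := fun f => by ext n; simp
  refine ⟨?_, ?_⟩
  · rw [coeff_map, h.zero, map_one]
  · rw [he, he, h.eq, map_mul]

theorem coeffCommute_scalar (f h : PowerSeries F) : CoeffCommute f h := fun _ _ => Commute.all _ _

end ExponentialOperations

/-! ### Logarithms of the structure functions -/

section ScalarSeries

/-- This is `-log(1 - a u) = ∑ a^n u^n / n`. The entry at `n = 0` is `1 / 0 = 0` by convention,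
which does no harm since constant terms of logarithms are irrelevant. -/
theorem isExp_geom (a : F) :
    IsExp (PowerSeries.mk fun n => a ^ n / n) (PowerSeries.mk fun n => a ^ n) := by
  refine ⟨by simp, ?_⟩
  ext n
  have e : ∀ m : ℕ, m • (a ^ m / (m : F)) = if m = 0 then 0 else a ^ m := fun m => by
    rcases Nat.eq_zero_or_pos m with rfl | hm
    · simp
    · have : (m : F) ≠ 0 := Nat.cast_ne_zero.2 hm.ne'
      rw [if_neg hm.ne', nsmul_eq_mul]; field_simp
  simp only [coeff_mul, coeff_euler, coeff_mk, e]
  rw [Finset.Nat.sum_antidiagonal_eq_sum_range_succ_mk, sum_range_succ']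
  simp only [Nat.add_eq_zero_iff, one_ne_zero, and_false, if_false, if_true,
    zero_mul, add_zero]
  rw [sum_congr rfl (g := fun _ => a ^ n)]
  · simp
  · intro k hk
    rw [← pow_add]
    congr 1
    simp at hk; omega

theorem geom_mul (a : F) :
    (PowerSeries.mk fun n => a ^ n) * (1 - C a * PowerSeries.X) = 1 := by
  ext n
  rw [mul_sub, mul_one, map_sub, ← mul_assoc, coeff_mk]
  rcases n with _ | n
  · simp
  · rw [coeff_succ_mul_X, coeff_mul_C, coeff_mk, coeff_one, if_neg n.succ_ne_zero, pow_succ,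
      sub_self]

theorem isExp_linear (a : F) :
    IsExp (PowerSeries.mk fun n => -(a ^ n / n)) (1 - C a * PowerSeries.X) := by
  have := (isExp_geom a).of_mul_eq_one (geom_mul a) (coeffCommute_scalar _ _)
  refine this.congr_log fun n _ => by simp

/-- The coefficients of `log g`. -/
def kap (n : ℕ) : F := (1 - q ^ n) * (1 - t⁻¹ ^ n) * (1 - p⁻¹ ^ n) / n

theorem q_ne_zero : q ≠ 0 := pow_ne_zero 2 qHalf_ne_zero

theorem t_ne_zero : t ≠ 0 := pow_ne_zero 2 tHalf_ne_zero

theorem isExp_Gplus : IsExp (PowerSeries.mk fun n => -((q ^ n + t⁻¹ ^ n + p⁻¹ ^ n) / n))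
    (Gplus : PowerSeries F) := by
  have h := ((isExp_linear q).mul (isExp_linear t⁻¹) (coeffCommute_scalar _ _)).mul
    (isExp_linear p⁻¹) (coeffCommute_scalar _ _)
  have e : (Gplus : PowerSeries F) = (1 - C q * PowerSeries.X) * (1 - C t⁻¹ * PowerSeries.X) *
      (1 - C p⁻¹ * PowerSeries.X) := by
    rw [Gplus, p, show (q / t)⁻¹ = q⁻¹ * t by field_simp]
    simp only [Polynomial.coe_mul, Polynomial.coe_sub, Polynomial.coe_one, Polynomial.coe_C,
      Polynomial.coe_X]
  rw [e]
  refine h.congr_log fun n _ => ?_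
  simp only [map_add, coeff_mk]
  ring

theorem isExp_Gminus : IsExp (PowerSeries.mk fun n => -((q⁻¹ ^ n + t ^ n + p ^ n) / n))
    (Gminus : PowerSeries F) := by
  have h := ((isExp_linear q⁻¹).mul (isExp_linear t) (coeffCommute_scalar _ _)).mul
    (isExp_linear p) (coeffCommute_scalar _ _)
  have e : (Gminus : PowerSeries F) = (1 - C q⁻¹ * PowerSeries.X) * (1 - C t * PowerSeries.X) *
      (1 - C p * PowerSeries.X) := by
    rw [Gminus, p, show q / t = q * t⁻¹ by field_simp]
    simp only [Polynomial.coe_mul, Polynomial.coe_sub, Polynomial.coe_one, Polynomial.coe_C,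
      Polynomial.coe_X]
  rw [e]
  refine h.congr_log fun n _ => ?_
  simp only [map_add, coeff_mk]
  ring

/-- The logarithms of `G⁺` and `G⁻` are power sums of `q, t⁻¹, p⁻¹` and of their inverses. As the
product of these three numbers is `1`, the difference of the power sums factors as in `kap`. -/
theorem isExp_g : IsExp (PowerSeries.mk kap) g := by
  have h0 : constantCoeff (Gminus : PowerSeries F) ≠ 0 := by
    rw [← coeff_zero_eq_constantCoeff_apply, isExp_Gminus.zero]; exact one_ne_zero
  have h1 := isExp_Gminus.of_mul_eq_one (PowerSeries.mul_inv_cancel _ h0) (coeffCommute_scalar _ _)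
  refine (isExp_Gplus.mul h1 (coeffCommute_scalar _ _)).congr_log fun n _ => ?_
  simp only [map_add, map_neg, coeff_mk, kap, p]
  have hq := q_ne_zero
  have ht := t_ne_zero
  simp only [inv_pow, div_pow, inv_div]
  have : q ^ n ≠ 0 := pow_ne_zero _ hq
  have : t ^ n ≠ 0 := pow_ne_zero _ ht
  rcases eq_or_ne (n : F) 0 with hn | hn
  · simp [hn]
  · field_simp
    ring

theorem isExp_g_inv : IsExp (PowerSeries.mk fun n => -kap n) g⁻¹ := by
  have h0 : constantCoeff g ≠ 0 := by
    rw [← coeff_zero_eq_constantCoeff_apply, isExp_g.zero]; exact one_ne_zero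
  exact (isExp_g.of_mul_eq_one (PowerSeries.mul_inv_cancel _ h0)
    (coeffCommute_scalar _ _)).congr_log fun n _ => by simp

/-- `(1 - a u)(1 - b u) / ((1 - u)(1 - a b u))` -/
def crossSeries (a b : F) : PowerSeries F :=
  (1 - C a * PowerSeries.X) * (1 - C b * PowerSeries.X) *
    ((PowerSeries.mk fun n => 1 ^ n) * PowerSeries.mk fun n => (a * b) ^ n)

/-- This series is what `A` becomes after multiplication by the contraction factor of two copies of
`t`, or of `t*` with inverted parameters. -/
theorem isExp_crossSeries (a b : F) :
    IsExp (PowerSeries.mk fun n => (1 - a ^ n) * (1 - b ^ n) / n) (crossSeries a b) := by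
  have h := ((isExp_linear a).mul (isExp_linear b) (coeffCommute_scalar _ _)).mul
    ((isExp_geom 1).mul (isExp_geom (a * b)) (coeffCommute_scalar _ _)) (coeffCommute_scalar _ _)
  refine h.congr_log fun n _ => ?_
  simp only [map_add, coeff_mk]
  ring

end ScalarSeries


/-! ### Rearrangement of finitely supported sums -/

section FiniteSums

variable {V : Type*} [AddCommGroup V]

theorem finsum_eq_sum_range {f : ℕ → V} {L : ℕ} (h : ∀ k, L ≤ k → f k = 0) :
    ∑ᶠ k, f k = ∑ k ∈ range L, f k :=
  finsum_eq_sum_of_support_subset _ fun k hk => by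
    by_contra hk'
    exact hk (h k (by simpa using hk'))

theorem finite_support_of_range {f : ℕ → V} {L : ℕ} (h : ∀ k, L ≤ k → f k = 0) :
    (Function.support f).Finite :=
  (range L).finite_toSet.subset fun k hk => by
    by_contra hk'
    exact hk (h k (by simpa using hk'))

/-- A double sum over a square, arranged by antidiagonals. -/
theorem sum_range_range_eq_sum_antidiagonal {g : ℕ → ℕ → V} {L : ℕ}
    (h : ∀ k l, L ≤ k + l → g k l = 0) :
    ∑ k ∈ range L, ∑ l ∈ range L, g k l = ∑ n ∈ range L, ∑ kl ∈ antidiagonal n, g kl.1 kl.2 := by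
  rw [← sum_product', sum_sigma']
  symm
  refine sum_of_injOn (fun x => x.2) ?_ ?_ ?_ ?_
  · rintro ⟨n, x⟩ hx ⟨n', x'⟩ hx' h
    simp only [coe_sigma, Set.mem_sigma_iff, mem_coe, HasAntidiagonal.mem_antidiagonal, mem_range] at hx hx' h
    subst h
    obtain ⟨-, rfl⟩ := hx
    obtain ⟨-, rfl⟩ := hx'
    rfl
  · rintro ⟨n, x⟩ hx
    simp only [coe_sigma, Set.mem_sigma_iff, mem_coe, HasAntidiagonal.mem_antidiagonal, mem_range] at hx
    simp only [mem_coe, mem_product, mem_range]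
    omega
  · intro x hx hx'
    refine h _ _ ?_
    by_contra hlt
    exact hx' ⟨⟨x.1 + x.2, x⟩, by simp; omega, rfl⟩
  · intro x _; rfl

end FiniteSums

/-! ### Rational functions and the difference of their two expansions -/

section Reflection

variable {V : Type*} [AddCommGroup V] [Module F V]

theorem shift_pow_apply (k : ℕ) (s : ℤ → V) (m : ℤ) :
    (shift ^ k : Module.End F (ℤ → V)) s m = s (m - k) := by
  induction k generalizing m with
  | zero => simp
  | succ k ih =>
    rw [pow_succ', Module.End.mul_apply, shift, LinearMap.funLeft_apply, ← shift, ih]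
    congr 1; push_cast; ring

theorem polyMul_apply {P : Polynomial F} {n : ℕ} (hP : P.natDegree < n) (s : ℤ → V) (m : ℤ) :
    polyMul P s m = ∑ k ∈ range n, P.coeff k • s (m - k) := by
  rw [polyMul, Polynomial.aeval_eq_sum_range' hP, LinearMap.sum_apply, Finset.sum_apply]
  refine sum_congr rfl fun k _ => ?_
  rw [LinearMap.smul_apply, Pi.smul_apply, shift_pow_apply]

/-- The coefficients of `f(u) ∑ s_m u^m`. -/
def serMul (f : PowerSeries F) (s : ℤ → V) (m : ℤ) : V := ∑ᶠ k : ℕ, coeff k f • s (m - k)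

theorem serMul_eq_sum (f : PowerSeries F) {s : ℤ → V} {M : ℤ} (hs : ∀ m < M, s m = 0) {m : ℤ}
    {L : ℕ} (hL : m - M < L) : serMul f s m = ∑ k ∈ range L, coeff k f • s (m - k) :=
  finsum_eq_sum_range fun k hk => by rw [hs _ (by omega), smul_zero]

theorem serMul_serMul (f h : PowerSeries F) {s : ℤ → V} {M : ℤ} (hs : ∀ m < M, s m = 0) (m : ℤ) :
    serMul f (serMul h s) m = serMul (f * h) s m := by
  have hs' : ∀ m < M, serMul h s m = 0 := fun m hm => by
    rw [serMul_eq_sum h hs (L := 0) (by simp; omega), sum_range_zero]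
  obtain ⟨L, hL⟩ : ∃ L : ℕ, m - M < L := ⟨(m - M + 1).toNat, by omega⟩
  rw [serMul_eq_sum f hs' hL, serMul_eq_sum (f * h) hs hL]
  have e : ∀ k ∈ range L, coeff k f • serMul h s (m - k)
      = ∑ l ∈ range L, (coeff k f * coeff l h) • s (m - k - l) := fun k _ => by
    rw [serMul_eq_sum h hs (L := L) (by omega), smul_sum]
    simp only [smul_smul]
  rw [sum_congr rfl e, sum_range_range_eq_sum_antidiagonal]
  · refine sum_congr rfl fun n _ => ?_
    rw [coeff_mul, sum_smul]
    refine sum_congr rfl fun kl hkl => ?_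
    have : ((n : ℕ) : ℤ) = kl.1 + kl.2 := by rw [← mem_antidiagonal.1 hkl]; push_cast; rfl
    rw [this, sub_sub]
  · intro k l hkl
    rw [hs _ (by omega), smul_zero]

theorem serMul_polynomial {P : Polynomial F} {n : ℕ} (hP : P.natDegree < n) (s : ℤ → V) (m : ℤ) :
    serMul (P : PowerSeries F) s m = polyMul P s m := by
  rw [polyMul_apply hP, serMul, finsum_eq_sum_range (L := n)]
  · simp only [Polynomial.coeff_coe]
  · intro k hk
    rw [Polynomial.coeff_coe, Polynomial.coeff_eq_zero_of_natDegree_lt (by omega), zero_smul]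

/-- `(1 - a u)(1 - b u)(1 - u / (a b))` -/
def cubic (a b : F) : Polynomial F :=
  (1 - Polynomial.C a * Polynomial.X) * (1 - Polynomial.C b * Polynomial.X) *
    (1 - Polynomial.C (a * b)⁻¹ * Polynomial.X)

theorem cubic_eq (a b : F) : cubic a b = 1 - Polynomial.C (a + b + (a * b)⁻¹) * Polynomial.X +
    Polynomial.C (a * b + a * (a * b)⁻¹ + b * (a * b)⁻¹) * Polynomial.X ^ 2 -
    Polynomial.C (a * b * (a * b)⁻¹) * Polynomial.X ^ 3 := by
  rw [cubic]
  simp only [map_add, map_mul]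
  ring

theorem natDegree_cubic_lt (a b : F) : (cubic a b).natDegree < 4 := by
  rw [cubic_eq]
  refine Nat.lt_succ_of_le ?_
  compute_degree

theorem coeff_cubic (a b : F) : (cubic a b).coeff 0 = 1 ∧ (cubic a b).coeff 1 = -(a + b + (a * b)⁻¹) ∧
    (cubic a b).coeff 2 = a * b + a * (a * b)⁻¹ + b * (a * b)⁻¹ ∧
    (cubic a b).coeff 3 = -(a * b * (a * b)⁻¹) := by
  rw [cubic_eq]
  generalize a + b + (a * b)⁻¹ = x
  generalize a * b + a * (a * b)⁻¹ + b * (a * b)⁻¹ = y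
  generalize a * b * (a * b)⁻¹ = z
  simp [Polynomial.coeff_one, Polynomial.coeff_X, Polynomial.coeff_X_pow]

/-- The extension to `k ∈ ℤ` of the coefficients of `1 / ((1 - u)(1 - r u)(1 - u / r))`. -/
def poleCoeff (r : F) (k : ℤ) : F :=
  ((1 - r) * (1 - r⁻¹))⁻¹ + ((1 - r⁻¹) * (1 - r⁻¹ ^ 2))⁻¹ * r ^ k +
    ((1 - r) * (1 - r ^ 2))⁻¹ * r⁻¹ ^ k

/-- The rational function `R(u) = 1 / ((1 - u)(1 - r u)(1 - u / r))` satisfies `R(1/u) = -u^3 R(u)`.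
For the extension of its coefficients to all integers this is a symmetry about `-3/2`. -/
theorem poleCoeff_reflect {r : F} (h0 : r ≠ 0) (h1 : 1 - r ≠ 0) (h2 : 1 - r ^ 2 ≠ 0) (k : ℤ) :
    poleCoeff r (-3 - k) = poleCoeff r k := by
  have h3 : r ^ 2 - 1 ≠ 0 := fun h => h2 (by linear_combination -h)
  have h4 : r - 1 ≠ 0 := fun h => h1 (by linear_combination -h)
  have hk : r ^ k ≠ 0 := zpow_ne_zero _ h0
  rw [poleCoeff, poleCoeff, zpow_sub₀ h0, zpow_sub₀ (inv_ne_zero h0), inv_zpow r k, inv_zpow r (-3),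
    show r ^ (-3 : ℤ) = (r ^ 3)⁻¹ by rw [zpow_neg]; norm_cast]
  have e1 : (1 - r⁻¹) = (r - 1) / r := by field_simp
  have e2 : (1 - r⁻¹ ^ 2) = (r ^ 2 - 1) / r ^ 2 := by field_simp
  have e3 : (1 - r) = -(r - 1) := by ring
  have e4 : (1 - r ^ 2) = -(r ^ 2 - 1) := by ring
  rw [e1, e2, e3, e4]
  field_simp
  ring

/-- The indices `-1` and `-2` form the gap between the expansion at `0`, with indices `k ≥ 0`, and
the expansion at infinity, with indices `k ≤ -3`. -/
theorem poleCoeff_neg_one {r : F} (h0 : r ≠ 0) (h1 : 1 - r ≠ 0) (h2 : 1 - r ^ 2 ≠ 0) :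
    poleCoeff r (-1) = 0 := by
  have h3 : r ^ 2 - 1 ≠ 0 := fun h => h2 (by linear_combination -h)
  have h4 : r - 1 ≠ 0 := fun h => h1 (by linear_combination -h)
  have h5 : r + 1 ≠ 0 := fun h => h3 (by linear_combination (r - 1) * h)
  rw [poleCoeff, zpow_neg_one, zpow_neg_one, inv_inv]
  have e1 : (1 - r⁻¹) = (r - 1) / r := by field_simp
  have e2 : (1 - r⁻¹ ^ 2) = (r - 1) * (r + 1) / r ^ 2 := by field_simp; ring
  have e3 : (1 - r) = -(r - 1) := by ring
  have e4 : (1 - r ^ 2) = -((r - 1) * (r + 1)) := by ring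
  rw [e1, e2, e3, e4]
  field_simp
  ring

theorem poleCoeff_neg_two {r : F} (h0 : r ≠ 0) (h1 : 1 - r ≠ 0) (h2 : 1 - r ^ 2 ≠ 0) :
    poleCoeff r (-2) = 0 := by
  rw [← poleCoeff_neg_one h0 h1 h2, ← poleCoeff_reflect h0 h1 h2 (-1)]; norm_num

theorem poleSeries_mul_cubic {a b : F} (h0 : a * b ≠ 0) (h1 : 1 - a * b ≠ 0)
    (h2 : 1 - (a * b) ^ 2 ≠ 0) :
    (PowerSeries.mk fun k : ℕ => poleCoeff (a * b) k) * (cubic a b : PowerSeries F)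
      = crossSeries a b := by
  set r := a * b with hr
  have h3 : r ^ 2 - 1 ≠ 0 := fun h => h2 (by linear_combination -h)
  have h4 : r - 1 ≠ 0 := fun h => h1 (by linear_combination -h)
  set A := ((1 - r) * (1 - r⁻¹))⁻¹ with hA
  set B := ((1 - r⁻¹) * (1 - r⁻¹ ^ 2))⁻¹ with hB
  set D := ((1 - r) * (1 - r ^ 2))⁻¹ with hD
  have e1 : (1 - r⁻¹) = (r - 1) / r := by field_simp
  have e2 : (1 - r⁻¹ ^ 2) = (r ^ 2 - 1) / r ^ 2 := by field_simp
  have e3 : (1 - r) = -(r - 1) := by ring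
  have e4 : (1 - r ^ 2) = -(r ^ 2 - 1) := by ring
  have h5 : r + 1 ≠ 0 := fun h => h3 (by linear_combination (r - 1) * h)
  have e5 : r ^ 2 - 1 = (r - 1) * (r + 1) := by ring
  -- `A`, `B`, `D` are partial fraction coefficients; `s1`, `s2`, `s3` compare the powers `u^0`,
  -- `u^1`, `u^2` in `A l2 l3 + B l1 l3 + D l1 l2 = 1`.
  have s1 : A + B + D = 1 := by
    rw [hA, hB, hD, e1, e2, e3, e4, e5]; field_simp; ring
  have s2 : A * (r + r⁻¹) + B * (1 + r⁻¹) + D * (1 + r) = 0 := by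
    rw [hA, hB, hD, e1, e2, e3, e4, e5]; field_simp; ring
  have s3 : A + B * r⁻¹ + D * r = 0 := by
    rw [hA, hB, hD, e1, e2, e3, e4, e5]; field_simp; ring
  have hser : (PowerSeries.mk fun k : ℕ => poleCoeff r k)
      = C A * (PowerSeries.mk fun k => 1 ^ k) + C B * (PowerSeries.mk fun k => r ^ k)
        + C D * (PowerSeries.mk fun k => r⁻¹ ^ k) := by
    ext k
    simp only [map_add, coeff_mk, coeff_C_mul, poleCoeff, one_pow, mul_one, zpow_natCast, hA, hB,
      hD]
  have hcub : (cubic a b : PowerSeries F) = (1 - C a * PowerSeries.X) *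
      (1 - C b * PowerSeries.X) * (1 - C r⁻¹ * PowerSeries.X) := by
    rw [cubic]
    simp only [Polynomial.coe_mul, Polynomial.coe_sub, Polynomial.coe_one, Polynomial.coe_C,
      Polynomial.coe_X, ← hr]
  have g1 := geom_mul (1 : F)
  have g2 := geom_mul r
  have g3 := geom_mul r⁻¹
  rw [hser, hcub, crossSeries]
  set G1 : PowerSeries F := PowerSeries.mk fun k => 1 ^ k
  set G2 : PowerSeries F := PowerSeries.mk fun k => r ^ k
  set G3 : PowerSeries F := PowerSeries.mk fun k => r⁻¹ ^ k
  set l1 : PowerSeries F := 1 - C 1 * PowerSeries.X with hl1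
  set l2 : PowerSeries F := 1 - C r * PowerSeries.X with hl2
  set l3 : PowerSeries F := 1 - C r⁻¹ * PowerSeries.X with hl3
  have key : C A * (l2 * l3) + C B * (l1 * l3) + C D * (l1 * l2) = 1 := by
    have c1 : (C A + C B + C D : PowerSeries F) = 1 := by rw [← map_add, ← map_add, s1, map_one]
    have c2 : (C A * (C r + C r⁻¹) + C B * (1 + C r⁻¹) + C D * (1 + C r) : PowerSeries F) = 0 := by
      rw [← map_one C, ← map_add, ← map_add, ← map_add, ← map_mul, ← map_mul, ← map_mul, ← map_add,
        ← map_add, s2, map_zero]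
    have c3 : (C A + C B * C r⁻¹ + C D * C r : PowerSeries F) = 0 := by
      rw [← map_mul, ← map_mul, ← map_add, ← map_add, s3, map_zero]
    have c4 : (C r * C r⁻¹ : PowerSeries F) = 1 := by
      rw [← map_mul, mul_inv_cancel₀ h0, map_one]
    rw [hl1, hl2, hl3, map_one]
    linear_combination c1 - PowerSeries.X * c2 + PowerSeries.X ^ 2 * c3 + C A * PowerSeries.X ^ 2 * c4
  have e6 : (C A * G1 + C B * G2 + C D * G3) * l3 = G1 * G2 := by
    have e7 : (C A * G1 + C B * G2 + C D * G3) * l3 * (l1 * l2) = 1 := by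
      linear_combination key + C A * l3 * l2 * g1 + C B * l3 * l1 * g2 + C D * l1 * l2 * g3
    linear_combination (G1 * G2) * e7 - (C A * G1 + C B * G2 + C D * G3) * l3 * G2 * l2 * g1
      - (C A * G1 + C B * G2 + C D * G3) * l3 * g2
  linear_combination (1 - C a * PowerSeries.X) * (1 - C b * PowerSeries.X) * e6

theorem finsum_int_eq_sum {f : ℤ → V} {L : ℕ} (h1 : ∀ k : ℕ, L ≤ k → f k = 0)
    (h2 : ∀ k : ℕ, L ≤ k → f (-1 - k) = 0) :
    ∑ᶠ k, f k = ∑ k ∈ range L, f k + ∑ k ∈ range L, f (-1 - k) := by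
  have e : ∀ L : ℕ, ∑ k ∈ Finset.Ico (-L : ℤ) L, f k
      = ∑ k ∈ range L, f k + ∑ k ∈ range L, f (-1 - k) := by
    intro L
    induction L with
    | zero => simp
    | succ L ih =>
      have : Finset.Ico (-(L + 1 : ℕ) : ℤ) (L + 1 : ℕ)
          = insert (-1 - L : ℤ) (insert (L : ℤ) (Finset.Ico (-L : ℤ) L)) := by
        ext k; simp; omega
      rw [this, sum_insert (by simp), sum_insert (by simp), ih, sum_range_succ,
        sum_range_succ]
      abel
  rw [← e]
  refine finsum_eq_sum_of_support_subset _ fun k hk => ?_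
  by_contra hk'
  refine hk ?_
  simp only [coe_Ico, Set.mem_Ico, not_and_or, not_le, not_lt] at hk'
  rcases hk' with h | h
  · have := h2 (-1 - k).toNat (by omega)
    rwa [show (-1 - ((-1 - k).toNat : ℤ)) = k by omega] at this
  · have := h1 k.toNat (by omega)
    rwa [show ((k.toNat : ℕ) : ℤ) = k by omega] at this

/-- The cubic times `s` is a sequence `y` that is bounded below and antisymmetric under `m ↦ d + 3 -
m`, hence a Laurent polynomial. Applying the cross series to `s` amounts to applying the pole series
to `y`. Subtracting the reflected value turns this one-sided convolution into one over all of `ℤ`,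
that is, into delta functions at the three poles. Antisymmetry of `y` kills the pole at `1` and ties
the other two to the single value `σ`. -/
theorem cross_reflection {a b : F} (h0 : a * b ≠ 0) (h1 : 1 - a * b ≠ 0)
    (h2 : 1 - (a * b) ^ 2 ≠ 0) (ha : 1 - a ≠ 0) (hb : 1 - b ≠ 0) {s : ℤ → V} {d : ℤ}
    (hs : ∃ M, ∀ m < M, s m = 0)
    (hrel : ∀ m, ∑ k ∈ range 4, (cubic a⁻¹ b⁻¹).coeff k • s (m + k)
      = ∑ k ∈ range 4, (cubic a b).coeff k • s (d - m - k)) :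
    ∃ σ, HasRationalSum (a * b)⁻¹ s σ ∧ ∀ m, serMul (crossSeries a b) s m
      - serMul (crossSeries a b) s (d - m)
        = ((1 - a) * (1 - b) / (1 - a * b)) • ((a * b) ^ (d - m) • σ - (a * b) ^ m • σ) := by
  obtain ⟨M, hM⟩ := hs
  have ha0 : a ≠ 0 := left_ne_zero_of_mul h0
  have hb0 : b ≠ 0 := right_ne_zero_of_mul h0
  set y := polyMul (cubic a b) s with hy
  -- Up to sign, `cubic a⁻¹ b⁻¹` is `cubic a b` with its coefficients reversed, so the exchange
  -- relation becomes antisymmetry of `y`. The shift `3` is the degree of the cubic.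
  have hyr : ∀ m, y m = -y (d + 3 - m) := by
    intro m
    have h := hrel (d - m)
    rw [hy, polyMul_apply (natDegree_cubic_lt a b), polyMul_apply (natDegree_cubic_lt a b)]
    simp only [sum_range_succ, sum_range_zero, coeff_cubic, zero_add] at h ⊢
    rw [show d - (d - m) - ((0 : ℕ) : ℤ) = m - (0 : ℕ) by ring,
      show d - (d - m) - ((1 : ℕ) : ℤ) = m - (1 : ℕ) by ring,
      show d - (d - m) - ((2 : ℕ) : ℤ) = m - (2 : ℕ) by ring,
      show d - (d - m) - ((3 : ℕ) : ℤ) = m - (3 : ℕ) by ring] at h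
    rw [← h]
    rw [show d - m + ((0 : ℕ) : ℤ) = d + 3 - m - (3 : ℕ) by push_cast; ring,
      show d - m + ((1 : ℕ) : ℤ) = d + 3 - m - (2 : ℕ) by push_cast; ring,
      show d - m + ((2 : ℕ) : ℤ) = d + 3 - m - (1 : ℕ) by push_cast; ring,
      show d - m + ((3 : ℕ) : ℤ) = d + 3 - m - (0 : ℕ) by push_cast; ring]
    have e1 : a⁻¹ + b⁻¹ + (a⁻¹ * b⁻¹)⁻¹ = a * b + a * (a * b)⁻¹ + b * (a * b)⁻¹ := by
      field_simp; ring
    have e2 : a⁻¹ * b⁻¹ + a⁻¹ * (a⁻¹ * b⁻¹)⁻¹ + b⁻¹ * (a⁻¹ * b⁻¹)⁻¹ = a + b + (a * b)⁻¹ := by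
      field_simp; ring
    have e3 : a⁻¹ * b⁻¹ * (a⁻¹ * b⁻¹)⁻¹ = 1 := by field_simp
    have e4 : a * b * (a * b)⁻¹ = 1 := mul_inv_cancel₀ h0
    rw [e1, e2, e3, e4]
    generalize a + b + (a * b)⁻¹ = x₁
    generalize a * b + a * (a * b)⁻¹ + b * (a * b)⁻¹ = x₂
    simp only [neg_smul, one_smul, neg_add_rev, neg_neg]
    abel
  have hy0 : ∀ m < M, y m = 0 := fun m hm => by
    rw [hy, polyMul_apply (natDegree_cubic_lt a b)]
    exact sum_eq_zero fun k _ => by rw [hM _ (by omega), smul_zero]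
  have hy1 : ∀ m, d + 3 - M < m → y m = 0 := fun m hm => by
    rw [hyr, hy0 _ (by omega), neg_zero]
  have hfin : (Function.support y).Finite := by
    refine (Set.finite_Icc M (d + 3 - M)).subset fun m hm => ?_
    by_contra h
    rw [Set.mem_Icc, not_and_or, not_le, not_le] at h
    exact hm (h.elim (hy0 m) (hy1 m))
  set r := a * b with hr
  have hPr : (cubic a b).eval r⁻¹ = (1 - b⁻¹) * (1 - a⁻¹) * (1 - r⁻¹ ^ 2) := by
    rw [cubic, hr]
    simp only [Polynomial.eval_mul, Polynomial.eval_sub, Polynomial.eval_one, Polynomial.eval_C,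
      Polynomial.eval_X]
    field_simp
  have f1 : 1 - b⁻¹ ≠ 0 := fun h => hb (by field_simp at h; linear_combination -h)
  have f2 : 1 - a⁻¹ ≠ 0 := fun h => ha (by field_simp at h; linear_combination -h)
  have f3 : 1 - r⁻¹ ^ 2 ≠ 0 := fun h => h2 (by
    have : r ^ 2 * (1 - r⁻¹ ^ 2) = 0 := by rw [h, mul_zero]
    field_simp at this; linear_combination -this)
  have f4 : 1 - r⁻¹ ≠ 0 := fun h => h1 (by
    have : r * (1 - r⁻¹) = 0 := by rw [h, mul_zero]
    field_simp at this; linear_combination -this)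
  have hPr0 : (cubic a b).eval r⁻¹ ≠ 0 := by
    rw [hPr]; exact mul_ne_zero (mul_ne_zero f1 f2) f3
  set Y : F → V := fun c => ∑ᶠ i : ℤ, c ^ i • y i with hY
  have hsup : ∀ c : ℤ → F, (Function.support fun i => c i • y i).Finite := fun c =>
    hfin.subset fun i hi h => hi (by simp [h])
  have hYrefl : ∀ c : F, c ≠ 0 → Y c = -(c ^ (d + 3) • Y c⁻¹) := by
    intro c hc
    rw [hY]
    simp only
    rw [← finsum_comp_equiv (Equiv.subLeft (d + 3)), smul_finsum, ← finsum_neg_distrib]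
    refine finsum_congr fun i => ?_
    rw [Equiv.subLeft_apply, hyr, sub_sub_cancel, smul_neg, smul_smul, zpow_sub₀ hc, inv_zpow,
      div_eq_mul_inv]
  refine ⟨((cubic a b).eval r⁻¹)⁻¹ • Y r⁻¹, ⟨⟨M, hM⟩, cubic a b, hPr0, hfin, rfl⟩, fun m => ?_⟩
  have hser : ∀ m, serMul (crossSeries a b) s m
      = serMul (PowerSeries.mk fun k : ℕ => poleCoeff r k) y m := fun m => by
    rw [← poleSeries_mul_cubic h0 h1 h2, ← serMul_serMul _ _ hM]
    congr 1
    exact funext fun m => serMul_polynomial (natDegree_cubic_lt a b) s m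
  -- The reflections of `poleCoeff` and of `y` turn the second series into the part `j ≤ -3` of the
  -- bilateral sum. The indices `-1` and `-2`, which account for `L + 2`, contribute nothing.
  have hdiff : serMul (crossSeries a b) s m - serMul (crossSeries a b) s (d - m)
      = ∑ᶠ j : ℤ, poleCoeff r j • y (m - j) := by
    obtain ⟨L, hL⟩ : ∃ L : ℕ, m - M < L ∧ d - m - M < L := ⟨(max (m - M) (d - m - M) + 1).toNat, by omega⟩
    rw [finsum_int_eq_sum (L := L + 2)]
    · rw [hser, hser, serMul_eq_sum _ hy0 (L := L + 2) (by push_cast; omega),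
        serMul_eq_sum _ hy0 hL.2]
      rw [sub_eq_add_neg]
      congr 1
      · simp only [coeff_mk]
      · rw [add_comm L 2, sum_range_add]
        simp only [sum_range_succ, sum_range_zero]
        rw [show (-1 - ((0 : ℕ) : ℤ)) = -1 by norm_num, show (-1 - ((1 : ℕ) : ℤ)) = -2 by norm_num,
          poleCoeff_neg_one h0 h1 h2, poleCoeff_neg_two h0 h1 h2, zero_smul, zero_smul, add_zero,
          zero_add, zero_add, ← sum_neg_distrib]
        refine sum_congr rfl fun k _ => ?_
        rw [coeff_mk, ← poleCoeff_reflect h0 h1 h2, ← smul_neg, hyr (d - m - k), neg_neg]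
        congr 2
        · push_cast; ring
        · push_cast; ring
    · intro k hk
      rw [hy0 _ (by omega), smul_zero]
    · intro k hk
      rw [hy1 _ (by omega), smul_zero]
  -- Antisymmetry gives `Y 1 = -Y 1`: the pole of the structure function at `z = w` leaves no delta
  -- function.
  have hY1 : Y 1 = 0 := by
    have := hYrefl 1 one_ne_zero
    rw [one_zpow, one_smul, inv_one] at this
    have h2 : (2 : F) • Y 1 = 0 := by rw [two_smul]; nth_rewrite 1 [this]; simp
    exact (smul_eq_zero.1 h2).resolve_left two_ne_zero
  have hsum : ∑ᶠ j : ℤ, poleCoeff r j • y (m - j)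
      = ((1 - r) * (1 - r⁻¹))⁻¹ • Y 1 + (((1 - r⁻¹) * (1 - r⁻¹ ^ 2))⁻¹ * r ^ m) • Y r⁻¹ +
        (((1 - r) * (1 - r ^ 2))⁻¹ * r⁻¹ ^ m) • Y r := by
    rw [← finsum_comp_equiv (Equiv.subLeft m)]
    simp only [Equiv.subLeft_apply, sub_sub_cancel]
    rw [hY]
    simp only
    rw [smul_finsum, smul_finsum, smul_finsum, ← finsum_add_distrib, ← finsum_add_distrib]
    · refine finsum_congr fun i => ?_
      rw [poleCoeff, zpow_sub₀ h0, zpow_sub₀ (inv_ne_zero h0), one_zpow, one_smul, smul_smul,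
        smul_smul, ← add_smul, ← add_smul]
      congr 1
      simp only [inv_zpow, div_eq_mul_inv, inv_inv]
      ring
    · simp only [smul_smul, ← add_smul]; exact hsup _
    · simp only [smul_smul]; exact hsup _
    · simp only [smul_smul]; exact hsup _
    · simp only [smul_smul]; exact hsup _
  rw [hdiff, hsum, hY1, hYrefl r h0, hPr, smul_zero, zero_add, smul_neg, smul_smul, smul_smul,
    smul_smul, ← sub_eq_add_neg, ← sub_smul, ← sub_smul, smul_smul]
  congr 1
  rw [zpow_sub₀ h0, inv_zpow, zpow_add₀ h0, show r ^ (3 : ℤ) = r ^ 3 by norm_cast]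
  have hm : r ^ m ≠ 0 := zpow_ne_zero _ h0
  set R := r ^ m
  set S := r ^ d
  have e1 : (1 - r⁻¹) = (r - 1) / r := by field_simp
  have e2 : (1 - r⁻¹ ^ 2) = (r ^ 2 - 1) / r ^ 2 := by field_simp
  have e3 : (1 - r) = -(r - 1) := by ring
  have e4 : (1 - r ^ 2) = -(r ^ 2 - 1) := by ring
  have e5 : (1 - a⁻¹) = -(1 - a) / a := by field_simp; ring
  have e6 : (1 - b⁻¹) = -(1 - b) / b := by field_simp; ring
  have h3 : r ^ 2 - 1 ≠ 0 := fun h => h2 (by linear_combination -h)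
  have h4 : r - 1 ≠ 0 := fun h => h1 (by linear_combination -h)
  have e7 : a = r / b := by rw [hr]; field_simp
  rw [e1, e2, e3, e4, e5, e6]
  field_simp
  rw [hr]
  ring

end Reflection


/-! ### Filtrations, homogeneous currents and dressing -/

/-- An exhaustive increasing filtration that vanishes in negative degrees. -/
structure Filt (V : Type*) [AddCommGroup V] [Module F V] where
  fl : ℤ → Submodule F V
  mono : Monotone fl
  bot : ∀ N < 0, fl N = ⊥
  exh : ∀ v, ∃ N, v ∈ fl N

section Filtered

variable {V : Type*} [AddCommGroup V] [Module F V] (fl : Filt V)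

/-- The map `f` lowers the filtration by `d`. -/
def OpDeg (d : ℤ) (f : V → V) : Prop := ∀ N v, v ∈ fl.fl N → f v ∈ fl.fl (N - d)

/-- The current `x` has degree `e`: its `n`-th coefficient has degree `n + e`. -/
def CurDeg (e : ℤ) (x : Cur V) : Prop := ∀ n, OpDeg fl (n + e) (x n)

/-- A series in `z` whose coefficients have the degrees of a homogeneous current. -/
def LeftDeg (a : PowerSeries (Module.End F V)) : Prop := ∀ i : ℕ, OpDeg fl (-i) ⇑(coeff i a)

/-- A series in `z⁻¹` whose coefficients have the degrees of a homogeneous current. -/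
def RightDeg (b : PowerSeries (Module.End F V)) : Prop := ∀ j : ℕ, OpDeg fl j ⇑(coeff j b)

/-- The current of a family of operators. -/
abbrev toCur (x : ℤ → Module.End F V) : Cur V := fun n v => x n v

variable {fl}

theorem Filt.eq_zero {N : ℤ} (hN : N < 0) {v : V} (hv : v ∈ fl.fl N) : v = 0 := by
  rwa [fl.bot N hN, Submodule.mem_bot] at hv

theorem OpDeg.eq_zero {d : ℤ} {f : V → V} (hf : OpDeg fl d f) {N : ℤ} {v : V}
    (hv : v ∈ fl.fl N) (h : N < d) : f v = 0 :=
  fl.eq_zero (by omega) (hf N v hv)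

theorem OpDeg.map_zero {d : ℤ} {f : V → V} (hf : OpDeg fl d f) : f 0 = 0 :=
  hf.eq_zero (fl.fl (d - 1)).zero_mem (by omega)

theorem OpDeg.comp {d e : ℤ} {f h : V → V} (hf : OpDeg fl d f) (hh : OpDeg fl e h) :
    OpDeg fl (d + e) fun v => f (h v) := fun N v hv => by
  have := hf _ _ (hh N v hv)
  rwa [show N - e - d = N - (d + e) by ring] at this

/-- The level obtained does not depend on `j`. Hence both indices of a dressed sum are bounded on a
given vector: `j` by the degree of `b`, and `i` by the degree of the product. -/
theorem dressTerm_mem {b : PowerSeries (Module.End F V)} {x : Cur V} {e : ℤ}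
    (hx : CurDeg fl e x) (hb : RightDeg fl b) {N : ℤ} {v : V} (hv : v ∈ fl.fl N) (n : ℤ)
    (i j : ℕ) : x (n + i - j) (coeff j b v) ∈ fl.fl (N - n - i - e) := by
  have := hx (n + i - j) _ _ (hb j _ _ hv)
  rwa [show N - j - (n + i - j + e) = N - n - i - e by ring] at this

theorem dressTerm_eq_zero {a b : PowerSeries (Module.End F V)} {x : Cur V} {e : ℤ}
    (hx : CurDeg fl e x) (hb : RightDeg fl b) {N : ℤ} {v : V} (hv : v ∈ fl.fl N) (n : ℤ)
    (i j : ℕ) (h : N - n - e < i ∨ N < j) : dressTerm a x b n v (i, j) = 0 := by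
  rw [dressTerm]
  rcases h with h | h
  · rw [fl.eq_zero (by omega) (dressTerm_mem hx hb hv n i j), map_zero]
  · simp only
    rw [(hb j).eq_zero hv h, (hx _).map_zero, map_zero]

theorem dressTerm_support {a b : PowerSeries (Module.End F V)} {x : Cur V} {e : ℤ}
    (hx : CurDeg fl e x) (hb : RightDeg fl b) {N : ℤ} {v : V} (hv : v ∈ fl.fl N) {n : ℤ}
    {L₁ L₂ : ℕ} (h₁ : N - n - e < L₁) (h₂ : N < L₂) :
    Function.support (dressTerm a x b n v) ⊆ ↑(range L₁ ×ˢ range L₂) := by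
  rintro ⟨i, j⟩ hij
  by_contra h
  simp only [coe_product, coe_range, Set.mem_prod, Set.mem_Iio, not_and_or, not_lt] at h
  exact hij (dressTerm_eq_zero hx hb hv n i j (by omega))

theorem dressTerm_finite {a b : PowerSeries (Module.End F V)} {x : Cur V} {e : ℤ}
    (hx : CurDeg fl e x) (hb : RightDeg fl b) (n : ℤ) (v : V) :
    (Function.support (dressTerm a x b n v)).Finite := by
  obtain ⟨N, hv⟩ := fl.exh v
  exact (finite_toSet _).subset (dressTerm_support hx hb hv (L₁ := (N - n - e + 1).toNat)
    (L₂ := (N + 1).toNat) (by omega) (by omega))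

theorem dress_eq_sum {a b : PowerSeries (Module.End F V)} {x : Cur V} {e : ℤ}
    (hx : CurDeg fl e x) (hb : RightDeg fl b) {N : ℤ} {v : V} (hv : v ∈ fl.fl N) {n : ℤ}
    {L₁ L₂ : ℕ} (h₁ : N - n - e < L₁) (h₂ : N < L₂) :
    dress a x b n v
      = ∑ i ∈ range L₁, ∑ j ∈ range L₂, coeff i a (x (n + i - j) (coeff j b v)) := by
  rw [dress, finsum_eq_sum_of_support_subset _ (dressTerm_support hx hb hv h₁ h₂), sum_product]
  rfl

theorem CurDeg.dress {a b : PowerSeries (Module.End F V)} {x : Cur V} {e : ℤ}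
    (hx : CurDeg fl e x) (ha : LeftDeg fl a) (hb : RightDeg fl b) :
    CurDeg fl e (dress a x b) := by
  intro n N v hv
  rw [dress_eq_sum hx hb hv (n := n) (L₁ := (N - n - e + 1).toNat) (L₂ := (N + 1).toNat)
    (by omega) (by omega)]
  refine sum_mem fun i _ => sum_mem fun j _ => ?_
  have := ha i _ _ (dressTerm_mem hx hb hv n i j)
  rwa [show N - n - i - e - -(i : ℤ) = N - (n + e) by ring] at this

theorem CurDeg.apply_eq_zero {x : ℤ → Module.End F V} (hx : CurDeg fl 0 (toCur x)) {N : ℤ} {v : V}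
    (hv : v ∈ fl.fl N) {n : ℤ} (h : N < n) : x n v = 0 :=
  (hx n).eq_zero hv (by omega)

theorem sum_sum_swap (s : Finset ℕ) (f : ℕ → ℕ → ℕ → ℕ → V) :
    ∑ a ∈ s, ∑ b ∈ s, ∑ c ∈ s, ∑ d ∈ s, f a b c d
      = ∑ c ∈ s, ∑ d ∈ s, ∑ a ∈ s, ∑ b ∈ s, f a b c d := by
  rw [sum_congr rfl fun a _ => sum_comm, sum_comm]
  refine sum_congr rfl fun c _ => ?_
  rw [sum_congr rfl fun a _ => sum_comm, sum_comm]

theorem exists_bound₂ (a b : ℤ) : ∃ L : ℕ, a < L ∧ b < L :=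
  ⟨(max a b + 1).toNat, by omega⟩

theorem exists_bound₃ (a b c : ℤ) : ∃ L : ℕ, a < L ∧ b < L ∧ c < L :=
  ⟨(max (max a b) c + 1).toNat, by omega⟩

/-- The dressed current of a family of operators consists of operators. -/
theorem dress_linear {a b : PowerSeries (Module.End F V)} {x : ℤ → Module.End F V} {e : ℤ}
    (hx : CurDeg fl e (toCur x)) (hb : RightDeg fl b) :
    ∃ T : ℤ → Module.End F V, dress a (toCur x) b = toCur T := by
  refine ⟨fun n => ⟨⟨dress a (toCur x) b n, fun v w => ?_⟩, fun c v => ?_⟩, rfl⟩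
  · obtain ⟨N, hv⟩ := fl.exh v
    obtain ⟨N', hw⟩ := fl.exh w
    have hv' := fl.mono (le_max_left N N') hv
    have hw' := fl.mono (le_max_right N N') hw
    obtain ⟨L, h1, h2⟩ := exists_bound₂ (max N N' - n - e) (max N N')
    rw [dress_eq_sum hx hb hv' h1 h2, dress_eq_sum hx hb hw' h1 h2,
      dress_eq_sum hx hb (add_mem hv' hw') h1 h2]
    simp only [map_add, sum_add_distrib]
  · obtain ⟨N, hv⟩ := fl.exh v
    obtain ⟨L, h1, h2⟩ := exists_bound₂ (N - n - e) N
    simp only [RingHom.id_apply]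
    rw [dress_eq_sum hx hb hv h1 h2, dress_eq_sum hx hb (Submodule.smul_mem _ c hv) h1 h2]
    simp only [map_smul, smul_sum]

theorem dress_commute {a b : PowerSeries (Module.End F V)} {x : ℤ → Module.End F V} {e : ℤ}
    (hx : CurDeg fl e (toCur x)) (hb : RightDeg fl b) {D : Module.End F V}
    (h1 : ∀ i, Commute D (coeff i a)) (h2 : ∀ n, Commute D (x n)) (h3 : ∀ j, Commute D (coeff j b))
    (n : ℤ) (v : V) : dress a (toCur x) b n (D v) = D (dress a (toCur x) b n v) := by
  obtain ⟨N, hv⟩ := fl.exh v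
  obtain ⟨N', hw⟩ := fl.exh (D v)
  have hv' := fl.mono (le_max_left N N') hv
  have hw' := fl.mono (le_max_right N N') hw
  obtain ⟨L, hL, hL'⟩ := exists_bound₂ (max N N' - n - e) (max N N')
  rw [dress_eq_sum hx hb hv' hL hL', dress_eq_sum hx hb hw' hL hL', map_sum]
  refine sum_congr rfl fun i _ => ?_
  rw [map_sum]
  refine sum_congr rfl fun j _ => ?_
  have e1 := fun w => LinearMap.congr_fun (h1 i).eq w
  have e2 := fun w => LinearMap.congr_fun (h2 (n + i - j)).eq w
  have e3 := fun w => LinearMap.congr_fun (h3 j).eq w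
  simp only [Module.End.mul_apply] at e1 e2 e3
  rw [e1, toCur, e2, e3]

theorem sum_range_add_shift {f : ℕ → V} (k L : ℕ) :
    ∑ i ∈ range (L + k), (if k ≤ i then f (i - k) else 0) = ∑ i ∈ range L, f i := by
  rw [add_comm L k, sum_range_add, sum_eq_zero, zero_add]
  · exact sum_congr rfl fun i _ => by simp
  · intro i hi
    rw [if_neg (by simpa using hi)]

/-- The bracket of `D` with `a` shifts the index of `a` by `k`, and the bracket with `x` shifts the
mode of `x`. After reindexing, the two contributions are opposite. The range `L + k` leaves room for
the shift. -/
theorem dress_commute_left {a b : PowerSeries (Module.End F V)} {x : ℤ → Module.End F V} {e : ℤ}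
    (hx : CurDeg fl e (toCur x)) (hb : RightDeg fl b) {D c : Module.End F V} {k : ℕ}
    (h1 : ∀ i, D * coeff i a = coeff i a * D + if k ≤ i then c * coeff (i - k) a else 0)
    (h2 : ∀ n, D * x n = x n * D - c * x (n + k)) (h3 : ∀ j, Commute D (coeff j b))
    (hc : ∀ i, Commute c (coeff i a))
    (n : ℤ) (v : V) : dress a (toCur x) b n (D v) = D (dress a (toCur x) b n v) := by
  obtain ⟨N, hv⟩ := fl.exh v
  obtain ⟨N', hw⟩ := fl.exh (D v)
  have hv' := fl.mono (le_max_left N N') hv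
  have hw' := fl.mono (le_max_right N N') hw
  obtain ⟨L, hL, hL', hL''⟩ :=
    exists_bound₃ (max N N' - n - e) (max N N') (max N N' - (n + k) - e)
  rw [dress_eq_sum hx hb hv' (L₁ := L + k) (by push_cast; omega) hL',
    dress_eq_sum hx hb hw' (L₁ := L + k) (by push_cast; omega) hL', map_sum]
  have term : ∀ i j : ℕ, D (coeff i a (x (n + i - j) (coeff j b v)))
      = coeff i a (x (n + i - j) (coeff j b (D v)))
        - c (coeff i a (x (n + k + i - j) (coeff j b v)))
        + if k ≤ i then c (coeff (i - k) a (x (n + k + (i - k : ℕ) - j) (coeff j b v))) else 0 := by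
    intro i j
    have e1 := LinearMap.congr_fun (h1 i) (x (n + i - j) (coeff j b v))
    have e2 := LinearMap.congr_fun (h2 (n + i - j)) (coeff j b v)
    have e3 := LinearMap.congr_fun (h3 j).eq v
    have e4 := LinearMap.congr_fun (hc i).eq (x (n + i - j + k) (coeff j b v))
    simp only [Module.End.mul_apply, LinearMap.add_apply, LinearMap.sub_apply] at e1 e2 e3 e4
    rw [e1, e2, e3, map_sub, ← e4, show n + i - j + k = n + k + i - j by ring]
    congr 1
    split_ifs with hk
    · rw [show n + k + (i - k : ℕ) - j = n + i - j by push_cast [hk]; ring, Module.End.mul_apply]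
    · rfl
  simp only [map_sum, term, sum_add_distrib, sum_sub_distrib]
  have e5 : ∑ i ∈ range (L + k), ∑ j ∈ range L, c (coeff i a (x (n + k + i - j) (coeff j b v)))
      = ∑ i ∈ range L, ∑ j ∈ range L, c (coeff i a (x (n + k + i - j) (coeff j b v))) := by
    have := congrArg c ((dress_eq_sum (a := a) hx hb hv' (n := n + k) (L₁ := L + k)
      (by push_cast; omega) hL').symm.trans (dress_eq_sum hx hb hv' (n := n + k) hL'' hL'))
    simpa only [map_sum] using this
  have e6 : ∑ i ∈ range (L + k), ∑ j ∈ range L,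
      (if k ≤ i then c (coeff (i - k) a (x (n + k + (i - k : ℕ) - j) (coeff j b v))) else 0)
      = ∑ i ∈ range L, ∑ j ∈ range L, c (coeff i a (x (n + k + i - j) (coeff j b v))) := by
    rw [← sum_range_add_shift k L]
    refine sum_congr rfl fun i _ => ?_
    split_ifs
    · rfl
    · simp
  rw [e5, e6, sub_add_cancel]

/-- Mirror image of `dress_commute_left`: here the bracket with the right factor compensates the
bracket with `x`. Now `c` has to pass through `x` as well, because it is produced to the right of
it. -/
theorem dress_commute_right {a b : PowerSeries (Module.End F V)} {x : ℤ → Module.End F V} {e : ℤ}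
    (hx : CurDeg fl e (toCur x)) (hb : RightDeg fl b) {D c : Module.End F V} {k : ℕ}
    (h1 : ∀ i, Commute D (coeff i a)) (h2 : ∀ n, D * x n = x n * D + c * x (n - k))
    (h3 : ∀ j, D * coeff j b = coeff j b * D - if k ≤ j then c * coeff (j - k) b else 0)
    (hc : ∀ i, Commute c (coeff i a)) (hc' : ∀ n, Commute c (x n))
    (n : ℤ) (v : V) : dress a (toCur x) b n (D v) = D (dress a (toCur x) b n v) := by
  obtain ⟨N, hv⟩ := fl.exh v
  obtain ⟨N', hw⟩ := fl.exh (D v)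
  have hv' := fl.mono (le_max_left N N') hv
  have hw' := fl.mono (le_max_right N N') hw
  obtain ⟨L, hL, hL', hL''⟩ :=
    exists_bound₃ (max N N' - n - e) (max N N') (max N N' - (n - k) - e)
  rw [dress_eq_sum hx hb hv' hL (L₂ := L + k) (by push_cast; omega),
    dress_eq_sum hx hb hw' hL (L₂ := L + k) (by push_cast; omega), map_sum]
  have term : ∀ i j : ℕ, D (coeff i a (x (n + i - j) (coeff j b v)))
      = coeff i a (x (n + i - j) (coeff j b (D v)))
        - (if k ≤ j then c (coeff i a (x (n - k + i - (j - k : ℕ)) (coeff (j - k) b v))) else 0)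
        + c (coeff i a (x (n - k + i - j) (coeff j b v))) := by
    intro i j
    have e1 := LinearMap.congr_fun (h1 i).eq (x (n + i - j) (coeff j b v))
    have e2 := LinearMap.congr_fun (h2 (n + i - j)) (coeff j b v)
    have e3 := LinearMap.congr_fun (h3 j) v
    have e4 := fun w => LinearMap.congr_fun (hc i).eq w
    have e5 := fun w => LinearMap.congr_fun (hc' (n + i - j)).eq w
    simp only [Module.End.mul_apply, LinearMap.add_apply, LinearMap.sub_apply] at e1 e2 e3 e4 e5
    rw [e1, e2, e3, map_add, map_sub, map_sub, ← e4, show n + i - j - k = n - k + i - j by ring]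
    congr 2
    split_ifs with hk
    · rw [show n - k + i - (j - k : ℕ) = n + i - j by push_cast [hk]; ring, Module.End.mul_apply,
        ← e5, ← e4]
    · simp
  simp only [map_sum, term, sum_add_distrib, sum_sub_distrib]
  have e5 : ∑ i ∈ range L, ∑ j ∈ range (L + k), c (coeff i a (x (n - k + i - j) (coeff j b v)))
      = ∑ i ∈ range L, ∑ j ∈ range L, c (coeff i a (x (n - k + i - j) (coeff j b v))) := by
    have := congrArg c ((dress_eq_sum (a := a) hx hb hv' (n := n - k) hL'' (L₂ := L + k)
      (by push_cast; omega)).symm.trans (dress_eq_sum hx hb hv' (n := n - k) hL'' hL'))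
    simpa only [map_sum] using this
  have e6 : ∀ i : ℕ, ∑ j ∈ range (L + k),
      (if k ≤ j then c (coeff i a (x (n - k + i - (j - k : ℕ)) (coeff (j - k) b v))) else 0)
      = ∑ j ∈ range L, c (coeff i a (x (n - k + i - j) (coeff j b v))) := fun i =>
    sum_range_add_shift (f := fun j => c (coeff i a (x (n - k + i - j) (coeff j b v)))) k L
  simp only [e6]
  rw [e5, sub_add_cancel]

/-! ### Normal ordering of products of dressed currents -/

section Products

variable {α β α' β' : PowerSeries (Module.End F V)}

theorem exchTerm_eq_zero {a : PowerSeries (Module.End F V)} {f h : Cur V} {e e' : ℤ}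
    (hf : CurDeg fl e f) (hh : CurDeg fl e' h) {N : ℤ} {v : V} (hv : v ∈ fl.fl N) {m n : ℤ} {k : ℕ}
    (hk : N - n - e' < k) : exchTerm a f h m n v k = 0 := by
  rw [exchTerm, (hh (n + k)).eq_zero hv (by omega), (hf _).map_zero, map_zero]

theorem exchTerm_finite {a : PowerSeries (Module.End F V)} {f h : Cur V} {e e' : ℤ}
    (hf : CurDeg fl e f) (hh : CurDeg fl e' h) (m n : ℤ) (v : V) :
    (Function.support (exchTerm a f h m n v)).Finite := by
  obtain ⟨N, hv⟩ := fl.exh v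
  exact finite_support_of_range (L := (N - n - e' + 1).toNat) fun k hk =>
    exchTerm_eq_zero hf hh hv (by omega)

theorem exch_eq_sum {a : PowerSeries (Module.End F V)} {f h : Cur V} {e e' : ℤ}
    (hf : CurDeg fl e f) (hh : CurDeg fl e' h) {N : ℤ} {v : V} (hv : v ∈ fl.fl N) {m n : ℤ} {L : ℕ}
    (hL : N - n - e' < L) :
    exch a f h m n v = ∑ k ∈ range L, coeff k a (f (m - k) (h (n + k) v)) :=
  finsum_eq_sum_range fun k hk => exchTerm_eq_zero hf hh hv (by omega)

/-- The coefficients of the series `a` preserve the filtration. -/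
def ScalarDeg (fl : Filt V) (a : PowerSeries (Module.End F V)) : Prop :=
  ∀ k, OpDeg fl 0 ⇑(coeff k a)

theorem exch_opDeg {a : PowerSeries (Module.End F V)} {f h : Cur V}
    (hf : CurDeg fl 0 f) (hh : CurDeg fl 0 h) (ha : ScalarDeg fl a) (m n : ℤ) :
    OpDeg fl (m + n) (exch a f h m n) := by
  intro N v hv
  rw [exch_eq_sum hf hh hv (L := (N - n - 0 + 1).toNat) (by omega)]
  refine sum_mem fun k _ => ?_
  have := ha k _ _ (hf (m - k) _ _ (hh (n + k) _ _ hv))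
  rwa [show N - (n + k + 0) - (m - k + 0) - 0 = N - (m + n) by ring] at this

/-- The coefficients of `α(z) α'(w) K(z, w) β(z) β'(w)`. -/
def dress₂ (α β α' β' : PowerSeries (Module.End F V)) (K : ℤ → ℤ → V → V) (m n : ℤ) (v : V) : V :=
  dress α' (fun n => dress α (fun m => K m n) β m) β' n v

theorem curDeg_inner {K : ℤ → ℤ → V → V} (hK : ∀ m n, OpDeg fl (m + n) (K m n)) (hα : LeftDeg fl α)
    (hβ : RightDeg fl β) (m : ℤ) :
    CurDeg fl m (fun n => dress α (fun m => K m n) β m) := fun n => by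
  have h : CurDeg fl n (fun m => K m n) := fun m => hK m n
  have := h.dress hα hβ m
  rwa [add_comm] at this

theorem dress₂_eq_sum {K : ℤ → ℤ → V → V} (hK : ∀ m n, OpDeg fl (m + n) (K m n))
    (hα : LeftDeg fl α) (hβ : RightDeg fl β) (hβ' : RightDeg fl β') {N : ℤ} {v : V}
    (hv : v ∈ fl.fl N) {m n : ℤ} {L : ℕ} (h₁ : N - m - n < L) (h₂ : N < L) :
    dress₂ α β α' β' K m n v = ∑ i' ∈ range L, ∑ j' ∈ range L, ∑ i ∈ range L, ∑ j ∈ range L,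
      coeff i' α' (coeff i α (K (m + i - j) (n + i' - j') (coeff j β (coeff j' β' v)))) := by
  rw [dress₂, dress_eq_sum (curDeg_inner hK hα hβ m) hβ' hv (L₁ := L) (by omega) h₂]
  refine sum_congr rfl fun i' _ => sum_congr rfl fun j' _ => ?_
  have h : CurDeg fl (n + i' - j') (fun m => K m (n + i' - j')) := fun m => hK m _
  rw [dress_eq_sum h hβ (hβ' j' _ _ hv) (L₁ := L) (L₂ := L) (by omega) (by omega)]
  simp only [map_sum]

/-- Moving `β(z)` to the right across `x'(w)` costs the factor `f(w/z)`, which is absorbed in the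
exchange product. -/
theorem dress_mul {x x' : ℤ → Module.End F V} (hx : CurDeg fl 0 (toCur x))
    (hx' : CurDeg fl 0 (toCur x')) (hβ : RightDeg fl β)
    {f : PowerSeries (Module.End F V)} (hfd : ScalarDeg fl f)
    (hf : ∀ k n, Commute (coeff k f) (x n))
    (hβx : ∀ j n, coeff j β * x' n
      = ∑ kl ∈ antidiagonal j, coeff kl.1 f * x' (n + kl.1) * coeff kl.2 β) (m n : ℤ) (w : V) :
    dress α (toCur x) β m (x' n w)
      = dress α (fun m => exch f (toCur x) (toCur x') m n) β m w := by
  obtain ⟨N, hw⟩ := fl.exh w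
  obtain ⟨L, h1, h2, h3⟩ := exists_bound₃ N (N - n) (N - m - n)
  have hK : CurDeg fl n (fun m => exch f (toCur x) (toCur x') m n) :=
    fun m => exch_opDeg hx hx' hfd m n
  rw [dress_eq_sum hx hβ (hx' n _ _ hw) (L₁ := L) (L₂ := L) (by omega) (by omega),
    dress_eq_sum hK hβ hw (L₁ := L) (L₂ := L) (by omega) h1]
  refine sum_congr rfl fun i _ => ?_
  rw [← map_sum, ← map_sum]
  congr 1
  have e : ∀ l ∈ range L, exch f (toCur x) (toCur x') (m + i - l) n (coeff l β w)
      = ∑ k ∈ range L, coeff k f (x (m + i - l - k) (x' (n + k) (coeff l β w))) := fun l _ =>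
    exch_eq_sum hx hx' (hβ l _ _ hw) (by omega)
  rw [sum_congr rfl e, sum_comm, sum_range_range_eq_sum_antidiagonal]
  · refine sum_congr rfl fun j _ => ?_
    have e2 := LinearMap.congr_fun (hβx j n) w
    rw [Module.End.mul_apply, LinearMap.sum_apply] at e2
    rw [e2, toCur, map_sum]
    refine sum_congr rfl fun kl hkl => ?_
    have e3 := LinearMap.congr_fun (hf kl.1 (m + i - j)).eq (x' (n + kl.1) (coeff kl.2 β w))
    simp only [Module.End.mul_apply] at e3 ⊢
    rw [← e3, show m + i - (j : ℤ) = m + i - kl.2 - kl.1 by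
      rw [← HasAntidiagonal.mem_antidiagonal.1 hkl]; push_cast; ring]
  · intro k l hkl
    rw [hx'.apply_eq_zero (hβ l _ _ hw) (by omega), map_zero, map_zero]

/-- Normal ordering of the product of two dressed currents. -/
theorem dress_dress {x x' : ℤ → Module.End F V} (hx : CurDeg fl 0 (toCur x))
    (hx' : CurDeg fl 0 (toCur x')) (hα : LeftDeg fl α) (hβ : RightDeg fl β) (hβ' : RightDeg fl β')
    {f : PowerSeries (Module.End F V)} (hfd : ScalarDeg fl f)
    (hf : ∀ k n, Commute (coeff k f) (x n))
    (hβx : ∀ j n, coeff j β * x' n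
      = ∑ kl ∈ antidiagonal j, coeff kl.1 f * x' (n + kl.1) * coeff kl.2 β)
    (hcomm : ∀ i, CommutesWith (dress α (toCur x) β) (coeff i α')) (m n : ℤ) (v : V) :
    dress α (toCur x) β m (dress α' (toCur x') β' n v)
      = dress₂ α β α' β' (exch f (toCur x) (toCur x')) m n v := by
  obtain ⟨N, hv⟩ := fl.exh v
  obtain ⟨L, h1, h2, h3⟩ := exists_bound₃ N (N - n) (N - m - n)
  obtain ⟨T, hT⟩ := dress_linear (a := α) hx hβ
  -- By `dress_mul` the inner current on the right-hand side is `T m` applied to `x' n`. It remains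
  -- to pull `α'` out through `T m`, which is the hypothesis `hcomm`.
  have e : (fun n => dress α (fun m => exch f (toCur x) (toCur x') m n) β m)
      = fun n v => T m (x' n v) := by
    funext n v
    rw [← dress_mul hx hx' hβ hfd hf hβx, hT]
  have hdeg := curDeg_inner (exch_opDeg hx hx' hfd) hα hβ m
  rw [dress₂]
  rw [e] at hdeg ⊢
  rw [dress_eq_sum hdeg hβ' hv (L₁ := L) (L₂ := L) (by omega) h1,
    dress_eq_sum hx' hβ' hv (L₁ := L) (L₂ := L) (by omega) h1]
  rw [hT] at hcomm ⊢
  simp only [map_sum]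
  exact sum_congr rfl fun i _ => sum_congr rfl fun j _ => hcomm i m _

theorem exch_exch {x x' : ℤ → Module.End F V} (hx : CurDeg fl 0 (toCur x))
    (hx' : CurDeg fl 0 (toCur x')) {a f : PowerSeries (Module.End F V)}
    {N : ℤ} {v : V} (hv : v ∈ fl.fl N) {m n : ℤ} {L : ℕ} (hL : N - n < L) :
    ∑ s ∈ range L, coeff s a (exch f (toCur x) (toCur x') (m - s) (n + s) v)
      = exch (a * f) (toCur x) (toCur x') m n v := by
  rw [exch_eq_sum hx hx' hv (L := L) (by omega)]
  have e : ∀ s ∈ range L, coeff s a (exch f (toCur x) (toCur x') (m - s) (n + s) v)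
      = ∑ k ∈ range L, coeff s a (coeff k f (x (m - s - k) (x' (n + s + k) v))) := fun s _ => by
    rw [exch_eq_sum hx hx' hv (L := L) (by omega), map_sum]
  rw [sum_congr rfl e, sum_range_range_eq_sum_antidiagonal]
  · refine sum_congr rfl fun r _ => ?_
    rw [coeff_mul, LinearMap.sum_apply]
    refine sum_congr rfl fun kl hkl => ?_
    rw [Module.End.mul_apply, ← HasAntidiagonal.mem_antidiagonal.1 hkl]
    push_cast
    rw [sub_sub, add_assoc]
  · intro k l hkl
    rw [hx'.apply_eq_zero hv (by omega), map_zero, map_zero, map_zero]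

/-- The exchange product of two dressed currents is the dressing of an exchange product. -/
theorem exch_dress {x x' : ℤ → Module.End F V} (hx : CurDeg fl 0 (toCur x))
    (hx' : CurDeg fl 0 (toCur x')) (hα : LeftDeg fl α) (hα' : LeftDeg fl α') (hβ : RightDeg fl β)
    (hβ' : RightDeg fl β') {a f : PowerSeries (Module.End F V)}
    (hfd : ScalarDeg fl f) (hafd : ScalarDeg fl (a * f))
    (hf : ∀ k n, Commute (coeff k f) (x n))
    (haα : ∀ k i, Commute (coeff k a) (coeff i α)) (haα' : ∀ k i, Commute (coeff k a) (coeff i α'))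
    (hβx : ∀ j n, coeff j β * x' n
      = ∑ kl ∈ antidiagonal j, coeff kl.1 f * x' (n + kl.1) * coeff kl.2 β)
    (hcomm : ∀ i, CommutesWith (dress α (toCur x) β) (coeff i α')) (m n : ℤ) (v : V) :
    exch a (dress α (toCur x) β) (dress α' (toCur x') β') m n v
      = dress₂ α β α' β' (exch (a * f) (toCur x) (toCur x')) m n v := by
  obtain ⟨N, hv⟩ := fl.exh v
  obtain ⟨L, h1, h2, h3⟩ := exists_bound₃ N (N - n) (N - m - n)
  rw [exch_eq_sum (hx.dress hα hβ) (hx'.dress hα' hβ') hv (L := L) (by omega)]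
  simp only [dress_dress hx hx' hα hβ hβ' hfd hf hβx hcomm]
  rw [dress₂_eq_sum (exch_opDeg hx hx' hafd) hα hβ hβ' hv h3 h1]
  have e : ∀ s ∈ range L, coeff s a
      (dress₂ α β α' β' (exch f (toCur x) (toCur x')) (m - s) (n + s) v)
      = ∑ i' ∈ range L, ∑ j' ∈ range L, ∑ i ∈ range L, ∑ j ∈ range L,
          coeff i' α' (coeff i α (coeff s a (exch f (toCur x) (toCur x') (m + i - j - s)
            (n + i' - j' + s) (coeff j β (coeff j' β' v))))) := fun s _ => by
    rw [dress₂_eq_sum (exch_opDeg hx hx' hfd) hα hβ hβ' hv (L := L) (by omega) h1]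
    simp only [map_sum]
    refine sum_congr rfl fun i' _ => sum_congr rfl fun j' _ => sum_congr rfl fun i _ =>
      sum_congr rfl fun j _ => ?_
    have c1 := fun w => LinearMap.congr_fun (haα s i).eq w
    have c2 := fun w => LinearMap.congr_fun (haα' s i').eq w
    simp only [Module.End.mul_apply] at c1 c2
    rw [c2, c1]
    congr 4 <;> ring
  rw [sum_congr rfl e, sum_comm]
  refine sum_congr rfl fun i' _ => ?_
  rw [sum_comm]
  refine sum_congr rfl fun j' _ => ?_
  rw [sum_comm]
  refine sum_congr rfl fun i _ => ?_
  rw [sum_comm]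
  refine sum_congr rfl fun j _ => ?_
  rw [← map_sum, ← map_sum, exch_exch hx hx' (hβ j _ _ (hβ' j' _ _ hv)) (by omega)]

/-- The two orders of a product are brought to one normal ordering by this symmetry, so that only
the undressed kernels have to be compared. -/
theorem dress₂_swap {K : ℤ → ℤ → V → V} (hK : ∀ m n, OpDeg fl (m + n) (K m n))
    (hα : LeftDeg fl α) (hα' : LeftDeg fl α') (hβ : RightDeg fl β) (hβ' : RightDeg fl β')
    (hαα' : CoeffCommute α α') (hββ' : CoeffCommute β β') (m n : ℤ) (v : V) :
    dress₂ α β α' β' K m n v = dress₂ α' β' α β (fun m n => K n m) n m v := by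
  obtain ⟨N, hv⟩ := fl.exh v
  obtain ⟨L, h1, h2⟩ := exists_bound₂ N (N - m - n)
  have hK' : ∀ m n, OpDeg fl (m + n) ((fun m n => K n m) m n) := fun m n => by
    rw [add_comm]; exact hK n m
  rw [dress₂_eq_sum hK hα hβ hβ' hv h2 h1, dress₂_eq_sum hK' hα' hβ' hβ hv (L := L) (by omega) h1]
  have e : ∀ i' j' i j : ℕ,
      coeff i' α' (coeff i α (K (m + i - j) (n + i' - j') (coeff j β (coeff j' β' v))))
      = coeff i α (coeff i' α' (K (m + i - j) (n + i' - j') (coeff j' β' (coeff j β v)))) := by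
    intro i' j' i j
    rw [← Module.End.mul_apply, ← (hαα' i i').eq, ← Module.End.mul_apply (coeff j β),
      (hββ' j j').eq]
    rfl
  simp only [e]
  exact sum_sum_swap _ _

theorem dress₂_sub {K K' : ℤ → ℤ → V → V} (hK : ∀ m n, OpDeg fl (m + n) (K m n))
    (hK' : ∀ m n, OpDeg fl (m + n) (K' m n)) (hα : LeftDeg fl α) (hβ : RightDeg fl β)
    (hβ' : RightDeg fl β') (m n : ℤ) (v : V) :
    dress₂ α β α' β' K m n v - dress₂ α β α' β' K' m n v
      = dress₂ α β α' β' (fun m n v => K m n v - K' m n v) m n v := by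
  obtain ⟨N, hv⟩ := fl.exh v
  obtain ⟨L, h1, h2⟩ := exists_bound₂ N (N - m - n)
  have h : ∀ m n, OpDeg fl (m + n) ((fun m n v => K m n v - K' m n v) m n) := fun m n N v hv =>
    sub_mem (hK m n N v hv) (hK' m n N v hv)
  rw [dress₂_eq_sum hK hα hβ hβ' hv h2 h1, dress₂_eq_sum hK' hα hβ hβ' hv h2 h1,
    dress₂_eq_sum h hα hβ hβ' hv h2 h1]
  simp only [map_sub, sum_sub_distrib]

theorem dress₂_smul {K : ℤ → ℤ → V → V} (hK : ∀ m n, OpDeg fl (m + n) (K m n)) (c : F)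
    (hα : LeftDeg fl α) (hβ : RightDeg fl β) (hβ' : RightDeg fl β') (m n : ℤ) (v : V) :
    dress₂ α β α' β' (fun m n v => c • K m n v) m n v = c • dress₂ α β α' β' K m n v := by
  obtain ⟨N, hv⟩ := fl.exh v
  obtain ⟨L, h1, h2⟩ := exists_bound₂ N (N - m - n)
  have h : ∀ m n, OpDeg fl (m + n) ((fun m n v => c • K m n v) m n) := fun m n N v hv =>
    Submodule.smul_mem _ _ (hK m n N v hv)
  rw [dress₂_eq_sum hK hα hβ hβ' hv h2 h1, dress₂_eq_sum h hα hβ hβ' hv h2 h1]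
  simp only [map_smul, smul_sum]

/-- Dressing of `δ(c w/z) y(z)`. -/
theorem dress₂_delta {y : ℤ → Module.End F V} (hy : CurDeg fl 0 (toCur y))
    {c : (Module.End F V)ˣ} (hc : OpDeg fl 0 ⇑(c : Module.End F V))
    (hc' : OpDeg fl 0 ⇑((c⁻¹ : (Module.End F V)ˣ) : Module.End F V))
    (hcα : ∀ i, Commute (c : Module.End F V) (coeff i α))
    (hcα' : ∀ i, Commute (c : Module.End F V) (coeff i α'))
    (hcy : ∀ n, Commute (c : Module.End F V) (y n))
    (hcβ : ∀ i, Commute (c : Module.End F V) (coeff i β))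
    (hα : LeftDeg fl α) (hβ : RightDeg fl β) (hβ' : RightDeg fl β')
    (hb : RightDeg fl (β * dil c β')) (m n : ℤ) (v : V) :
    dress₂ α β α' β' (deltaZ c (toCur y)) m n v
      = deltaZ c (dress (dil c⁻¹ α' * α) (toCur y) (β * dil c β')) m n v := by
  obtain ⟨N, hv⟩ := fl.exh v
  obtain ⟨L, h1, h2⟩ := exists_bound₂ N (N - m - n)
  have hpow : ∀ k : ℕ, OpDeg fl 0 ⇑((c ^ k : (Module.End F V)ˣ) : Module.End F V) := fun k => by
    induction k with
    | zero => intro N v hv; simpa using hv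
    | succ k ih => rw [pow_succ, Units.val_mul]; exact ih.comp hc
  have hpow' : ∀ k : ℕ, OpDeg fl 0 ⇑((c⁻¹ ^ k : (Module.End F V)ˣ) : Module.End F V) := fun k => by
    induction k with
    | zero => intro N v hv; simpa using hv
    | succ k ih => rw [pow_succ, Units.val_mul]; exact ih.comp hc'
  have hz : ∀ k : ℤ, OpDeg fl 0 ⇑((c ^ k : (Module.End F V)ˣ) : Module.End F V) := fun k => by
    obtain ⟨k, rfl | rfl⟩ := k.eq_nat_or_neg
    · rw [zpow_natCast]; exact hpow k
    · rw [zpow_neg, zpow_natCast, ← inv_pow]; exact hpow' k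
  have hzc : ∀ (D : Module.End F V), Commute (c : Module.End F V) D → ∀ (k : ℤ) (w : V),
      ((c ^ k : (Module.End F V)ˣ) : Module.End F V) (D w)
        = D (((c ^ k : (Module.End F V)ˣ) : Module.End F V) w) := fun D hD k w =>
    LinearMap.congr_fun (hD.units_zpow_left k).eq w
  have hK : ∀ m n, OpDeg fl (m + n) (deltaZ c (toCur y) m n) := fun m n N v hv => by
    have := hz (-n) _ _ (hy (m + n) _ _ hv)
    rwa [show N - (m + n + 0) - 0 = N - (m + n) by ring] at this
  rw [dress₂_eq_sum hK hα hβ hβ' hv h2 h1, deltaZ, dress_eq_sum hy hb hv (L₁ := L) (by omega) h1]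
  -- On the support of `δ(c w/z)` one has `w = c⁻¹ z`. The power of `c` created by the shift of
  -- modes is split into `c⁻¹ ^ i'` for `α'` and `c ^ j'` for `β'`, the latter being a series in
  -- `w⁻¹`.
  have e1 : ∀ i' j' i j : ℕ, coeff i' α' (coeff i α (deltaZ c (toCur y) (m + i - j) (n + i' - j')
      (coeff j β (coeff j' β' v))))
      = ((c ^ (-n) : (Module.End F V)ˣ) : Module.End F V) (coeff i' (dil c⁻¹ α') (coeff i α
          (y (m + n + (i' + i : ℕ) - (j + j' : ℕ)) (coeff j β (coeff j' (dil c β') v))))) := by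
    intro i' j' i j
    rw [deltaZ, coeff_dil, coeff_dil, Module.End.mul_apply, Module.End.mul_apply, ← zpow_natCast c,
      ← zpow_natCast c⁻¹, inv_zpow']
    rw [show m + i - j + (n + i' - j') = m + n + (i' + i : ℕ) - (j + j' : ℕ) by push_cast; ring,
      ← hzc _ (hcβ j), ← hzc _ (hcy _), ← hzc _ (hcα i), ← hzc _ (hcα i), ← hzc _ (hcα' i'),
      ← hzc _ (hcα' i')]
    simp only [← Module.End.mul_apply, ← Units.val_mul, ← zpow_add, ← mul_assoc]
    rw [show -(n + (i' : ℤ) - j') = -n + (-i' + j') by ring]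
  simp only [e1]
  have e2 : ∀ i' i : ℕ, ∑ j' ∈ range L, ∑ j ∈ range L,
      ((c ^ (-n) : (Module.End F V)ˣ) : Module.End F V) (coeff i' (dil c⁻¹ α') (coeff i α
          (y (m + n + (i' + i : ℕ) - (j + j' : ℕ)) (coeff j β (coeff j' (dil c β') v)))))
      = ((c ^ (-n) : (Module.End F V)ˣ) : Module.End F V) (coeff i' (dil c⁻¹ α') (coeff i α
          (∑ s ∈ range L, y (m + n + (i' + i : ℕ) - s) (coeff s (β * dil c β') v)))) := by
    intro i' i
    rw [sum_comm]
    simp only [← map_sum]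
    congr 3
    rw [sum_range_range_eq_sum_antidiagonal]
    · refine sum_congr rfl fun s _ => ?_
      rw [coeff_mul, LinearMap.sum_apply, map_sum]
      refine sum_congr rfl fun kl hkl => ?_
      rw [HasAntidiagonal.mem_antidiagonal.1 hkl, Module.End.mul_apply]
    · intro j j' hjj
      have h3 := hβ' j' _ _ hv
      have h4 := hpow j' _ _ h3
      rw [coeff_dil, Module.End.mul_apply, (hβ j).eq_zero h4 (by omega), map_zero]
  have e3 : ∀ i' : ℕ, ∑ j' ∈ range L, ∑ i ∈ range L, ∑ j ∈ range L,
      ((c ^ (-n) : (Module.End F V)ˣ) : Module.End F V) (coeff i' (dil c⁻¹ α') (coeff i α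
          (y (m + n + (i' + i : ℕ) - (j + j' : ℕ)) (coeff j β (coeff j' (dil c β') v)))))
      = ∑ i ∈ range L, ((c ^ (-n) : (Module.End F V)ˣ) : Module.End F V) (coeff i' (dil c⁻¹ α')
          (coeff i α (∑ s ∈ range L, y (m + n + (i' + i : ℕ) - s)
            (coeff s (β * dil c β') v)))) := fun i' => by
    rw [sum_comm]
    exact sum_congr rfl fun i _ => e2 i' i
  rw [sum_congr rfl fun i' _ => e3 i', sum_range_range_eq_sum_antidiagonal]
  · rw [map_sum]
    refine sum_congr rfl fun r _ => ?_
    rw [← map_sum, ← map_sum, coeff_mul, LinearMap.sum_apply]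
    congr 1
    refine sum_congr rfl fun kl hkl => ?_
    rw [HasAntidiagonal.mem_antidiagonal.1 hkl, Module.End.mul_apply]
  · intro i' i hii
    rw [sum_eq_zero, map_zero, map_zero, map_zero]
    intro s _
    have h3 := hy (m + n + (i' + i : ℕ) - s) _ _ (hb s _ _ hv)
    exact fl.eq_zero (by push_cast; omega) h3

end Products

end Filtered


/-! ### Central operators, relations and filtration of a representation -/

section Representation

variable {V : Type*} [AddCommGroup V] [Module F V] (ρ : U →ₐ[F] Module.End F V)

/-! ### The commutant -/

/-- The operators that commute with the representation. -/
def cen : Subalgebra F (Module.End F V) := Subalgebra.centralizer F (Set.range ρ)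

/-- The double commutant of the representation. -/
def dcen : Subalgebra F (Module.End F V) := Subalgebra.centralizer F (cen ρ : Set (Module.End F V))

/-- The centre of the double commutant. -/
def zen : Subalgebra F (Module.End F V) := cen ρ ⊓ dcen ρ

variable {ρ}

theorem commute_of_mem {z a : Module.End F V} (hz : z ∈ cen ρ) (ha : a ∈ dcen ρ) : Commute z a := by
  rw [dcen, Subalgebra.mem_centralizer_iff] at ha
  exact ha z hz

theorem mem_dcen (u : U) : ρ u ∈ dcen ρ := by
  rw [dcen, Subalgebra.mem_centralizer_iff]
  intro z hz
  have hz' : z ∈ cen ρ := hz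
  rw [cen, Subalgebra.mem_centralizer_iff] at hz'
  exact (hz' _ ⟨u, rfl⟩).symm

theorem mem_cen_of_gen {z : Module.End F V} (h : ∀ a : Gen, Commute z (ρ (gen a))) : z ∈ cen ρ := by
  rw [cen, Subalgebra.mem_centralizer_iff]
  rintro _ ⟨u, rfl⟩
  obtain ⟨f, rfl⟩ := RingQuot.mkAlgHom_surjective F Rel u
  suffices Commute z (ρ (RingQuot.mkAlgHom F Rel f)) from this.eq.symm
  induction f using FreeAlgebra.induction with
  | grade0 r =>
    rw [AlgHom.commutes, AlgHom.commutes]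
    exact (Algebra.commutes r z).symm
  | grade1 a => exact h a
  | mul a b ha hb => rw [map_mul, map_mul]; exact ha.mul_right hb
  | add a b ha hb => rw [map_add, map_add]; exact ha.add_right hb

theorem zen_le_dcen {z : Module.End F V} (hz : z ∈ zen ρ) : z ∈ dcen ρ := hz.2

theorem units_inv_mem_centralizer {S : Set (Module.End F V)} {u : (Module.End F V)ˣ}
    (hu : (u : Module.End F V) ∈ Subalgebra.centralizer F S) :
    ((u⁻¹ : (Module.End F V)ˣ) : Module.End F V) ∈ Subalgebra.centralizer F S := by
  rw [Subalgebra.mem_centralizer_iff] at hu ⊢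
  exact fun g hg => (Commute.units_inv_right (hu g hg : Commute g u)).eq

theorem units_inv_mem_zen {u : (Module.End F V)ˣ} (hu : (u : Module.End F V) ∈ zen ρ) :
    ((u⁻¹ : (Module.End F V)ˣ) : Module.End F V) ∈ zen ρ :=
  ⟨units_inv_mem_centralizer hu.1, units_inv_mem_centralizer hu.2⟩

/-- The inverses of `ψ^±_0` and of `γ^n - γ^{-n}` need not come from the algebra, but commutants are
closed under inversion. This is the reason for using the double commutant instead of the image of
`ρ`. -/
theorem inverse_mem_zen {z : Module.End F V} (hz : z ∈ zen ρ) : Ring.inverse z ∈ zen ρ := by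
  by_cases h : IsUnit z
  · obtain ⟨u, rfl⟩ := h
    rw [Ring.inverse_unit]
    exact units_inv_mem_zen hz
  · rw [Ring.inverse_non_unit _ h]
    exact zero_mem _

theorem units_mul_mem_zen {u w : (Module.End F V)ˣ} (hu : (u : Module.End F V) ∈ zen ρ)
    (hw : (w : Module.End F V) ∈ zen ρ) : ((u * w : (Module.End F V)ˣ) : Module.End F V) ∈ zen ρ := by
  rw [Units.val_mul]; exact mul_mem hu hw

theorem units_pow_mem_zen {u : (Module.End F V)ˣ} (hu : (u : Module.End F V) ∈ zen ρ) (k : ℕ) :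
    ((u ^ k : (Module.End F V)ˣ) : Module.End F V) ∈ zen ρ := by
  rw [Units.val_pow_eq_pow_val]; exact pow_mem hu k

theorem units_zpow_mem_zen {u : (Module.End F V)ˣ} (hu : (u : Module.End F V) ∈ zen ρ) (k : ℤ) :
    ((u ^ k : (Module.End F V)ˣ) : Module.End F V) ∈ zen ρ := by
  obtain ⟨k, rfl | rfl⟩ := k.eq_nat_or_neg
  · rw [zpow_natCast]; exact units_pow_mem_zen hu k
  · rw [zpow_neg, zpow_natCast]; exact units_inv_mem_zen (units_pow_mem_zen hu k)

theorem zen_commute {z a : Module.End F V} (hz : z ∈ zen ρ) (ha : a ∈ dcen ρ) : Commute z a :=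
  commute_of_mem hz.1 ha

/-! ### The relations as identities of operators -/

variable (ρ)

/-- `x⁺_n` on `V` -/
def xp (n : ℤ) : Module.End F V := ρ (gen (Gen.xp n))

/-- `x⁻_n` on `V` -/
def xm (n : ℤ) : Module.End F V := ρ (gen (Gen.xm n))

/-- `ψ⁺_n` on `V` -/
def pp (n : ℕ) : Module.End F V := ρ (gen (Gen.psip n))

/-- `ψ⁻_{-n}` on `V` -/
def pm (n : ℕ) : Module.End F V := ρ (gen (Gen.psim n))

/-- The action of the free algebra. -/
def freeRep : Free →ₐ[F] Module.End F V := ρ.comp (RingQuot.mkAlgHom F Rel)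

theorem freeRep_rel {a b : Free} (h : Rel a b) : freeRep ρ a = freeRep ρ b := by
  simp only [freeRep, AlgHom.comp_apply, RingQuot.mkAlgHom_rel F h]

theorem freeRep_xp (n : ℤ) : freeRep ρ (Free.xp n) = xp ρ n := rfl
theorem freeRep_xm (n : ℤ) : freeRep ρ (Free.xm n) = xm ρ n := rfl
theorem freeRep_psip (n : ℕ) : freeRep ρ (Free.psip n) = pp ρ n := rfl
theorem freeRep_psim (n : ℕ) : freeRep ρ (Free.psim n) = pm ρ n := rfl
theorem freeRep_gam : freeRep ρ Free.gam = gh ρ := rfl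
theorem freeRep_gamInv : freeRep ρ Free.gamInv = ((gh ρ)⁻¹ : (Module.End F V)ˣ) := rfl

theorem freeRep_gamPow (k : ℤ) :
    freeRep ρ (Free.gamPow k) = ((gh ρ ^ k : (Module.End F V)ˣ) : Module.End F V) := by
  rw [Free.gamPow]
  split_ifs with h
  · rw [map_pow, freeRep_gam, ← Units.val_pow_eq_pow_val, ← zpow_natCast, Int.toNat_of_nonneg h]
  · rw [map_pow, freeRep_gamInv, ← Units.val_pow_eq_pow_val, ← zpow_natCast,
      Int.toNat_of_nonneg (by omega), inv_zpow', neg_neg]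

theorem gh_mem_zen : (gh ρ : Module.End F V) ∈ zen ρ := by
  refine ⟨mem_cen_of_gen fun a => ?_, mem_dcen _⟩
  have := freeRep_rel ρ (Rel.gam_central a)
  rw [map_mul, map_mul] at this
  exact this

theorem gamma_mem_zen : (gamma ρ : Module.End F V) ∈ zen ρ :=
  units_pow_mem_zen (gh_mem_zen ρ) 2

theorem pU_mem_zen : ((pU : (Module.End F V)ˣ) : Module.End F V) ∈ zen ρ :=
  (zen ρ).algebraMap_mem p

theorem gammaDiff_mem_zen (n : ℕ) : gammaDiff ρ n ∈ zen ρ :=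
  sub_mem (units_pow_mem_zen (gamma_mem_zen ρ) n)
    (units_pow_mem_zen (units_inv_mem_zen (gamma_mem_zen ρ)) n)

theorem pp_mul_xp (m : ℕ) (n : ℤ) : pp ρ m * xp ρ n = ∑ k ∈ range (m + 1),
    PowerSeries.coeff k g⁻¹ • (((gh ρ ^ (-k : ℤ) : (Module.End F V)ˣ) : Module.End F V) *
      (xp ρ (n + k) * pp ρ (m - k))) := by
  simpa only [map_mul, map_sum, map_smul, freeRep_gamPow, freeRep_xp, freeRep_psip] using
    freeRep_rel ρ (Rel.psip_xp m n)

theorem pp_mul_xm (m : ℕ) (n : ℤ) : pp ρ m * xm ρ n = ∑ k ∈ range (m + 1),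
    PowerSeries.coeff k g • (((gh ρ ^ (k : ℤ) : (Module.End F V)ˣ) : Module.End F V) *
      (xm ρ (n + k) * pp ρ (m - k))) := by
  simpa only [map_mul, map_sum, map_smul, freeRep_gamPow, freeRep_xm, freeRep_psip] using
    freeRep_rel ρ (Rel.psip_xm m n)

theorem pm_mul_xp (m : ℕ) (n : ℤ) : pm ρ m * xp ρ n = ∑ k ∈ range (m + 1),
    PowerSeries.coeff k g • (((gh ρ ^ (-k : ℤ) : (Module.End F V)ˣ) : Module.End F V) *
      (xp ρ (n - k) * pm ρ (m - k))) := by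
  simpa only [map_mul, map_sum, map_smul, freeRep_gamPow, freeRep_xp, freeRep_psim] using
    freeRep_rel ρ (Rel.psim_xp m n)

theorem pm_mul_xm (m : ℕ) (n : ℤ) : pm ρ m * xm ρ n = ∑ k ∈ range (m + 1),
    PowerSeries.coeff k g⁻¹ • (((gh ρ ^ (k : ℤ) : (Module.End F V)ˣ) : Module.End F V) *
      (xm ρ (n - k) * pm ρ (m - k))) := by
  simpa only [map_mul, map_sum, map_smul, freeRep_gamPow, freeRep_xm, freeRep_psim] using
    freeRep_rel ρ (Rel.psim_xm m n)

theorem pp_commute (m n : ℕ) : Commute (pp ρ m) (pp ρ n) := by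
  change pp ρ m * pp ρ n = pp ρ n * pp ρ m
  simpa only [map_mul, freeRep_psip] using freeRep_rel ρ (Rel.psip_psip m n)

theorem pm_commute (m n : ℕ) : Commute (pm ρ m) (pm ρ n) := by
  change pm ρ m * pm ρ n = pm ρ n * pm ρ m
  simpa only [map_mul, freeRep_psim] using freeRep_rel ρ (Rel.psim_psim m n)

/-- `g(γ u) / g(γ⁻¹ u)` on `V` -/
def gRatioSeries : PowerSeries (Module.End F V) :=
  dil (gamma ρ) (PowerSeries.map (algebraMap F _) g) *
    dil (gamma ρ)⁻¹ (PowerSeries.map (algebraMap F _) g⁻¹)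

theorem freeRep_gRatio (k : ℕ) : freeRep ρ (Free.gRatio k) = coeff k (gRatioSeries ρ) := by
  rw [Free.gRatio, map_sum, gRatioSeries, coeff_mul,
    Finset.Nat.sum_antidiagonal_eq_sum_range_succ_mk]
  refine sum_congr rfl fun i hi => ?_
  have hik : i ≤ k := by simpa [Nat.lt_succ_iff] using hi
  simp only [map_smul, freeRep_gamPow, coeff_dil, coeff_map]
  rw [← Algebra.commutes, ← Algebra.smul_def, ← Algebra.commutes, ← Algebra.smul_def,
    smul_mul_smul_comm, ← Units.val_mul]
  congr 2
  rw [gamma, ← zpow_natCast, ← zpow_natCast, ← zpow_natCast, inv_zpow', ← zpow_mul, ← zpow_mul,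
    ← zpow_add]
  congr 1
  push_cast [hik]
  ring

theorem pp_mul_pm (m n : ℕ) : pp ρ m * pm ρ n = ∑ k ∈ range (min m n + 1),
    coeff k (gRatioSeries ρ) * (pm ρ (n - k) * pp ρ (m - k)) := by
  simpa only [map_mul, map_sum, freeRep_gRatio, freeRep_psim, freeRep_psip] using
    freeRep_rel ρ (Rel.psip_psim m n)

theorem xp_bracket_xm (m n : ℤ) : xp ρ m * xm ρ n - xm ρ n * xp ρ m
    = ((1 - q) * (1 - t⁻¹) / (1 - p)) •
      (((gh ρ ^ (m - n) : (Module.End F V)ˣ) : Module.End F V) *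
          (if 0 ≤ m + n then pp ρ (m + n).toNat else 0) -
        ((gh ρ ^ (n - m) : (Module.End F V)ˣ) : Module.End F V) *
          (if m + n ≤ 0 then pm ρ (-(m + n)).toNat else 0)) := by
  have h := freeRep_rel ρ (Rel.xp_xm m n)
  have e1 : freeRep ρ (Free.psipZ (m + n)) = if 0 ≤ m + n then pp ρ (m + n).toNat else 0 := by
    rw [Free.psipZ]; split_ifs <;> simp [freeRep_psip]
  have e2 : freeRep ρ (Free.psimZ (m + n)) = if m + n ≤ 0 then pm ρ (-(m + n)).toNat else 0 := by
    rw [Free.psimZ]; split_ifs <;> simp [freeRep_psim]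
  simpa only [map_mul, map_sub, map_smul, freeRep_gamPow, e1, e2, freeRep_xp, freeRep_xm] using h

theorem xp_mul_xp (m n : ℤ) : ∑ k ∈ range 4, Gminus.coeff k • (xp ρ (m + k) * xp ρ (n - k))
    = ∑ k ∈ range 4, Gplus.coeff k • (xp ρ (n - k) * xp ρ (m + k)) := by
  simpa only [map_mul, map_sum, map_smul, freeRep_xp] using freeRep_rel ρ (Rel.xp_xp m n)

theorem xm_mul_xm (m n : ℤ) : ∑ k ∈ range 4, Gplus.coeff k • (xm ρ (m + k) * xm ρ (n - k))
    = ∑ k ∈ range 4, Gminus.coeff k • (xm ρ (n - k) * xm ρ (m + k)) := by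
  simpa only [map_mul, map_sum, map_smul, freeRep_xm] using freeRep_rel ρ (Rel.xm_xm m n)

/-- For `ψ⁺_0` only the lowest term of each exchange relation survives, and `g`, `g⁻¹` and the ratio
of `g`'s all have constant term `1`. -/
theorem pp_zero_mem_zen : pp ρ 0 ∈ zen ρ := by
  have hg := isExp_g.zero
  have hg' := isExp_g_inv.zero
  have hr : coeff 0 (gRatioSeries ρ) = 1 := by
    rw [gRatioSeries, coeff_mul, Finset.Nat.antidiagonal_zero, sum_singleton, coeff_dil, coeff_dil,
      coeff_map, coeff_map, hg, hg']
    simp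
  refine ⟨mem_cen_of_gen fun a => ?_, mem_dcen _⟩
  cases a with
  | xp n =>
    have h := pp_mul_xp ρ 0 n
    simp only [zero_add, sum_range_one, hg', one_smul, Nat.cast_zero, neg_zero, zpow_zero,
      Units.val_one, one_mul, add_zero] at h
    exact h
  | xm n =>
    have h := pp_mul_xm ρ 0 n
    simp only [zero_add, sum_range_one, hg, one_smul, Nat.cast_zero, zpow_zero,
      Units.val_one, one_mul, add_zero] at h
    exact h
  | psip n => exact pp_commute ρ 0 n
  | psim n =>
    have h := pp_mul_pm ρ 0 n
    simp only [Nat.zero_min, zero_add, sum_range_one, hr, one_mul, Nat.sub_zero] at h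
    exact h
  | gam => exact (zen_commute (gh_mem_zen ρ) (mem_dcen _)).symm
  | gamInv => exact (zen_commute (units_inv_mem_zen (gh_mem_zen ρ)) (mem_dcen _)).symm

theorem pm_zero_mem_zen : pm ρ 0 ∈ zen ρ := by
  have hg := isExp_g.zero
  have hg' := isExp_g_inv.zero
  have hr : coeff 0 (gRatioSeries ρ) = 1 := by
    rw [gRatioSeries, coeff_mul, Finset.Nat.antidiagonal_zero, sum_singleton, coeff_dil, coeff_dil,
      coeff_map, coeff_map, hg, hg']
    simp
  refine ⟨mem_cen_of_gen fun a => ?_, mem_dcen _⟩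
  cases a with
  | xp n =>
    have h := pm_mul_xp ρ 0 n
    simp only [zero_add, sum_range_one, hg, one_smul, Nat.cast_zero, neg_zero, zpow_zero,
      Units.val_one, one_mul, sub_zero, Nat.sub_zero] at h
    exact h
  | xm n =>
    have h := pm_mul_xm ρ 0 n
    simp only [zero_add, sum_range_one, hg', one_smul, Nat.cast_zero, zpow_zero,
      Units.val_one, one_mul, sub_zero, Nat.sub_zero] at h
    exact h
  | psip n =>
    have h := pp_mul_pm ρ n 0
    simp only [Nat.min_zero, zero_add, sum_range_one, hr, one_mul, Nat.sub_zero] at h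
    exact h.symm
  | psim n => exact pm_commute ρ 0 n
  | gam => exact (zen_commute (gh_mem_zen ρ) (mem_dcen _)).symm
  | gamInv => exact (zen_commute (units_inv_mem_zen (gh_mem_zen ρ)) (mem_dcen _)).symm

/-! ### The filtration -/

/-- The filtration of `V` by the degrees of the products that kill a vector. -/
def filt (hadm : Admissible ρ) : Filt V where
  fl N :=
    { carrier := {v | ∀ l : List Gen, N < (l.map Gen.deg).sum → ρ ((l.map gen).prod) v = 0}
      add_mem' := fun hv hw l hl => by rw [map_add, hv l hl, hw l hl, add_zero]
      zero_mem' := fun l _ => by rw [map_zero]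
      smul_mem' := fun c v hv l hl => by rw [map_smul, hv l hl, smul_zero] }
  mono N M h v hv l hl := hv l (lt_of_le_of_lt h hl)
  bot N hN := by
    rw [eq_bot_iff]
    intro v hv
    have := hv [] (by simpa using hN)
    simpa using this
  exh v := by
    obtain ⟨N, hN⟩ := hadm v
    exact ⟨N, hN⟩

variable {ρ} (hadm : Admissible ρ)

/-- A letter at the end of a word acts first, so killing by longer words is exactly a statement
about the image of `a`. -/
theorem opDeg_gen (a : Gen) : OpDeg (filt ρ hadm) a.deg ⇑(ρ (gen a)) := by
  intro N v hv l hl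
  have := hv (l ++ [a]) (by simp; omega)
  simpa using this

theorem opDeg_of_mem_cen {z : Module.End F V} (hz : z ∈ cen ρ) : OpDeg (filt ρ hadm) 0 ⇑z := by
  intro N v hv l hl
  rw [cen, Subalgebra.mem_centralizer_iff] at hz
  have h := LinearMap.congr_fun (hz _ ⟨(l.map gen).prod, rfl⟩) v
  rw [Module.End.mul_apply, Module.End.mul_apply] at h
  rw [h, hv l (by omega), map_zero]

end Representation

/-! ### Degrees of operators and of exponentials -/

section OperatorDegree

variable {V : Type*} [AddCommGroup V] [Module F V] (fl : Filt V)

/-- The operators of degree `d`. -/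
def degSub (d : ℤ) : Submodule F (Module.End F V) where
  carrier := {T | OpDeg fl d ⇑T}
  add_mem' := fun hS hT N v hv => add_mem (hS N v hv) (hT N v hv)
  zero_mem' := fun _ _ _ => zero_mem _
  smul_mem' := fun c _ hT N v hv => Submodule.smul_mem _ c (hT N v hv)

variable {fl}

theorem mem_degSub {d : ℤ} {T : Module.End F V} : T ∈ degSub fl d ↔ OpDeg fl d ⇑T := Iff.rfl

theorem one_mem_degSub : (1 : Module.End F V) ∈ degSub fl 0 := fun N v hv => by simpa using hv

theorem mul_mem_degSub {d e : ℤ} {S T : Module.End F V} (hS : S ∈ degSub fl d)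
    (hT : T ∈ degSub fl e) : S * T ∈ degSub fl (d + e) :=
  (mem_degSub.1 hS).comp (mem_degSub.1 hT)

/-- The series with coefficients of degree `ε n`. -/
def SeriesDeg (fl : Filt V) (ε : ℤ) (f : PowerSeries (Module.End F V)) : Prop :=
  ∀ n : ℕ, coeff n f ∈ degSub fl (ε * n)

variable {ε : ℤ} {b Φ Φ' : PowerSeries (Module.End F V)}

theorem SeriesDeg.exp (h : IsExp b Φ) (hb : ∀ n : ℕ, 1 ≤ n → coeff n b ∈ degSub fl (ε * n)) :
    SeriesDeg fl ε Φ :=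
  h.mem_of_log_mem (fun n => degSub fl (ε * n)) (by simpa using one_mem_degSub)
    (fun i j x y hx hy => by
      have := mul_mem_degSub hx hy
      rwa [← mul_add, ← Nat.cast_add] at this) hb

theorem SeriesDeg.log (h : IsExp b Φ) (hΦ : SeriesDeg fl ε Φ) (n : ℕ) (hn : 1 ≤ n) :
    coeff n b ∈ degSub fl (ε * n) :=
  h.log_mem_of_mem (fun n => degSub fl (ε * n))
    (fun i j x y hx hy => by
      have := mul_mem_degSub hx hy
      rwa [← mul_add, ← Nat.cast_add] at this) hΦ n hn

theorem SeriesDeg.mul (h : SeriesDeg fl ε Φ) (h' : SeriesDeg fl ε Φ') :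
    SeriesDeg fl ε (Φ * Φ') := by
  intro n
  rw [coeff_mul]
  refine sum_mem fun ij hij => ?_
  have := mul_mem_degSub (h ij.1) (h' ij.2)
  rwa [← mul_add, ← Nat.cast_add, HasAntidiagonal.mem_antidiagonal.1 hij] at this

theorem SeriesDeg.rightDeg (h : SeriesDeg fl 1 Φ) : RightDeg fl Φ := fun j => by
  have := mem_degSub.1 (h j); rwa [one_mul] at this

theorem SeriesDeg.leftDeg (h : SeriesDeg fl (-1) Φ) : LeftDeg fl Φ := fun j => by
  have := mem_degSub.1 (h j); rwa [neg_one_mul] at this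

end OperatorDegree


/-! ### Commutation relations of the logarithms of `ψ^±` -/

section Logarithms

variable {V : Type*} [AddCommGroup V] [Module F V] (ρ : U →ₐ[F] Module.End F V)

theorem coeff_dil_map (u : (Module.End F V)ˣ) (f : PowerSeries F) (k : ℕ) :
    coeff k (dil u (PowerSeries.map (algebraMap F (Module.End F V)) f))
      = coeff k f • ((u ^ k : (Module.End F V)ˣ) : Module.End F V) := by
  rw [coeff_dil, coeff_map, ← Algebra.commutes, Algebra.smul_def]

theorem isExp_dil_map {b Φ : PowerSeries F} (h : IsExp b Φ) (u : (Module.End F V)ˣ) :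
    IsExp (dil u (PowerSeries.map (algebraMap F (Module.End F V)) b))
      (dil u (PowerSeries.map (algebraMap F (Module.End F V)) Φ)) :=
  h.map.dil fun n => by rw [coeff_map]; exact (Algebra.commutes _ _).symm

variable {ρ}

theorem coeff_dil_map_mem_zen {u : (Module.End F V)ˣ} (hu : (u : Module.End F V) ∈ zen ρ)
    (f : PowerSeries F) (k : ℕ) :
    coeff k (dil u (PowerSeries.map (algebraMap F (Module.End F V)) f)) ∈ zen ρ := by
  rw [coeff_dil_map]
  exact (zen ρ).smul_mem (units_pow_mem_zen hu k) _

/-- The logarithmic form of an exchange relation between a series and a current. -/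
theorem IsExp.log_relation {b Φ φ d : PowerSeries (Module.End F V)} (h : IsExp b Φ)
    {Ψ : ℕ → Module.End F V} {z : Module.End F V} (hΦ : ∀ n, coeff n Φ = z * Ψ n) (hz : z ∈ zen ρ)
    (hφ : IsExp d φ) (hφz : ∀ k, coeff k φ ∈ zen ρ) (hdz : ∀ k, coeff k d ∈ zen ρ)
    (hb : ∀ k, coeff k b ∈ dcen ρ) {x : ℕ → Module.End F V} (hx : ∀ i, x i ∈ dcen ρ)
    (hrel : ∀ m i, Ψ m * x i = ∑ k ∈ range (m + 1), coeff k φ * (x (i + k) * Ψ (m - k)))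
    (k : ℕ) (hk : 1 ≤ k) (i : ℕ) :
    coeff k b * x i = x i * coeff k b + coeff k d * x (i + k) := by
  refine (h.shift_iff hφ (fun i j => (zen_commute (hφz j) (hb i)).symm)
    (fun i j => zen_commute (hdz i) (zen_le_dcen (hφz j))) x).1 (fun m i => ?_) k hk i
  rw [hΦ, mul_assoc, hrel, Finset.Nat.sum_antidiagonal_eq_sum_range_succ_mk, mul_sum]
  refine sum_congr rfl fun k _ => ?_
  rw [hΦ, ← mul_assoc z, (zen_commute hz (zen_le_dcen (hφz k))).eq, mul_assoc, ← mul_assoc z,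
    (zen_commute hz (hx (i + k))).eq]
  simp only [mul_assoc]

variable (ρ)

/-- `(ψ⁺_0)⁻¹ ψ⁺(z)` -/
def psiPn : PowerSeries (Module.End F V) := C (Ring.inverse (psiP0 ρ)) * psiP ρ

/-- `(ψ⁻_0)⁻¹ ψ⁻(z)` -/
def psiMn : PowerSeries (Module.End F V) := C (Ring.inverse (psiM0 ρ)) * psiM ρ

theorem coeff_psiPn (n : ℕ) : coeff n (psiPn ρ) = Ring.inverse (psiP0 ρ) * pp ρ n := by
  rw [psiPn, coeff_C_mul, psiP, coeff_mk, pp]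

theorem coeff_psiMn (n : ℕ) : coeff n (psiMn ρ) = Ring.inverse (psiM0 ρ) * pm ρ n := by
  rw [psiMn, coeff_C_mul, psiM, coeff_mk, pm]

theorem inv_psiP0_mem_zen : Ring.inverse (psiP0 ρ) ∈ zen ρ := inverse_mem_zen (pp_zero_mem_zen ρ)

theorem inv_psiM0_mem_zen : Ring.inverse (psiM0 ρ) ∈ zen ρ := inverse_mem_zen (pm_zero_mem_zen ρ)

theorem coeff_psiPn_mem (n : ℕ) : coeff n (psiPn ρ) ∈ dcen ρ := by
  rw [coeff_psiPn]; exact mul_mem (zen_le_dcen (inv_psiP0_mem_zen ρ)) (mem_dcen _)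

theorem coeff_psiMn_mem (n : ℕ) : coeff n (psiMn ρ) ∈ dcen ρ := by
  rw [coeff_psiMn]; exact mul_mem (zen_le_dcen (inv_psiM0_mem_zen ρ)) (mem_dcen _)

theorem psiPn_commute : CoeffCommute (psiPn ρ) (psiPn ρ) := fun i j => by
  rw [coeff_psiPn, coeff_psiPn]
  have h := fun n => zen_commute (inv_psiP0_mem_zen ρ) (mem_dcen (gen (Gen.psip n)))
  exact ((Commute.refl _).mul_right (h j)).mul_left ((h i).symm.mul_right (pp_commute ρ i j))

theorem psiMn_commute : CoeffCommute (psiMn ρ) (psiMn ρ) := fun i j => by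
  rw [coeff_psiMn, coeff_psiMn]
  have h := fun n => zen_commute (inv_psiM0_mem_zen ρ) (mem_dcen (gen (Gen.psim n)))
  exact ((Commute.refl _).mul_right (h j)).mul_left ((h i).symm.mul_right (pm_commute ρ i j))

theorem isExp_psiPn (hψP : IsUnit (psiP0 ρ)) : IsExp (plog (psiPn ρ)) (psiPn ρ) :=
  isExp_plog (by rw [coeff_psiPn]; exact Ring.inverse_mul_cancel _ hψP) (psiPn_commute ρ)

theorem coeff_plog_psiPn_mem (hψP : IsUnit (psiP0 ρ)) (n : ℕ) : coeff n (plog (psiPn ρ)) ∈ dcen ρ := by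
  rcases Nat.eq_zero_or_pos n with rfl | hn
  · rw [coeff_zero_plog]; exact zero_mem _
  · exact (isExp_psiPn ρ hψP).log_mem_subalgebra _ (coeff_psiPn_mem ρ) n hn

theorem plog_psiPn_commute (hψP : IsUnit (psiP0 ρ)) : CoeffCommute (plog (psiPn ρ)) (plog (psiPn ρ)) := fun i j => by
  rcases Nat.eq_zero_or_pos i with rfl | hi
  · rw [coeff_zero_plog]; exact Commute.zero_left _
  rcases Nat.eq_zero_or_pos j with rfl | hj
  · rw [coeff_zero_plog]; exact Commute.zero_right _
  have h := isExp_psiPn ρ hψP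
  exact h.commute_log (fun n => (h.commute_log (fun m => psiPn_commute ρ n m) i hi).symm) j hj

/-- The structure function is `g(γ^{-1/2} u)⁻¹`, whose logarithm has the coefficients `-kap k
γ^{-k/2}`. The analogues for `x⁻` and for `ψ⁻` differ in the sign, in the power of `γ` and in the
direction of the shift. -/
theorem plog_psiPn_mul_xp (hψP : IsUnit (psiP0 ρ)) (k : ℕ) (hk : 1 ≤ k) (n : ℤ) :
    coeff k (plog (psiPn ρ)) * xp ρ n = xp ρ n * coeff k (plog (psiPn ρ))
      + ((-kap k) • (((gh ρ)⁻¹ ^ k : (Module.End F V)ˣ) : Module.End F V)) * xp ρ (n + k) := by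
  have hu := units_inv_mem_zen (gh_mem_zen ρ)
  have := (isExp_psiPn ρ hψP).log_relation (coeff_psiPn ρ) (inv_psiP0_mem_zen ρ)
    (isExp_dil_map isExp_g_inv (gh ρ)⁻¹) (coeff_dil_map_mem_zen hu _)
    (coeff_dil_map_mem_zen hu _) (coeff_plog_psiPn_mem ρ hψP) (x := fun i => xp ρ (n + i))
    (fun _ => mem_dcen _) (fun m i => by
      rw [pp_mul_xp]
      refine sum_congr rfl fun k _ => ?_
      rw [coeff_dil_map, smul_mul_assoc, ← zpow_natCast (gh ρ)⁻¹, inv_zpow', Nat.cast_add,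
        add_assoc]) k hk 0
  simpa only [coeff_dil_map, map_neg, coeff_mk, Nat.cast_zero, add_zero, sub_zero, zero_add]
    using this

theorem plog_psiPn_mul_xm (hψP : IsUnit (psiP0 ρ)) (k : ℕ) (hk : 1 ≤ k) (n : ℤ) :
    coeff k (plog (psiPn ρ)) * xm ρ n = xm ρ n * coeff k (plog (psiPn ρ))
      + (kap k • ((gh ρ ^ k : (Module.End F V)ˣ) : Module.End F V)) * xm ρ (n + k) := by
  have hu := gh_mem_zen ρ
  have := (isExp_psiPn ρ hψP).log_relation (coeff_psiPn ρ) (inv_psiP0_mem_zen ρ)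
    (isExp_dil_map isExp_g (gh ρ)) (coeff_dil_map_mem_zen hu _)
    (coeff_dil_map_mem_zen hu _) (coeff_plog_psiPn_mem ρ hψP) (x := fun i => xm ρ (n + i))
    (fun _ => mem_dcen _) (fun m i => by
      rw [pp_mul_xm]
      refine sum_congr rfl fun k _ => ?_
      rw [coeff_dil_map, smul_mul_assoc, ← zpow_natCast (gh ρ), Nat.cast_add,
        add_assoc]) k hk 0
  simpa only [coeff_dil_map, map_neg, coeff_mk, Nat.cast_zero, add_zero, sub_zero, zero_add]
    using this

/-- The coefficients of `ψ⁻` are read as a current `x_i = ψ⁻_{-(n-i)}`, suitably normalized and set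
to `0` for `i > n`, so that the criterion for currents applies. The logarithm of `g(γ u) / g(γ⁻¹ u)`
contributes `γ^k - γ^{-k}`. -/
theorem plog_psiPn_mul_psiMn (hψP : IsUnit (psiP0 ρ)) (k : ℕ) (hk : 1 ≤ k) (n : ℕ) :
    coeff k (plog (psiPn ρ)) * coeff n (psiMn ρ) = coeff n (psiMn ρ) * coeff k (plog (psiPn ρ))
      + if k ≤ n then (kap k • gammaDiff ρ k) * coeff (n - k) (psiMn ρ) else 0 := by
  have hu := gamma_mem_zen ρ
  have hu' := units_inv_mem_zen hu
  have hexp := (isExp_dil_map isExp_g (gamma ρ)).mul (isExp_dil_map isExp_g_inv (gamma ρ)⁻¹)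
    (fun i j => zen_commute (coeff_dil_map_mem_zen hu' _ i)
      (zen_le_dcen (coeff_dil_map_mem_zen hu _ j)))
  have hz : ∀ k, coeff k (gRatioSeries ρ) ∈ zen ρ := fun k => by
    rw [gRatioSeries, coeff_mul]
    exact sum_mem fun _ _ => mul_mem (coeff_dil_map_mem_zen hu _ _) (coeff_dil_map_mem_zen hu' _ _)
  have := (isExp_psiPn ρ hψP).log_relation (coeff_psiPn ρ) (inv_psiP0_mem_zen ρ) hexp hz
    (fun k => by
      rw [map_add]
      exact add_mem (coeff_dil_map_mem_zen hu _ _) (coeff_dil_map_mem_zen hu' _ _))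
    (coeff_plog_psiPn_mem ρ hψP) (x := fun i => if i ≤ n then coeff (n - i) (psiMn ρ) else 0)
    (fun i => by
      split_ifs
      · exact coeff_psiMn_mem ρ _
      · exact zero_mem _) (fun m i => by
      by_cases hi : i ≤ n
      · rw [if_pos hi, coeff_psiMn]
        have hc := zen_commute (inv_psiM0_mem_zen ρ) (mem_dcen (gen (Gen.psip m)))
        rw [← mul_assoc, show pp ρ m * Ring.inverse (psiM0 ρ) = Ring.inverse (psiM0 ρ) * pp ρ m from
          hc.eq.symm, mul_assoc, pp_mul_pm, mul_sum]
        have hsub : range (min m (n - i) + 1) ⊆ range (m + 1) :=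
          range_subset_range.2 (by omega)
        rw [← sum_subset hsub]
        · refine sum_congr rfl fun k hk => ?_
          have hk' := mem_range.1 hk
          rw [if_pos (by omega), coeff_psiMn, ← mul_assoc (Ring.inverse _),
            (zen_commute (inv_psiM0_mem_zen ρ) (zen_le_dcen (hz k))).eq, Nat.sub_sub]
          simp only [gRatioSeries, mul_assoc]
        · intro k hk hk'
          have h1 := mem_range.1 hk
          rw [mem_range] at hk'
          rw [if_neg (by omega), zero_mul, mul_zero]
      · rw [if_neg hi, mul_zero, sum_eq_zero]
        intro k _
        rw [if_neg (by omega), zero_mul, mul_zero]) k hk 0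
  simp only [Nat.zero_le, if_true, Nat.sub_zero, zero_add, map_add, coeff_dil_map, coeff_mk] at this
  rw [this, gammaDiff, smul_sub, neg_smul, ← sub_eq_add_neg, mul_ite, mul_zero]

theorem isExp_psiMn (hψM : IsUnit (psiM0 ρ)) : IsExp (plog (psiMn ρ)) (psiMn ρ) :=
  isExp_plog (by rw [coeff_psiMn]; exact Ring.inverse_mul_cancel _ hψM) (psiMn_commute ρ)

theorem coeff_plog_psiMn_mem (hψM : IsUnit (psiM0 ρ)) (n : ℕ) : coeff n (plog (psiMn ρ)) ∈ dcen ρ := by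
  rcases Nat.eq_zero_or_pos n with rfl | hn
  · rw [coeff_zero_plog]; exact zero_mem _
  · exact (isExp_psiMn ρ hψM).log_mem_subalgebra _ (coeff_psiMn_mem ρ) n hn

theorem plog_psiMn_commute (hψM : IsUnit (psiM0 ρ)) : CoeffCommute (plog (psiMn ρ)) (plog (psiMn ρ)) := fun i j => by
  rcases Nat.eq_zero_or_pos i with rfl | hi
  · rw [coeff_zero_plog]; exact Commute.zero_left _
  rcases Nat.eq_zero_or_pos j with rfl | hj
  · rw [coeff_zero_plog]; exact Commute.zero_right _
  have h := isExp_psiMn ρ hψM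
  exact h.commute_log (fun n => (h.commute_log (fun m => psiMn_commute ρ n m) i hi).symm) j hj

theorem plog_psiMn_mul_xp (hψM : IsUnit (psiM0 ρ)) (k : ℕ) (hk : 1 ≤ k) (n : ℤ) :
    coeff k (plog (psiMn ρ)) * xp ρ n = xp ρ n * coeff k (plog (psiMn ρ))
      + (kap k • (((gh ρ)⁻¹ ^ k : (Module.End F V)ˣ) : Module.End F V)) * xp ρ (n - k) := by
  have hu := units_inv_mem_zen (gh_mem_zen ρ)
  have := (isExp_psiMn ρ hψM).log_relation (coeff_psiMn ρ) (inv_psiM0_mem_zen ρ)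
    (isExp_dil_map isExp_g (gh ρ)⁻¹) (coeff_dil_map_mem_zen hu _)
    (coeff_dil_map_mem_zen hu _) (coeff_plog_psiMn_mem ρ hψM) (x := fun i => xp ρ (n - i))
    (fun _ => mem_dcen _) (fun m i => by
      rw [pm_mul_xp]
      refine sum_congr rfl fun k _ => ?_
      rw [coeff_dil_map, smul_mul_assoc, ← zpow_natCast (gh ρ)⁻¹, inv_zpow', Nat.cast_add,
        sub_sub]) k hk 0
  simpa only [coeff_dil_map, map_neg, coeff_mk, Nat.cast_zero, add_zero, sub_zero, zero_add]
    using this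

theorem plog_psiMn_mul_xm (hψM : IsUnit (psiM0 ρ)) (k : ℕ) (hk : 1 ≤ k) (n : ℤ) :
    coeff k (plog (psiMn ρ)) * xm ρ n = xm ρ n * coeff k (plog (psiMn ρ))
      + ((-kap k) • ((gh ρ ^ k : (Module.End F V)ˣ) : Module.End F V)) * xm ρ (n - k) := by
  have hu := gh_mem_zen ρ
  have := (isExp_psiMn ρ hψM).log_relation (coeff_psiMn ρ) (inv_psiM0_mem_zen ρ)
    (isExp_dil_map isExp_g_inv (gh ρ)) (coeff_dil_map_mem_zen hu _)
    (coeff_dil_map_mem_zen hu _) (coeff_plog_psiMn_mem ρ hψM) (x := fun i => xm ρ (n - i))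
    (fun _ => mem_dcen _) (fun m i => by
      rw [pm_mul_xm]
      refine sum_congr rfl fun k _ => ?_
      rw [coeff_dil_map, smul_mul_assoc, ← zpow_natCast (gh ρ), Nat.cast_add,
        sub_sub]) k hk 0
  simpa only [coeff_dil_map, map_neg, coeff_mk, Nat.cast_zero, add_zero, sub_zero, zero_add]
    using this

/-- Taking the logarithm of the second factor as well yields a Heisenberg relation, the central term
being concentrated at `l = k`. -/
theorem plog_psiPn_mul_plog_psiMn (hψP : IsUnit (psiP0 ρ)) (hψM : IsUnit (psiM0 ρ))
    (k : ℕ) (hk : 1 ≤ k) (l : ℕ) (hl : 1 ≤ l) :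
    coeff k (plog (psiPn ρ)) * coeff l (plog (psiMn ρ))
      = coeff l (plog (psiMn ρ)) * coeff k (plog (psiPn ρ))
        + if l = k then kap k • gammaDiff ρ k else 0 :=
  ((isExp_psiMn ρ hψM).heisenberg_iff _ _ hk fun n =>
    zen_commute ((zen ρ).smul_mem (gammaDiff_mem_zen ρ k) _) (coeff_plog_psiMn_mem ρ hψM n)).1
    (plog_psiPn_mul_psiMn ρ hψP k hk) l hl

end Logarithms


/-! ### The dressings of `x⁺` and `x⁻` and their Heisenberg relations -/

section Dressings

variable {V : Type*} [AddCommGroup V] [Module F V] (ρ : U →ₐ[F] Module.End F V)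

/-- `log α(z)` -/
def logAlpha : PowerSeries (Module.End F V) :=
  posSeries fun n => -(Ring.inverse (gammaDiff ρ n) * bM ρ n)

/-- `log β(z)` -/
def logBeta : PowerSeries (Module.End F V) :=
  posSeries fun n => Ring.inverse (gammaDiff ρ n) * bP ρ n

/-- The central factor relating `log ψ^±` to `log α` and `log β`. -/
def logScale (n : ℕ) : Module.End F V :=
  Ring.inverse (gammaDiff ρ n) * (((gh ρ)⁻¹ ^ n : (Module.End F V)ˣ) : Module.End F V)

theorem logScale_mem_zen (n : ℕ) : logScale ρ n ∈ zen ρ :=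
  mul_mem (inverse_mem_zen (gammaDiff_mem_zen ρ n))
    (units_pow_mem_zen (units_inv_mem_zen (gh_mem_zen ρ)) n)

theorem coeff_posSeries (c : ℕ → Module.End F V) (n : ℕ) :
    coeff n (posSeries c) = if n = 0 then 0 else c n := by
  rw [posSeries, coeff_mk]

theorem coeff_logBeta (hψP : IsUnit (psiP0 ρ)) (n : ℕ) :
    coeff n (logBeta ρ) = logScale ρ n * coeff n (plog (psiPn ρ)) := by
  rw [logBeta, coeff_posSeries]
  split_ifs with h
  · rw [h, coeff_zero_plog, mul_zero]
  · rw [bP, ← psiPn, logScale, mul_assoc,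
      (zen_commute (units_pow_mem_zen (units_inv_mem_zen (gh_mem_zen ρ)) n)
        (coeff_plog_psiPn_mem ρ hψP n)).eq]

theorem coeff_logAlpha (hψM : IsUnit (psiM0 ρ)) (n : ℕ) :
    coeff n (logAlpha ρ) = logScale ρ n * coeff n (plog (psiMn ρ)) := by
  rw [logAlpha, coeff_posSeries]
  split_ifs with h
  · rw [h, coeff_zero_plog, mul_zero]
  · rw [bM, ← psiMn, logScale, mul_assoc, mul_neg, neg_neg,
      (zen_commute (units_pow_mem_zen (units_inv_mem_zen (gh_mem_zen ρ)) n)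
        (coeff_plog_psiMn_mem ρ hψM n)).eq]

theorem coeff_logBeta_mem (hψP : IsUnit (psiP0 ρ)) (n : ℕ) : coeff n (logBeta ρ) ∈ dcen ρ := by
  rw [coeff_logBeta ρ hψP]
  exact mul_mem (zen_le_dcen (logScale_mem_zen ρ n)) (coeff_plog_psiPn_mem ρ hψP n)

theorem coeff_logAlpha_mem (hψM : IsUnit (psiM0 ρ)) (n : ℕ) : coeff n (logAlpha ρ) ∈ dcen ρ := by
  rw [coeff_logAlpha ρ hψM]
  exact mul_mem (zen_le_dcen (logScale_mem_zen ρ n)) (coeff_plog_psiMn_mem ρ hψM n)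

theorem logBeta_commute (hψP : IsUnit (psiP0 ρ)) : CoeffCommute (logBeta ρ) (logBeta ρ) :=
  fun i j => by
    rw [coeff_logBeta ρ hψP, coeff_logBeta ρ hψP]
    have h := fun n m => zen_commute (logScale_mem_zen ρ n) (coeff_plog_psiPn_mem ρ hψP m)
    exact ((zen_commute (logScale_mem_zen ρ i) (zen_le_dcen (logScale_mem_zen ρ j))).mul_right
      (h i j)).mul_left ((h j i).symm.mul_right (plog_psiPn_commute ρ hψP i j))

theorem logAlpha_commute (hψM : IsUnit (psiM0 ρ)) : CoeffCommute (logAlpha ρ) (logAlpha ρ) :=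
  fun i j => by
    rw [coeff_logAlpha ρ hψM, coeff_logAlpha ρ hψM]
    have h := fun n m => zen_commute (logScale_mem_zen ρ n) (coeff_plog_psiMn_mem ρ hψM m)
    exact ((zen_commute (logScale_mem_zen ρ i) (zen_le_dcen (logScale_mem_zen ρ j))).mul_right
      (h i j)).mul_left ((h j i).symm.mul_right (plog_psiMn_commute ρ hψM i j))

theorem isExp_alpha (hψM : IsUnit (psiM0 ρ)) : IsExp (logAlpha ρ) (alpha ρ) :=
  isExp_pexp (by rw [logAlpha, coeff_posSeries, if_pos rfl]) (logAlpha_commute ρ hψM)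

theorem isExp_beta (hψP : IsUnit (psiP0 ρ)) : IsExp (logBeta ρ) (beta ρ) :=
  isExp_pexp (by rw [logBeta, coeff_posSeries, if_pos rfl]) (logBeta_commute ρ hψP)

/-- `(1/n)(1 - qⁿ)(1 - t⁻ⁿ)(1 - p⁻ⁿ) γ^{kn} / (γⁿ - γ⁻ⁿ)` -/
def heis (k : ℤ) (n : ℕ) : Module.End F V :=
  kap n • (Ring.inverse (gammaDiff ρ n) * ((gamma ρ ^ (k * n) : (Module.End F V)ˣ) : Module.End F V))

theorem heis_mem_zen (k : ℤ) (n : ℕ) : heis ρ k n ∈ zen ρ :=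
  (zen ρ).smul_mem (mul_mem (inverse_mem_zen (gammaDiff_mem_zen ρ n))
    (units_zpow_mem_zen (gamma_mem_zen ρ) _)) _

theorem gamma_zpow_mul_heis (k l : ℤ) (n : ℕ) :
    ((gamma ρ ^ (l * n) : (Module.End F V)ˣ) : Module.End F V) * heis ρ k n = heis ρ (l + k) n := by
  have h := zen_commute (inverse_mem_zen (gammaDiff_mem_zen ρ n))
    (zen_le_dcen (units_zpow_mem_zen (gamma_mem_zen ρ) (l * n)))
  rw [heis, heis, mul_smul_comm, ← mul_assoc, ← h.eq, mul_assoc, ← Units.val_mul, ← zpow_add,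
    add_mul]

variable {ρ} in
theorem mul_eq_of_central {z L X r : Module.End F V} (hz : z ∈ zen ρ) (hX : X ∈ dcen ρ)
    (h : L * X = X * L + r) : z * L * X = X * (z * L) + z * r := by
  rw [mul_assoc, h, mul_add, ← mul_assoc, (zen_commute hz hX).eq, mul_assoc]

theorem xp_mem_dcen (n : ℤ) : xp ρ n ∈ dcen ρ := mem_dcen _

theorem xm_mem_dcen (n : ℤ) : xm ρ n ∈ dcen ρ := mem_dcen _

/-- The factor `γ^{-k/2}` of `logScale` and the one in the relation of `ψ⁺` with `x⁺` combine to
`γ^{-k}`, hence the exponent `-1` in `heis`. For `x⁻` the two powers cancel and the exponent is `0`.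
-/
theorem logBeta_mul_xp (hψP : IsUnit (psiP0 ρ)) (k : ℕ) (hk : 1 ≤ k) (n : ℤ) :
    coeff k (logBeta ρ) * xp ρ n = xp ρ n * coeff k (logBeta ρ) - heis ρ (-1) k * xp ρ (n + k) := by
  rw [coeff_logBeta ρ hψP, mul_eq_of_central (logScale_mem_zen ρ k) (xp_mem_dcen ρ n)
    (plog_psiPn_mul_xp ρ hψP k hk n), sub_eq_add_neg _ (heis _ _ _ * _), ← mul_assoc (logScale ρ k), ← neg_mul]
  congr 2
  rw [logScale, heis, neg_smul, mul_neg, mul_smul_comm, mul_assoc, ← Units.val_mul, gamma,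
    ← zpow_natCast, inv_zpow', ← zpow_natCast, ← zpow_mul, ← zpow_add]
  congr 5
  push_cast; ring

theorem logAlpha_mul_xp (hψM : IsUnit (psiM0 ρ)) (k : ℕ) (hk : 1 ≤ k) (n : ℤ) :
    coeff k (logAlpha ρ) * xp ρ n
      = xp ρ n * coeff k (logAlpha ρ) + heis ρ (-1) k * xp ρ (n - k) := by
  rw [coeff_logAlpha ρ hψM, mul_eq_of_central (logScale_mem_zen ρ k) (xp_mem_dcen ρ n)
    (plog_psiMn_mul_xp ρ hψM k hk n), ← mul_assoc (logScale ρ k)]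
  congr 2
  rw [logScale, heis, mul_smul_comm, mul_assoc, ← Units.val_mul, gamma,
    ← zpow_natCast, inv_zpow', ← zpow_natCast, ← zpow_mul, ← zpow_add]
  congr 4
  push_cast; ring

theorem logBeta_mul_xm (hψP : IsUnit (psiP0 ρ)) (k : ℕ) (hk : 1 ≤ k) (n : ℤ) :
    coeff k (logBeta ρ) * xm ρ n = xm ρ n * coeff k (logBeta ρ) + heis ρ 0 k * xm ρ (n + k) := by
  rw [coeff_logBeta ρ hψP, mul_eq_of_central (logScale_mem_zen ρ k) (xm_mem_dcen ρ n)
    (plog_psiPn_mul_xm ρ hψP k hk n), ← mul_assoc (logScale ρ k)]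
  congr 2
  rw [logScale, heis, mul_smul_comm, mul_assoc, ← Units.val_mul, zero_mul, zpow_zero, inv_pow,
    inv_mul_cancel]

theorem logAlpha_mul_xm (hψM : IsUnit (psiM0 ρ)) (k : ℕ) (hk : 1 ≤ k) (n : ℤ) :
    coeff k (logAlpha ρ) * xm ρ n
      = xm ρ n * coeff k (logAlpha ρ) - heis ρ 0 k * xm ρ (n - k) := by
  rw [coeff_logAlpha ρ hψM, mul_eq_of_central (logScale_mem_zen ρ k) (xm_mem_dcen ρ n)
    (plog_psiMn_mul_xm ρ hψM k hk n), sub_eq_add_neg _ (heis _ _ _ * _), ← mul_assoc (logScale ρ k), ← neg_mul]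
  congr 2
  rw [logScale, heis, neg_smul, mul_neg, mul_smul_comm, mul_assoc, ← Units.val_mul, zero_mul,
    zpow_zero, inv_pow, inv_mul_cancel]

/-- Two factors `1 / (γ^k - γ^{-k})` meet one factor `γ^k - γ^{-k}` from the bracket, which leaves
the same constant as in `logBeta_mul_xp` and `logAlpha_mul_xp`. This coincidence is what makes the
dressing work. -/
theorem logBeta_mul_logAlpha (hψP : IsUnit (psiP0 ρ)) (hψM : IsUnit (psiM0 ρ))
    (hγ : ∀ n : ℕ, 1 ≤ n → IsUnit (gammaDiff ρ n)) (k : ℕ) (hk : 1 ≤ k) (l : ℕ) (hl : 1 ≤ l) :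
    coeff k (logBeta ρ) * coeff l (logAlpha ρ)
      = coeff l (logAlpha ρ) * coeff k (logBeta ρ) + if l = k then heis ρ (-1) k else 0 := by
  have hLM := coeff_plog_psiMn_mem ρ hψM l
  have hLP := coeff_plog_psiPn_mem ρ hψP k
  rw [coeff_logBeta ρ hψP, coeff_logAlpha ρ hψM]
  set LP := coeff k (plog (psiPn ρ))
  set LM := coeff l (plog (psiMn ρ))
  have h := plog_psiPn_mul_plog_psiMn ρ hψP hψM k hk l hl
  have h1 := (zen_commute (logScale_mem_zen ρ l) hLP).eq
  have h2 : logScale ρ k * LP * LM = LM * (logScale ρ k * LP)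
      + logScale ρ k * (if l = k then kap k • gammaDiff ρ k else 0) :=
    mul_eq_of_central (logScale_mem_zen ρ k) hLM h
  have h3 := (zen_commute (logScale_mem_zen ρ l) (zen_le_dcen (logScale_mem_zen ρ k))).eq
  have h4 : logScale ρ k * LP * (logScale ρ l * LM) = logScale ρ l * (logScale ρ k * LP * LM) := by
    rw [← mul_assoc, mul_assoc _ LP, ← h1, ← mul_assoc, ← h3]
    simp only [mul_assoc]
  rw [h4, h2, mul_add, ← mul_assoc]
  congr 1
  split_ifs with hlk
  · subst hlk
    have hc := zen_commute (inverse_mem_zen (gammaDiff_mem_zen ρ l))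
      (zen_le_dcen (units_pow_mem_zen (units_inv_mem_zen (gh_mem_zen ρ)) l))
    have hc' := zen_commute (units_pow_mem_zen (units_inv_mem_zen (gh_mem_zen ρ)) l)
      (zen_le_dcen (gammaDiff_mem_zen ρ l))
    rw [heis, mul_smul_comm, mul_smul_comm]
    congr 1
    rw [logScale, mul_assoc _ _ (gammaDiff ρ l), hc'.eq, ← mul_assoc _ (gammaDiff ρ l),
      Ring.inverse_mul_cancel _ (hγ l hl), one_mul, mul_assoc, ← Units.val_mul, gamma,
      ← zpow_natCast, inv_zpow', ← zpow_natCast, ← zpow_mul, ← zpow_add]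
    congr 3
    push_cast; ring
  · rw [mul_zero, mul_zero]

/-- A current `x` together with exponentials `α = exp M` and `β = exp P`, for which `α x β` commutes
with `P` and `M`. -/
structure IsDressing (hadm : Admissible ρ) (M P : PowerSeries (Module.End F V))
    (c : ℕ → Module.End F V) (x : ℤ → Module.End F V) (α β : PowerSeries (Module.End F V)) :
    Prop where
  exp_left : IsExp M α
  exp_right : IsExp P β
  mem_left : ∀ k, coeff k M ∈ dcen ρ
  mem_right : ∀ k, coeff k P ∈ dcen ρ
  mem_mid : ∀ n, x n ∈ dcen ρ
  mem_central : ∀ k, c k ∈ zen ρ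
  comm_left : CoeffCommute M M
  comm_right : CoeffCommute P P
  right_left : ∀ k, 1 ≤ k → ∀ l, 1 ≤ l →
    coeff k P * coeff l M = coeff l M * coeff k P + if l = k then c k else 0
  right_mid : ∀ k, 1 ≤ k → ∀ n, coeff k P * x n = x n * coeff k P - c k * x (n + k)
  left_mid : ∀ k, 1 ≤ k → ∀ n, coeff k M * x n = x n * coeff k M + c k * x (n - k)
  deg_left : ∀ k : ℕ, 1 ≤ k → coeff k M ∈ degSub (filt ρ hadm) (-1 * k)
  deg_right : ∀ k : ℕ, 1 ≤ k → coeff k P ∈ degSub (filt ρ hadm) (1 * k)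
  deg_mid : CurDeg (filt ρ hadm) 0 (toCur x)

variable {ρ}

theorem opDeg_zen (hadm : Admissible ρ) {z : Module.End F V} (hz : z ∈ zen ρ) :
    z ∈ degSub (filt ρ hadm) 0 := opDeg_of_mem_cen hadm hz.1

theorem zen_mul_mem_degSub (hadm : Admissible ρ) {z T : Module.End F V} {d : ℤ} (hz : z ∈ zen ρ)
    (hT : T ∈ degSub (filt ρ hadm) d) : z * T ∈ degSub (filt ρ hadm) d := by
  have := mul_mem_degSub (opDeg_zen hadm hz) hT
  rwa [zero_add] at this

/-- The operators that commute with a family of operators. -/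
def commSub (T : ℤ → Module.End F V) : Subalgebra F (Module.End F V) :=
  Subalgebra.centralizer F (Set.range T)

theorem mem_commSub {T : ℤ → Module.End F V} {D : Module.End F V} :
    D ∈ commSub T ↔ CommutesWith (toCur T) D := by
  rw [commSub, Subalgebra.mem_centralizer_iff]
  constructor
  · intro h n v
    exact LinearMap.congr_fun (h _ ⟨n, rfl⟩) v
  · rintro h _ ⟨n, rfl⟩
    exact LinearMap.ext fun v => h n v

namespace IsDressing

variable {hadm : Admissible ρ} {M P α β : PowerSeries (Module.End F V)}
  {c : ℕ → Module.End F V} {x : ℤ → Module.End F V}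

theorem coeff_left_mem (h : IsDressing ρ hadm M P c x α β) (k : ℕ) : coeff k α ∈ dcen ρ :=
  h.exp_left.mem_subalgebra _ (fun n _ => h.mem_left n) k

theorem coeff_right_mem (h : IsDressing ρ hadm M P c x α β) (k : ℕ) : coeff k β ∈ dcen ρ :=
  h.exp_right.mem_subalgebra _ (fun n _ => h.mem_right n) k

theorem seriesDeg_left (h : IsDressing ρ hadm M P c x α β) : SeriesDeg (filt ρ hadm) (-1) α :=
  SeriesDeg.exp h.exp_left h.deg_left

theorem seriesDeg_right (h : IsDressing ρ hadm M P c x α β) : SeriesDeg (filt ρ hadm) 1 β :=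
  SeriesDeg.exp h.exp_right h.deg_right

theorem leftDeg (h : IsDressing ρ hadm M P c x α β) : LeftDeg (filt ρ hadm) α :=
  h.seriesDeg_left.leftDeg

theorem rightDeg (h : IsDressing ρ hadm M P c x α β) : RightDeg (filt ρ hadm) β :=
  h.seriesDeg_right.rightDeg

/-- The dressed current consists of operators that commute with the Heisenberg generators. -/
theorem exists_op (h : IsDressing ρ hadm M P c x α β) :
    ∃ T : ℤ → Module.End F V, dress α (toCur x) β = toCur T ∧ (∀ z ∈ zen ρ, z ∈ commSub T) ∧
      (∀ k, 1 ≤ k → coeff k M ∈ commSub T) ∧ ∀ k, 1 ≤ k → coeff k P ∈ commSub T := by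
  obtain ⟨T, hT⟩ := dress_linear (a := α) h.deg_mid h.rightDeg
  refine ⟨T, hT, fun z hz => ?_, fun k hk => ?_, fun k hk => ?_⟩
  · rw [mem_commSub, ← hT]
    exact dress_commute h.deg_mid h.rightDeg (fun i => zen_commute hz (h.coeff_left_mem i))
      (fun n => zen_commute hz (h.mem_mid n)) fun j => zen_commute hz (h.coeff_right_mem j)
  · rw [mem_commSub, ← hT]
    refine dress_commute_right (c := c k) (k := k) h.deg_mid h.rightDeg
      (fun i => h.exp_left.commute_of_log (fun n _ => h.comm_left k n) i) (h.left_mid k hk)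
      (fun j => ?_) (fun i => zen_commute (h.mem_central k) (h.coeff_left_mem i))
      (fun n => zen_commute (h.mem_central k) (h.mem_mid n))
    -- Seen from `M`, the bracket with `P` has the opposite sign, hence the constant `-c k`.
    have := (h.exp_right.heisenberg_iff (coeff k M) (-c k) hk
      (fun n => (zen_commute (h.mem_central k) (h.mem_right n)).neg_left)).2 (fun l hl => by
        rw [h.right_left l hl k hk]
        by_cases hlk : k = l
        · subst hlk; simp
        · rw [if_neg hlk, if_neg (Ne.symm hlk), add_zero, add_zero]) j
    rw [this, sub_eq_add_neg]
    split_ifs <;> simp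
  · rw [mem_commSub, ← hT]
    refine dress_commute_left (c := c k) (k := k) h.deg_mid h.rightDeg ?_ (h.right_mid k hk)
      (fun i => h.exp_right.commute_of_log (fun n _ => h.comm_right k n) i)
      (fun i => zen_commute (h.mem_central k) (h.coeff_left_mem i))
    exact (h.exp_left.heisenberg_iff (coeff k P) (c k) hk
      (fun n => zen_commute (h.mem_central k) (h.mem_left n))).2 fun l hl =>
        h.right_left k hk l hl

end IsDressing

variable (hadm : Admissible ρ)

theorem curDeg_xp : CurDeg (filt ρ hadm) 0 (toCur (xp ρ)) := fun n => by
  rw [add_zero]; exact opDeg_gen hadm (Gen.xp n)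

theorem curDeg_xm : CurDeg (filt ρ hadm) 0 (toCur (xm ρ)) := fun n => by
  rw [add_zero]; exact opDeg_gen hadm (Gen.xm n)

theorem seriesDeg_psiPn : SeriesDeg (filt ρ hadm) 1 (psiPn ρ) := fun n => by
  rw [coeff_psiPn, one_mul]
  exact zen_mul_mem_degSub hadm (inv_psiP0_mem_zen ρ) (opDeg_gen hadm (Gen.psip n))

theorem seriesDeg_psiMn : SeriesDeg (filt ρ hadm) (-1) (psiMn ρ) := fun n => by
  rw [coeff_psiMn, neg_one_mul]
  exact zen_mul_mem_degSub hadm (inv_psiM0_mem_zen ρ) (opDeg_gen hadm (Gen.psim n))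

theorem deg_logAlpha (hψM : IsUnit (psiM0 ρ)) (k : ℕ) (hk : 1 ≤ k) :
    coeff k (logAlpha ρ) ∈ degSub (filt ρ hadm) (-1 * k) := by
  rw [coeff_logAlpha ρ hψM]
  exact zen_mul_mem_degSub hadm (logScale_mem_zen ρ k)
    (SeriesDeg.log (isExp_psiMn ρ hψM) (seriesDeg_psiMn hadm) k hk)

theorem deg_logBeta (hψP : IsUnit (psiP0 ρ)) (k : ℕ) (hk : 1 ≤ k) :
    coeff k (logBeta ρ) ∈ degSub (filt ρ hadm) (1 * k) := by
  rw [coeff_logBeta ρ hψP]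
  exact zen_mul_mem_degSub hadm (logScale_mem_zen ρ k)
    (SeriesDeg.log (isExp_psiPn ρ hψP) (seriesDeg_psiPn hadm) k hk)

theorem isDressing_t (hψP : IsUnit (psiP0 ρ)) (hψM : IsUnit (psiM0 ρ))
    (hγ : ∀ n : ℕ, 1 ≤ n → IsUnit (gammaDiff ρ n)) :
    IsDressing ρ hadm (logAlpha ρ) (logBeta ρ) (heis ρ (-1)) (xp ρ) (alpha ρ) (beta ρ) where
  exp_left := isExp_alpha ρ hψM
  exp_right := isExp_beta ρ hψP
  mem_left := coeff_logAlpha_mem ρ hψM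
  mem_right := coeff_logBeta_mem ρ hψP
  mem_mid _ := mem_dcen _
  mem_central := heis_mem_zen ρ (-1)
  comm_left := logAlpha_commute ρ hψM
  comm_right := logBeta_commute ρ hψP
  right_left := logBeta_mul_logAlpha ρ hψP hψM hγ
  right_mid := logBeta_mul_xp ρ hψP
  left_mid := logAlpha_mul_xp ρ hψM
  deg_left := deg_logAlpha hadm hψM
  deg_right := deg_logBeta hadm hψP
  deg_mid := curDeg_xp hadm

theorem CoeffCommute.dil {f h : PowerSeries (Module.End F V)} (H : CoeffCommute f h)
    (hf : ∀ n, coeff n f ∈ dcen ρ) (hh : ∀ n, coeff n h ∈ dcen ρ) {c c' : (Module.End F V)ˣ}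
    (hc : (c : Module.End F V) ∈ zen ρ) (hc' : (c' : Module.End F V) ∈ zen ρ) :
    CoeffCommute (dil c f) (DingIohara.dil c' h) := fun i j => by
  rw [coeff_dil, coeff_dil]
  have hci := units_pow_mem_zen hc i
  have hcj := units_pow_mem_zen hc' j
  exact ((zen_commute hci (zen_le_dcen hcj)).mul_right (zen_commute hci (hh j))).mul_left
    ((zen_commute hcj (hf i)).symm.mul_right (H i j))

theorem CoeffCommute.neg {f h : PowerSeries (Module.End F V)} (H : CoeffCommute f h) :
    CoeffCommute (-f) (-h) := fun i j => by
  rw [map_neg, map_neg]; exact (H i j).neg_left.neg_right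

variable (ρ)

/-- `x⁻(p⁻¹ γ⁻¹ z)` -/
def xs (n : ℤ) : Module.End F V :=
  (((pU⁻¹ * (gamma ρ)⁻¹) ^ (-n) : (Module.End F V)ˣ) : Module.End F V) * xm ρ n

/-- `log α(p⁻¹ z)⁻¹` -/
def logAlphaStar : PowerSeries (Module.End F V) := -dil pU⁻¹ (logAlpha ρ)

/-- `log β(γ⁻² p⁻¹ z)⁻¹` -/
def logBetaStar : PowerSeries (Module.End F V) :=
  -dil ((gamma ρ)⁻¹ ^ 2 * pU⁻¹)⁻¹ (logBeta ρ)

/-- `α(p⁻¹ z)⁻¹` -/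
def alphaStar : PowerSeries (Module.End F V) := Ring.inverse (alphaAt ρ pU⁻¹)

/-- `β(γ⁻² p⁻¹ z)⁻¹` -/
def betaStar : PowerSeries (Module.End F V) :=
  Ring.inverse (betaAt ρ ((gamma ρ)⁻¹ ^ 2 * pU⁻¹))

variable {ρ}

theorem pU_commute (u : (Module.End F V)ˣ) : Commute (pU : (Module.End F V)ˣ) u :=
  Units.ext (Algebra.commutes p (u : Module.End F V))

variable (ρ) in
/-- The central unit `p^a γ^b`. -/
def mon (a b : ℤ) : (Module.End F V)ˣ := pU ^ a * gamma ρ ^ b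

theorem mon_mul (a b c d : ℤ) : mon ρ a b * mon ρ c d = mon ρ (a + c) (b + d) := by
  rw [mon, mon, mon, zpow_add, zpow_add, mul_assoc, ← mul_assoc (gamma ρ ^ b),
    ((pU_commute (gamma ρ)).zpow_zpow c b).eq.symm]
  simp only [mul_assoc]

theorem mon_zpow (a b n : ℤ) : mon ρ a b ^ n = mon ρ (a * n) (b * n) := by
  rw [mon, ((pU_commute (gamma ρ)).zpow_zpow a b).mul_zpow, ← zpow_mul, ← zpow_mul, mon]

theorem mon_pow (a b : ℤ) (n : ℕ) : mon ρ a b ^ n = mon ρ (a * n) (b * n) := by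
  rw [← zpow_natCast, mon_zpow]

theorem mon_inv (a b : ℤ) : (mon ρ a b)⁻¹ = mon ρ (-a) (-b) := by
  rw [← zpow_neg_one, mon_zpow, mul_neg_one, mul_neg_one]

theorem pU_inv_eq_mon : (pU⁻¹ : (Module.End F V)ˣ) = mon ρ (-1) 0 := by
  rw [mon, zpow_zero, mul_one, zpow_neg_one]

theorem gamma_zpow_eq_mon (k : ℤ) : gamma ρ ^ k = mon ρ 0 k := by
  rw [mon, zpow_zero, one_mul]

theorem starShift_eq_mon : pU⁻¹ * (gamma ρ)⁻¹ = mon ρ (-1) (-1) := by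
  rw [mon, zpow_neg_one, zpow_neg_one]

theorem betaScale_eq_mon : (gamma ρ)⁻¹ ^ 2 * pU⁻¹ = mon ρ (-1) (-2) := by
  rw [← zpow_natCast, inv_zpow', gamma_zpow_eq_mon, pU_inv_eq_mon (ρ := ρ), mon_mul]
  rfl

theorem pU_inv_mem_zen : ((pU⁻¹ : (Module.End F V)ˣ) : Module.End F V) ∈ zen ρ :=
  units_inv_mem_zen (pU_mem_zen ρ)

theorem gamma_inv_mem_zen : (((gamma ρ)⁻¹ : (Module.End F V)ˣ) : Module.End F V) ∈ zen ρ :=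
  units_inv_mem_zen (gamma_mem_zen ρ)

theorem betaScale_mem_zen :
    (((gamma ρ)⁻¹ ^ 2 * pU⁻¹ : (Module.End F V)ˣ) : Module.End F V) ∈ zen ρ :=
  units_mul_mem_zen (units_pow_mem_zen gamma_inv_mem_zen 2) pU_inv_mem_zen

theorem isExp_alphaAt (hψM : IsUnit (psiM0 ρ)) {c : (Module.End F V)ˣ} (hc : (c : Module.End F V) ∈ zen ρ) :
    IsExp (dil c (logAlpha ρ)) (alphaAt ρ c) :=
  (isExp_alpha ρ hψM).dil fun n => zen_commute hc (coeff_logAlpha_mem ρ hψM n)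

theorem isExp_betaAt (hψP : IsUnit (psiP0 ρ)) {c : (Module.End F V)ˣ} (hc : (c : Module.End F V) ∈ zen ρ) :
    IsExp (dil c⁻¹ (logBeta ρ)) (betaAt ρ c) :=
  (isExp_beta ρ hψP).dil fun n =>
    zen_commute (units_inv_mem_zen hc) (coeff_logBeta_mem ρ hψP n)

theorem isExp_inv_alphaAt (hψM : IsUnit (psiM0 ρ)) {c : (Module.End F V)ˣ} (hc : (c : Module.End F V) ∈ zen ρ) :
    IsExp (-dil c (logAlpha ρ)) (Ring.inverse (alphaAt ρ c)) :=
  (isExp_alphaAt hψM hc).inverse ((logAlpha_commute ρ hψM).dil (coeff_logAlpha_mem ρ hψM)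
    (coeff_logAlpha_mem ρ hψM) hc hc)

theorem isExp_inv_betaAt (hψP : IsUnit (psiP0 ρ)) {c : (Module.End F V)ˣ} (hc : (c : Module.End F V) ∈ zen ρ) :
    IsExp (-dil c⁻¹ (logBeta ρ)) (Ring.inverse (betaAt ρ c)) :=
  (isExp_betaAt hψP hc).inverse ((logBeta_commute ρ hψP).dil (coeff_logBeta_mem ρ hψP)
    (coeff_logBeta_mem ρ hψP) (units_inv_mem_zen hc) (units_inv_mem_zen hc))

/-- The commutation relations after rescaling by central operators. -/
theorem neg_scaled_mul {w r : Module.End F V} (hw : w ∈ zen ρ) (hr : r ∈ zen ρ) {L X R : Module.End F V}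
    (hL : L ∈ dcen ρ) (hX : X ∈ dcen ρ) (h : L * X = X * L + R) :
    -(w * L) * (r * X) = r * X * -(w * L) - w * r * R := by
  have h1 := mul_eq_of_central hw hX h
  have h2 := (zen_commute hr (zen_le_dcen hw)).eq
  have h3 := (zen_commute hr hL).eq
  rw [neg_mul, mul_neg, mul_assoc w L, ← mul_assoc L r, ← h3, ← mul_assoc w, ← mul_assoc w r, mul_assoc (w * r), h,
    mul_add, mul_assoc r X, ← mul_assoc X w, ← (zen_commute hw hX).eq, ← mul_assoc r, ← mul_assoc r w,
    h2]
  simp only [mul_assoc]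
  abel

/-- The arguments `p⁻¹z`, `p⁻¹γ⁻¹z` and `γ⁻²p⁻¹z` are tuned so that all three constants become `heis
ρ 1`. In the bracket of the two dressings, for instance, the rescalings contribute `γ^{2k}`, which
takes `heis ρ (-1)` to `heis ρ 1`. -/
theorem isDressing_star (hψP : IsUnit (psiP0 ρ)) (hψM : IsUnit (psiM0 ρ))
    (hγ : ∀ n : ℕ, 1 ≤ n → IsUnit (gammaDiff ρ n)) : IsDressing ρ hadm (logAlphaStar ρ) (logBetaStar ρ) (heis ρ 1) (xs ρ)
    (alphaStar ρ) (betaStar ρ) where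
  exp_left := isExp_inv_alphaAt hψM pU_inv_mem_zen
  exp_right := isExp_inv_betaAt hψP betaScale_mem_zen
  mem_left k := by
    rw [logAlphaStar, map_neg, coeff_dil]
    exact neg_mem (mul_mem (zen_le_dcen (units_pow_mem_zen pU_inv_mem_zen k))
      (coeff_logAlpha_mem ρ hψM k))
  mem_right k := by
    rw [logBetaStar, map_neg, coeff_dil]
    exact neg_mem (mul_mem (zen_le_dcen (units_pow_mem_zen (units_inv_mem_zen betaScale_mem_zen) k))
      (coeff_logBeta_mem ρ hψP k))
  mem_mid n := mul_mem (zen_le_dcen (units_zpow_mem_zen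
    (units_mul_mem_zen pU_inv_mem_zen gamma_inv_mem_zen) _)) (mem_dcen _)
  mem_central := heis_mem_zen ρ 1
  comm_left := ((logAlpha_commute ρ hψM).dil (coeff_logAlpha_mem ρ hψM)
    (coeff_logAlpha_mem ρ hψM) pU_inv_mem_zen pU_inv_mem_zen).neg
  comm_right := ((logBeta_commute ρ hψP).dil (coeff_logBeta_mem ρ hψP)
    (coeff_logBeta_mem ρ hψP) (units_inv_mem_zen betaScale_mem_zen)
    (units_inv_mem_zen betaScale_mem_zen)).neg
  right_left k hk l hl := by
    have h := neg_scaled_mul (units_pow_mem_zen (units_inv_mem_zen betaScale_mem_zen) k)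
      (neg_mem (units_pow_mem_zen (pU_inv_mem_zen (ρ := ρ)) l)) (coeff_logBeta_mem ρ hψP k)
      (coeff_logAlpha_mem ρ hψM l) (logBeta_mul_logAlpha ρ hψP hψM hγ k hk l hl)
    simp only [neg_mul] at h
    rw [logBetaStar, logAlphaStar, map_neg, map_neg, coeff_dil, coeff_dil, neg_mul, h, sub_eq_add_neg]
    congr 1
    split_ifs with hlk
    · subst hlk
      have hg : heis ρ 1 l = ((gamma ρ ^ (2 * (l : ℤ)) : (Module.End F V)ˣ) : Module.End F V) *
          heis ρ (-1) l := by
        rw [gamma_zpow_mul_heis]; rfl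
      rw [mul_neg, neg_mul, neg_neg, ← Units.val_mul, hg]
      congr 2
      rw [betaScale_eq_mon, pU_inv_eq_mon (ρ := ρ), mon_inv, mon_pow, mon_pow, mon_mul,
        gamma_zpow_eq_mon]
      congr 1 <;> ring
    · simp
  right_mid k hk n := by
    have h := neg_scaled_mul (units_pow_mem_zen (units_inv_mem_zen betaScale_mem_zen) k)
      (units_zpow_mem_zen (units_mul_mem_zen (pU_inv_mem_zen (ρ := ρ)) gamma_inv_mem_zen) (-n))
      (coeff_logBeta_mem ρ hψP k) (xm_mem_dcen ρ n) (logBeta_mul_xm ρ hψP k hk n)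
    rw [logBetaStar, map_neg, coeff_dil, xs, xs]
    refine h.trans ?_
    have hg : heis ρ 1 k = _ := (gamma_zpow_mul_heis ρ 0 1 k).symm
    rw [hg, mul_assoc _ (heis ρ 0 k), ← mul_assoc (heis ρ 0 k) (Units.val _),
      (zen_commute (heis_mem_zen ρ 0 k) (zen_le_dcen (units_zpow_mem_zen
        (units_mul_mem_zen pU_inv_mem_zen gamma_inv_mem_zen) _))).eq]
    simp only [← mul_assoc, ← Units.val_mul]
    congr 4
    rw [betaScale_eq_mon, starShift_eq_mon, gamma_zpow_eq_mon, mon_inv, mon_pow, mon_zpow,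
      mon_zpow, mon_mul, mon_mul]
    congr 1 <;> ring
  left_mid k hk n := by
    have h := neg_scaled_mul (units_pow_mem_zen pU_inv_mem_zen k)
      (units_zpow_mem_zen (units_mul_mem_zen (pU_inv_mem_zen (ρ := ρ)) gamma_inv_mem_zen) (-n))
      (coeff_logAlpha_mem ρ hψM k) (xm_mem_dcen ρ n)
      ((logAlpha_mul_xm ρ hψM k hk n).trans (sub_eq_add_neg _ _))
    rw [logAlphaStar, map_neg, coeff_dil, xs, xs]
    refine h.trans ?_
    have hg : heis ρ 1 k = _ := (gamma_zpow_mul_heis ρ 0 1 k).symm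
    rw [mul_neg (_ * _) (heis ρ _ _ * _), sub_neg_eq_add, hg, mul_assoc _ (heis ρ 0 k), ← mul_assoc (heis ρ 0 k) (Units.val _),
      (zen_commute (heis_mem_zen ρ 0 k) (zen_le_dcen (units_zpow_mem_zen
        (units_mul_mem_zen pU_inv_mem_zen gamma_inv_mem_zen) _))).eq]
    simp only [← mul_assoc, ← Units.val_mul]
    congr 4
    rw [starShift_eq_mon, pU_inv_eq_mon (ρ := ρ), gamma_zpow_eq_mon, mon_pow, mon_zpow,
      mon_zpow, mon_mul, mon_mul]
    congr 1 <;> ring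
  deg_left k hk := by
    rw [logAlphaStar, map_neg, coeff_dil]
    exact neg_mem (zen_mul_mem_degSub hadm (units_pow_mem_zen pU_inv_mem_zen k)
      (deg_logAlpha hadm hψM k hk))
  deg_right k hk := by
    rw [logBetaStar, map_neg, coeff_dil]
    exact neg_mem (zen_mul_mem_degSub hadm
      (units_pow_mem_zen (units_inv_mem_zen betaScale_mem_zen) k) (deg_logBeta hadm hψP k hk))
  deg_mid n := by
    rw [add_zero]
    exact zen_mul_mem_degSub hadm (units_zpow_mem_zen
      (units_mul_mem_zen pU_inv_mem_zen gamma_inv_mem_zen) _) (opDeg_gen hadm (Gen.xm n))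

end Dressings


/-! ### Genericity of `q`, `t` and `p` -/

section Parameters

/-- Inequalities in the field are tested by evaluating polynomials at a rational point. -/
theorem algebraMap_ne {f h : MvPolynomial (Fin 2) ℚ} (e : Fin 2 → ℚ)
    (hfh : MvPolynomial.eval e f ≠ MvPolynomial.eval e h) :
    algebraMap (MvPolynomial (Fin 2) ℚ) F f ≠ algebraMap (MvPolynomial (Fin 2) ℚ) F h :=
  fun H => hfh (congrArg _ (IsFractionRing.injective (MvPolynomial (Fin 2) ℚ) F H))

theorem q_ne_one : q ≠ 1 := by
  have := algebraMap_ne (f := MvPolynomial.X 0 ^ 2) (h := 1) ![2, 1] (by simp; norm_num)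
  rwa [map_pow, map_one] at this

theorem t_ne_one : t ≠ 1 := by
  have := algebraMap_ne (f := MvPolynomial.X 1 ^ 2) (h := 1) ![1, 2] (by simp; norm_num)
  rwa [map_pow, map_one] at this

theorem p_sq_ne_one : p ^ 2 ≠ 1 := by
  have := algebraMap_ne (f := (MvPolynomial.X 0 ^ 2) ^ 2) (h := (MvPolynomial.X 1 ^ 2) ^ 2)
    ![2, 1] (by simp; norm_num)
  rw [map_pow, map_pow, map_pow, map_pow] at this
  rw [p, div_pow, Ne, div_eq_one_iff_eq (pow_ne_zero 2 t_ne_zero)]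
  exact this

theorem p_ne_one : p ≠ 1 := fun h => p_sq_ne_one (by rw [h, one_pow])

end Parameters

/-! ### The specialized square of a current -/

section Squares

variable {V : Type*} [AddCommGroup V] [Module F V] {fl : Filt V}

/-- The exchange product of two families of operators consists of operators. -/
theorem exch_linear {a : PowerSeries (Module.End F V)} {x x' : ℤ → Module.End F V} {e e' : ℤ}
    (hx : CurDeg fl e (toCur x)) (hx' : CurDeg fl e' (toCur x')) (m n : ℤ) :
    ∃ T : Module.End F V, exch a (toCur x) (toCur x') m n = T := by
  refine ⟨⟨⟨exch a (toCur x) (toCur x') m n, fun v w => ?_⟩, fun c v => ?_⟩, rfl⟩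
  · rw [exch, exch, exch, ← finsum_add_distrib (exchTerm_finite hx hx' m n v)
      (exchTerm_finite hx hx' m n w)]
    exact finsum_congr fun k => by simp only [exchTerm, map_add]
  · simp only [exch, RingHom.id_apply]
    rw [smul_finsum]
    exact finsum_congr fun k => by simp only [exchTerm, map_smul]

/-- The product `x(c z) x(z)` of a current with cubic exchange relations. -/
theorem exists_square {x : ℤ → Module.End F V} (hx : CurDeg fl 0 (toCur x)) {a b : F}
    (h0 : a * b ≠ 0) (h1 : 1 - a * b ≠ 0) (h2 : 1 - (a * b) ^ 2 ≠ 0) (ha : 1 - a ≠ 0)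
    (hb : 1 - b ≠ 0)
    (hrel : ∀ m n, ∑ k ∈ range 4, (cubic a⁻¹ b⁻¹).coeff k • (x (m + k) * x (n - k))
      = ∑ k ∈ range 4, (cubic a b).coeff k • (x (n - k) * x (m + k))) :
    ∃ y : ℤ → Module.End F V, CurDeg fl 0 (toCur y) ∧
      (∀ n v, HasRationalSum (a * b)⁻¹ (fun m => x m (x (n - m) v)) (y n v)) ∧
      ∀ m n v, exch (PowerSeries.map (algebraMap F _) (crossSeries a b)) (toCur x) (toCur x) m n v
        - exch (PowerSeries.map (algebraMap F _) (crossSeries a b)) (toCur x) (toCur x) n m v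
        = ((1 - a) * (1 - b) / (1 - a * b)) •
          ((a * b) ^ n • y (m + n) v - (a * b) ^ m • y (m + n) v) := by
  set K := exch (PowerSeries.map (algebraMap F (Module.End F V)) (crossSeries a b)) (toCur x)
    (toCur x) with hK
  have hKs : ∀ m n d v, d = m + n →
      K m n v = serMul (crossSeries a b) (fun m => x m (x (d - m) v)) m := by
    rintro m n d v rfl
    refine finsum_congr fun k => ?_
    rw [exchTerm, coeff_map]
    simp only [show m + n - (m - k) = n + k by ring]
    rfl
  have hdeg : ∀ m n, OpDeg fl (m + n) (K m n) := exch_opDeg hx hx fun k N v hv => by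
    rw [coeff_map, sub_zero]
    exact Submodule.smul_mem _ _ hv
  set C := (1 - a) * (1 - b) / (1 - a * b) with hC
  have hC0 : C ≠ 0 := div_ne_zero (mul_ne_zero ha hb) h1
  have key : ∀ d v, ∃ σ, HasRationalSum (a * b)⁻¹ (fun m => x m (x (d - m) v)) σ ∧
      ∀ m n, m + n = d → K m n v - K n m v = C • ((a * b) ^ n • σ - (a * b) ^ m • σ) := by
    intro d v
    obtain ⟨N, hv⟩ := fl.exh v
    obtain ⟨σ, hσ, h⟩ := cross_reflection h0 h1 h2 ha hb
      (s := fun m => x m (x (d - m) v)) (d := d) ⟨d - N, fun m hm => by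
        rw [hx.apply_eq_zero hv (by omega), map_zero]⟩ (fun m => by
        have := LinearMap.congr_fun (hrel m (d - m)) v
        simp only [LinearMap.sum_apply, LinearMap.smul_apply, Module.End.mul_apply] at this
        convert this using 5 <;> ring_nf)
    refine ⟨σ, hσ, fun m n hmn => ?_⟩
    have := h m
    rw [show d - m = n by omega] at this
    rw [hKs m n d v hmn.symm, hKs n m d v (by omega), this]
  choose σ hσ h using key
  -- Solving for `σ` needs a pair `m + n = d` with `(a b)^n ≠ (a b)^m`. The choice `n = (d - 1) / 2`
  -- makes `m - n` equal to `1` or `2`, so that `a b ≠ 1` and `(a b)^2 ≠ 1` suffice.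
  have hpar : ∀ d : ℤ, (a * b) ^ ((d - 1) / 2) - (a * b) ^ (d - (d - 1) / 2) ≠ 0 := by
    intro d
    rcases (by omega : d - (d - 1) / 2 = (d - 1) / 2 + 1 ∨ d - (d - 1) / 2 = (d - 1) / 2 + 2) with
      e | e
    · rw [e, zpow_add₀ h0, zpow_one, ← mul_one_sub]
      exact mul_ne_zero (zpow_ne_zero _ h0) h1
    · rw [e, zpow_add₀ h0, show (a * b) ^ (2 : ℤ) = (a * b) ^ 2 by norm_cast, ← mul_one_sub]
      exact mul_ne_zero (zpow_ne_zero _ h0) h2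
  -- The explicit solution shows that `σ`, which was chosen for each vector separately, is linear in
  -- the vector and has the expected degree.
  have hsol : ∀ d v, σ d v = (C * ((a * b) ^ ((d - 1) / 2) - (a * b) ^ (d - (d - 1) / 2)))⁻¹ •
      (K (d - (d - 1) / 2) ((d - 1) / 2) v - K ((d - 1) / 2) (d - (d - 1) / 2) v) := by
    intro d v
    rw [h d v _ _ (by omega), ← sub_smul, smul_smul C, inv_smul_smul₀ (mul_ne_zero hC0 (hpar d))]
  have hlin : ∀ d, ∃ T : Module.End F V, σ d = T := by
    intro d
    obtain ⟨T, hT⟩ := exch_linear (a := PowerSeries.map (algebraMap F (Module.End F V))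
      (crossSeries a b)) hx hx (d - (d - 1) / 2) ((d - 1) / 2)
    obtain ⟨T', hT'⟩ := exch_linear (a := PowerSeries.map (algebraMap F (Module.End F V))
      (crossSeries a b)) hx hx ((d - 1) / 2) (d - (d - 1) / 2)
    refine ⟨(C * ((a * b) ^ ((d - 1) / 2) - (a * b) ^ (d - (d - 1) / 2)))⁻¹ • (T - T'),
      funext fun v => ?_⟩
    rw [hsol, hK, hT, hT']
    rfl
  choose y hy using hlin
  refine ⟨y, fun n N v hv => ?_, fun n v => ?_, fun m n v => ?_⟩
  · change y n v ∈ _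
    rw [← hy, hsol, add_zero]
    have e1 := hdeg (n - (n - 1) / 2) ((n - 1) / 2) _ _ hv
    have e2 := hdeg ((n - 1) / 2) (n - (n - 1) / 2) _ _ hv
    rw [show n - (n - 1) / 2 + (n - 1) / 2 = n by ring] at e1
    rw [show (n - 1) / 2 + (n - (n - 1) / 2) = n by ring] at e2
    exact Submodule.smul_mem _ _ (sub_mem e1 e2)
  · rw [← hy]; exact hσ n v
  · rw [← hy]; exact h _ v m n rfl

/-- Uniqueness of the value of a rational series replaces the choice made in `ratSum` by a known
operator. -/
theorem curSq_eq {c : F} (hc : c ≠ 0) {x : Cur V} {y : ℤ → Module.End F V}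
    (h : ∀ n v, HasRationalSum c⁻¹ (fun m => x m (x (n - m) v)) (y n v)) :
    curSq c x = toCur y := by
  funext n v
  have hex : ∃ s, HasRationalSum c⁻¹ (fun m => x m (x (n - m) v)) s := ⟨_, h n v⟩
  rw [curSq, ratSum, dif_pos hex]
  exact HasRationalSum.unique (inv_ne_zero hc) hex.choose_spec (h n v)

end Squares

/-! ### Exchange relations of dressed currents -/

section Exchange

variable {V : Type*} [AddCommGroup V] [Module F V] {ρ : U →ₐ[F] Module.End F V}
  {hadm : Admissible ρ}

theorem scalarDeg_of_mem_zen {f : PowerSeries (Module.End F V)} (hf : ∀ k, coeff k f ∈ zen ρ) :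
    ScalarDeg (filt ρ hadm) f := fun k => opDeg_of_mem_cen hadm (hf k).1

theorem coeff_mul_mem_zen {f h : PowerSeries (Module.End F V)} (hf : ∀ k, coeff k f ∈ zen ρ)
    (hh : ∀ k, coeff k h ∈ zen ρ) (k : ℕ) : coeff k (f * h) ∈ zen ρ := by
  rw [coeff_mul]
  exact sum_mem fun _ _ => mul_mem (hf _) (hh _)

theorem coeffCommute_of_mem_zen {f h : PowerSeries (Module.End F V)} (hf : ∀ k, coeff k f ∈ zen ρ)
    (hh : ∀ k, coeff k h ∈ dcen ρ) : CoeffCommute f h := fun i j => zen_commute (hf i) (hh j)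

variable {M P α β M' P' α' β' : PowerSeries (Module.End F V)} {c c' : ℕ → Module.End F V}
  {x x' : ℤ → Module.End F V}

/-- The dressed current. -/
theorem IsDressing.curDeg (h : IsDressing ρ hadm M P c x α β) :
    CurDeg (filt ρ hadm) 0 (dress α (toCur x) β) := h.deg_mid.dress h.leftDeg h.rightDeg

/-- Exponentiating `[P_k, x'_n] = d_k x'_{n+k}` produces the contraction factor `f`, and the
prefactor `a` multiplies it inside the normal ordering. -/
theorem IsDressing.exch (h : IsDressing ρ hadm M P c x α β)
    (h' : IsDressing ρ hadm M' P' c' x' α' β') {d f a : PowerSeries (Module.End F V)}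
    (hf : IsExp d f) (hd : ∀ k, coeff k d ∈ zen ρ) (ha : ∀ k, coeff k a ∈ zen ρ)
    (hrel : ∀ k, 1 ≤ k → ∀ n, coeff k P * x' n = x' n * coeff k P + coeff k d * x' (n + k))
    (hcomm : ∀ k, CommutesWith (dress α (toCur x) β) (coeff k α')) (m n : ℤ) (v : V) :
    DingIohara.exch a (dress α (toCur x) β) (dress α' (toCur x') β') m n v
      = dress₂ α β α' β' (DingIohara.exch (a * f) (toCur x) (toCur x')) m n v := by
  have hfz : ∀ k, coeff k f ∈ zen ρ := hf.mem_subalgebra _ fun k _ => hd k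
  refine exch_dress h.deg_mid h'.deg_mid h.leftDeg h'.leftDeg h.rightDeg h'.rightDeg
    (scalarDeg_of_mem_zen hfz) (scalarDeg_of_mem_zen (coeff_mul_mem_zen ha hfz))
    (fun k n => zen_commute (hfz k) (h.mem_mid n)) (fun k i => zen_commute (ha k) (h.coeff_left_mem i))
    (fun k i => zen_commute (ha k) (h'.coeff_left_mem i)) (fun j n => ?_) hcomm m n v
  have := (h.exp_right.shift_iff hf (coeffCommute_of_mem_zen hfz h.mem_right).symm
    (coeffCommute_of_mem_zen hd fun k => zen_le_dcen (hfz k)) fun i => x' (n + i)).2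
    (fun k hk i => by
      rw [hrel k hk, add_assoc]
      push_cast
      rfl) j 0
  simpa using this

/-- The quadratic relation of a dressed current. -/
theorem IsDressing.exch_sub_swap (h : IsDressing ρ hadm M P c x α β)
    {d f a K : PowerSeries (Module.End F V)} (hf : IsExp d f) (hd : ∀ k, coeff k d ∈ zen ρ)
    (ha : ∀ k, coeff k a ∈ zen ρ)
    (hrel : ∀ k, 1 ≤ k → ∀ n, coeff k P * x n = x n * coeff k P + coeff k d * x (n + k))
    (hcomm : ∀ k, CommutesWith (dress α (toCur x) β) (coeff k α)) (hK : a * f = K)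
    {y : ℤ → Module.End F V} (hy : CurDeg (filt ρ hadm) 0 (toCur y)) {u : (Module.End F V)ˣ}
    (hu : (u : Module.End F V) ∈ zen ρ) (huy : ∀ n, Commute (u : Module.End F V) (y n)) (C : F)
    (hswap : ∀ m n v, DingIohara.exch K (toCur x) (toCur x) m n v
      - DingIohara.exch K (toCur x) (toCur x) n m v
      = C • (deltaZ u (toCur y) m n v - deltaZ u (toCur y) n m v)) (m n : ℤ) (v : V) :
    DingIohara.exch a (dress α (toCur x) β) (dress α (toCur x) β) m n v
      - DingIohara.exch a (dress α (toCur x) β) (dress α (toCur x) β) n m v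
      = C • (deltaZ u (dress (dil u⁻¹ α * α) (toCur y) (β * dil u β)) m n v
        - deltaZ u (dress (dil u⁻¹ α * α) (toCur y) (β * dil u β)) n m v) := by
  have hfz : ∀ k, coeff k f ∈ zen ρ := hf.mem_subalgebra _ fun k _ => hd k
  have hKdeg : ∀ m n, OpDeg (filt ρ hadm) (m + n) (DingIohara.exch K (toCur x) (toCur x) m n) :=
    exch_opDeg h.deg_mid h.deg_mid (scalarDeg_of_mem_zen (hK ▸ coeff_mul_mem_zen ha hfz))
  have hswapDeg : ∀ {L : ℤ → ℤ → V → V}, (∀ m n, OpDeg (filt ρ hadm) (m + n) (L m n)) →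
      ∀ m n, OpDeg (filt ρ hadm) (m + n) ((fun m n => L n m) m n) := fun hL m n => by
    rw [add_comm m n]; exact hL n m
  have hzdeg : ∀ k : ℤ, OpDeg (filt ρ hadm) 0 ⇑((u ^ k : (Module.End F V)ˣ) : Module.End F V) :=
    fun k => opDeg_zen hadm (units_zpow_mem_zen hu k)
  have hD : ∀ m n, OpDeg (filt ρ hadm) (m + n) (deltaZ u (toCur y) m n) := fun m n => by
    have := (hzdeg (-n)).comp (hy (m + n))
    rwa [zero_add, add_zero] at this
  have hCα : CoeffCommute α α := fun i j => h.exp_left.commute_of_log (fun k _ =>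
    (h.exp_left.coeffCommute h.comm_left k i).symm) j
  have hCβ : CoeffCommute β β := fun i j => h.exp_right.commute_of_log (fun k _ =>
    (h.exp_right.coeffCommute h.comm_right k i).symm) j
  have hb : RightDeg (filt ρ hadm) (β * dil u β) := by
    refine (h.seriesDeg_right.mul fun k => ?_).rightDeg
    rw [coeff_dil]
    exact zen_mul_mem_degSub hadm (units_pow_mem_zen hu k) (h.seriesDeg_right k)
  have hdelta := fun m n v => dress₂_delta (α := α) (α' := α) (β := β) (β' := β) hy
    (opDeg_zen hadm hu) (opDeg_zen hadm (units_inv_mem_zen hu))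
    (fun i => zen_commute hu (h.coeff_left_mem i)) (fun i => zen_commute hu (h.coeff_left_mem i))
    huy (fun i => zen_commute hu (h.coeff_right_mem i)) h.leftDeg h.rightDeg h.rightDeg hb m n v
  rw [h.exch h hf hd ha hrel hcomm, h.exch h hf hd ha hrel hcomm, hK,
    dress₂_swap hKdeg h.leftDeg h.leftDeg h.rightDeg h.rightDeg hCα hCβ n m,
    dress₂_sub hKdeg (hswapDeg hKdeg) h.leftDeg h.rightDeg h.rightDeg]
  -- The kernel is now an antisymmetrized delta function. Each of its two terms is dressed on its
  -- support, the second after exchanging the roles of `z` and `w`.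
  simp only [hswap]
  rw [dress₂_smul (fun m n N v hv => sub_mem (hD m n N v hv) (hswapDeg hD m n N v hv)) C h.leftDeg
    h.rightDeg h.rightDeg, ← dress₂_sub hD (hswapDeg hD) h.leftDeg h.rightDeg h.rightDeg, hdelta,
    ← hdelta n m, dress₂_swap hD h.leftDeg h.leftDeg h.rightDeg h.rightDeg hCα hCβ n m]

end Exchange


/-! ### Commutation of `t` and `t*` with `α`, `β` and `ψ^±` -/

section Commutation

variable {V : Type*} [AddCommGroup V] [Module F V] {ρ : U →ₐ[F] Module.End F V}

theorem psiP_eq_exp (hψP : IsUnit (psiP0 ρ)) : psiP ρ = C (psiP0 ρ) *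
    pexp (posSeries fun n => bP ρ n * ((gh ρ ^ n : (Module.End F V)ˣ) : Module.End F V)) := by
  have e : (posSeries fun n => bP ρ n * ((gh ρ ^ n : (Module.End F V)ˣ) : Module.End F V))
      = plog (psiPn ρ) := by
    ext1 n
    rw [coeff_posSeries]
    split_ifs with h
    · rw [h, coeff_zero_plog]
    · rw [bP, mul_assoc, ← Units.val_mul, inv_pow, inv_mul_cancel, Units.val_one, mul_one, psiPn]
  rw [e, (isExp_pexp (coeff_zero_plog _) (plog_psiPn_commute ρ hψP)).unique (isExp_psiPn ρ hψP),
    psiPn, ← mul_assoc, ← map_mul, Ring.mul_inverse_cancel _ hψP, map_one, one_mul]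

theorem psiM_eq_exp (hψM : IsUnit (psiM0 ρ)) : psiM ρ = C (psiM0 ρ) *
    pexp (-posSeries fun n => bM ρ n * ((gh ρ ^ n : (Module.End F V)ˣ) : Module.End F V)) := by
  have e : (-posSeries fun n => bM ρ n * ((gh ρ ^ n : (Module.End F V)ˣ) : Module.End F V))
      = plog (psiMn ρ) := by
    ext1 n
    rw [map_neg, coeff_posSeries]
    split_ifs with h
    · rw [h, coeff_zero_plog, neg_zero]
    · rw [bM, neg_mul, neg_neg, mul_assoc, ← Units.val_mul, inv_pow, inv_mul_cancel, Units.val_one,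
        mul_one, psiMn]
  rw [e, (isExp_pexp (coeff_zero_plog _) (plog_psiMn_commute ρ hψM)).unique (isExp_psiMn ρ hψM),
    psiMn, ← mul_assoc, ← map_mul, Ring.mul_inverse_cancel _ hψM, map_one, one_mul]

theorem isUnit_alpha (hψM : IsUnit (psiM0 ρ)) : IsUnit (alpha ρ) :=
  (isExp_alpha ρ hψM).isUnit (logAlpha_commute ρ hψM)

theorem isUnit_beta (hψP : IsUnit (psiP0 ρ)) : IsUnit (beta ρ) :=
  (isExp_beta ρ hψP).isUnit (logBeta_commute ρ hψP)

theorem gammaDiff_mul_logScale (hγ : ∀ n : ℕ, 1 ≤ n → IsUnit (gammaDiff ρ n)) {k : ℕ} (hk : 1 ≤ k) :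
    ((gh ρ ^ k : (Module.End F V)ˣ) : Module.End F V) * gammaDiff ρ k * logScale ρ k = 1 := by
  rw [logScale, mul_assoc, ← mul_assoc (gammaDiff ρ k), Ring.mul_inverse_cancel _ (hγ k hk),
    one_mul, ← Units.val_mul, inv_pow, mul_inv_cancel, Units.val_one]

theorem coeff_plog_psiPn_eq (hψP : IsUnit (psiP0 ρ))
    (hγ : ∀ n : ℕ, 1 ≤ n → IsUnit (gammaDiff ρ n)) {k : ℕ} (hk : 1 ≤ k) :
    coeff k (plog (psiPn ρ)) = ((gh ρ ^ k : (Module.End F V)ˣ) : Module.End F V) * gammaDiff ρ k *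
      coeff k (logBeta ρ) := by
  rw [coeff_logBeta ρ hψP, ← mul_assoc, gammaDiff_mul_logScale hγ hk, one_mul]

theorem coeff_plog_psiMn_eq (hψM : IsUnit (psiM0 ρ))
    (hγ : ∀ n : ℕ, 1 ≤ n → IsUnit (gammaDiff ρ n)) {k : ℕ} (hk : 1 ≤ k) :
    coeff k (plog (psiMn ρ)) = ((gh ρ ^ k : (Module.End F V)ˣ) : Module.End F V) * gammaDiff ρ k *
      coeff k (logAlpha ρ) := by
  rw [coeff_logAlpha ρ hψM, ← mul_assoc, gammaDiff_mul_logScale hγ hk, one_mul]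

/-- For `S` the operators commuting with a dressed current, this reduces part (1) to the Heisenberg
generators: the coefficients of `log ψ^±` are central multiples of those of `log β` and `log α`. -/
theorem psi_mem_subalgebra (hψP : IsUnit (psiP0 ρ)) (hψM : IsUnit (psiM0 ρ))
    (hγ : ∀ n : ℕ, 1 ≤ n → IsUnit (gammaDiff ρ n)) {S : Subalgebra F (Module.End F V)}
    (hz : ∀ z ∈ zen ρ, z ∈ S) (hα : ∀ k, 1 ≤ k → coeff k (logAlpha ρ) ∈ S)
    (hβ : ∀ k, 1 ≤ k → coeff k (logBeta ρ) ∈ S) (k : ℕ) :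
    coeff k (alpha ρ) ∈ S ∧ coeff k (beta ρ) ∈ S ∧ coeff k (psiP ρ) ∈ S ∧ coeff k (psiM ρ) ∈ S := by
  have hc : ∀ k : ℕ, ((gh ρ ^ k : (Module.End F V)ˣ) : Module.End F V) * gammaDiff ρ k ∈ S :=
    fun k => hz _ (mul_mem (units_pow_mem_zen (gh_mem_zen ρ) k) (gammaDiff_mem_zen ρ k))
  refine ⟨(isExp_alpha ρ hψM).mem_subalgebra S hα k, (isExp_beta ρ hψP).mem_subalgebra S hβ k, ?_, ?_⟩
  · have h := (isExp_psiPn ρ hψP).mem_subalgebra S (fun k hk => by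
      rw [coeff_plog_psiPn_eq hψP hγ hk]; exact S.mul_mem (hc k) (hβ k hk)) k
    have e : coeff k (psiP ρ) = psiP0 ρ * coeff k (psiPn ρ) := by
      rw [psiPn, coeff_C_mul, ← mul_assoc, Ring.mul_inverse_cancel _ hψP, one_mul]
    rw [e]
    exact S.mul_mem (hz _ (pp_zero_mem_zen ρ)) h
  · have h := (isExp_psiMn ρ hψM).mem_subalgebra S (fun k hk => by
      rw [coeff_plog_psiMn_eq hψM hγ hk]; exact S.mul_mem (hc k) (hα k hk)) k
    have e : coeff k (psiM ρ) = psiM0 ρ * coeff k (psiMn ρ) := by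
      rw [psiMn, coeff_C_mul, ← mul_assoc, Ring.mul_inverse_cancel _ hψM, one_mul]
    rw [e]
    exact S.mul_mem (hz _ (pm_zero_mem_zen ρ)) h

/-- The dressing of `t*` provides only rescaled logarithms; the central rescaling is undone here. -/
theorem mem_of_neg_dil_mem {S : Subalgebra F (Module.End F V)} (hz : ∀ z ∈ zen ρ, z ∈ S)
    {u : (Module.End F V)ˣ} (hu : (u : Module.End F V) ∈ zen ρ) {f : PowerSeries (Module.End F V)}
    {k : ℕ} (h : coeff k (-dil u f) ∈ S) : coeff k f ∈ S := by
  rw [map_neg, coeff_dil] at h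
  have := S.mul_mem (hz _ (units_inv_mem_zen (units_pow_mem_zen hu k))) (S.neg_mem h)
  rwa [neg_neg, ← mul_assoc, ← Units.val_mul, inv_mul_cancel, Units.val_one, one_mul] at this

theorem tCur_eq : tCur ρ = dress (alpha ρ) (toCur (xp ρ)) (beta ρ) := rfl

theorem tStar_eq : tStar ρ = dress (alphaStar ρ) (toCur (xs ρ)) (betaStar ρ) := rfl

/-- The coefficients of `α`, `β` and `ψ^±` commute with `t(z)`. -/
theorem tCur_commutesWith (hadm : Admissible ρ) (hψP : IsUnit (psiP0 ρ)) (hψM : IsUnit (psiM0 ρ))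
    (hγ : ∀ n : ℕ, 1 ≤ n → IsUnit (gammaDiff ρ n)) (k : ℕ) :
    CommutesWith (tCur ρ) (coeff k (alpha ρ)) ∧ CommutesWith (tCur ρ) (coeff k (beta ρ)) ∧
      CommutesWith (tCur ρ) (coeff k (psiP ρ)) ∧ CommutesWith (tCur ρ) (coeff k (psiM ρ)) := by
  obtain ⟨T, hT, hz, hα, hβ⟩ := (isDressing_t hadm hψP hψM hγ).exists_op
  rw [tCur_eq, hT]
  simp only [← mem_commSub]
  exact psi_mem_subalgebra hψP hψM hγ hz hα hβ k

/-- The coefficients of `α`, `β` and `ψ^±` commute with `t*(z)`. -/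
theorem tStar_commutesWith (hadm : Admissible ρ) (hψP : IsUnit (psiP0 ρ)) (hψM : IsUnit (psiM0 ρ))
    (hγ : ∀ n : ℕ, 1 ≤ n → IsUnit (gammaDiff ρ n)) (k : ℕ) :
    CommutesWith (tStar ρ) (coeff k (alpha ρ)) ∧ CommutesWith (tStar ρ) (coeff k (beta ρ)) ∧
      CommutesWith (tStar ρ) (coeff k (psiP ρ)) ∧ CommutesWith (tStar ρ) (coeff k (psiM ρ)) := by
  obtain ⟨T, hT, hz, hα, hβ⟩ := (isDressing_star hadm hψP hψM hγ).exists_op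
  rw [tStar_eq, hT]
  simp only [← mem_commSub]
  exact psi_mem_subalgebra hψP hψM hγ hz
    (fun k hk => mem_of_neg_dil_mem hz pU_inv_mem_zen (hα k hk))
    (fun k hk => mem_of_neg_dil_mem hz (units_inv_mem_zen betaScale_mem_zen) (hβ k hk)) k

/-- The coefficients of `α(p⁻¹z)⁻¹` commute with `t(z)`. -/
theorem tCur_commutesWith_alphaStar (hadm : Admissible ρ) (hψP : IsUnit (psiP0 ρ)) (hψM : IsUnit (psiM0 ρ))
    (hγ : ∀ n : ℕ, 1 ≤ n → IsUnit (gammaDiff ρ n)) (k : ℕ) :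
    CommutesWith (tCur ρ) (coeff k (alphaStar ρ)) := by
  obtain ⟨T, hT, hz, hα, -⟩ := (isDressing_t hadm hψP hψM hγ).exists_op
  rw [tCur_eq, hT, ← mem_commSub]
  refine (isDressing_star hadm hψP hψM hγ).exp_left.mem_subalgebra _ (fun n hn => ?_) k
  rw [logAlphaStar, map_neg, coeff_dil]
  exact neg_mem (mul_mem (hz _ (units_pow_mem_zen pU_inv_mem_zen n)) (hα n hn))

/-- The coefficients of `α(p⁻¹z)⁻¹` commute with `t*(z)`. -/
theorem tStar_commutesWith_alphaStar (hadm : Admissible ρ) (hψP : IsUnit (psiP0 ρ)) (hψM : IsUnit (psiM0 ρ))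
    (hγ : ∀ n : ℕ, 1 ≤ n → IsUnit (gammaDiff ρ n)) (k : ℕ) :
    CommutesWith (tStar ρ) (coeff k (alphaStar ρ)) := by
  obtain ⟨T, hT, hz, hα, -⟩ := (isDressing_star hadm hψP hψM hγ).exists_op
  rw [tStar_eq, hT, ← mem_commSub]
  exact (isDressing_star hadm hψP hψM hγ).exp_left.mem_subalgebra _ hα k

end Commutation

/-! ### The series `A` and `B` -/

section StructureSeries

variable {V : Type*} [AddCommGroup V] [Module F V] (ρ : U →ₐ[F] Module.End F V)

/-- `γ^{kn} / (γⁿ - γ⁻ⁿ)` -/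
def gfrac (k : ℤ) (n : ℕ) : Module.End F V :=
  Ring.inverse (gammaDiff ρ n) * ((gamma ρ ^ (k * n) : (Module.End F V)ˣ) : Module.End F V)

theorem gfrac_mem_zen (k : ℤ) (n : ℕ) : gfrac ρ k n ∈ zen ρ :=
  mul_mem (inverse_mem_zen (gammaDiff_mem_zen ρ n)) (units_zpow_mem_zen (gamma_mem_zen ρ) _)

theorem heis_eq (k : ℤ) (n : ℕ) : heis ρ k n = kap n • gfrac ρ k n := rfl

variable {ρ}

theorem gamma_zpow_mul_gfrac (k l : ℤ) (n : ℕ) :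
    ((gamma ρ ^ (l * n) : (Module.End F V)ˣ) : Module.End F V) * gfrac ρ k n = gfrac ρ (l + k) n := by
  have h := zen_commute (inverse_mem_zen (gammaDiff_mem_zen ρ n))
    (zen_le_dcen (units_zpow_mem_zen (gamma_mem_zen ρ) (l * n)))
  rw [gfrac, gfrac, ← mul_assoc, ← h.eq, mul_assoc, ← Units.val_mul, ← zpow_add, add_mul]

/-- This cancellation removes `γ` from the structure function of the quadratic relations. -/
theorem gfrac_sub (hγ : ∀ n : ℕ, 1 ≤ n → IsUnit (gammaDiff ρ n)) {n : ℕ} (hn : 1 ≤ n) :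
    gfrac ρ 1 n - gfrac ρ (-1) n = 1 := by
  rw [gfrac, gfrac, ← mul_sub, ← Ring.inverse_mul_cancel _ (hγ n hn), gammaDiff]
  congr 3
  · rw [one_mul, zpow_natCast]
  · rw [neg_one_mul, zpow_neg, zpow_natCast, inv_pow]

/-- As `1 - γ^{-2n} = γ^{-n}(γ^n - γ^{-n})`, invertibility of this element follows from that of `γ^n
- γ^{-n}`. -/
theorem inverse_one_sub (hγ : ∀ n : ℕ, 1 ≤ n → IsUnit (gammaDiff ρ n)) {n : ℕ} (hn : 1 ≤ n) :
    Ring.inverse (1 - (((gamma ρ)⁻¹ ^ (2 * n) : (Module.End F V)ˣ) : Module.End F V))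
      = gfrac ρ 1 n := by
  obtain ⟨u, hu⟩ := hγ n hn
  have e : 1 - (((gamma ρ)⁻¹ ^ (2 * n) : (Module.End F V)ˣ) : Module.End F V)
      = (((gamma ρ)⁻¹ ^ n * u : (Module.End F V)ˣ) : Module.End F V) := by
    rw [Units.val_mul, hu, gammaDiff, mul_sub, ← Units.val_mul, ← Units.val_mul, ← pow_add,
      inv_pow _ n, inv_mul_cancel, Units.val_one, two_mul]
  rw [e, Ring.inverse_unit, gfrac, ← hu, Ring.inverse_unit, mul_inv_rev, inv_pow, inv_inv, one_mul,
    zpow_natCast, Units.val_mul]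

theorem gamma_inv_mul_gfrac (k : ℤ) (n : ℕ) :
    (((gamma ρ)⁻¹ ^ (2 * n) : (Module.End F V)ˣ) : Module.End F V) * gfrac ρ k n
      = gfrac ρ (-2 + k) n := by
  rw [← gamma_zpow_mul_gfrac, ← zpow_natCast, inv_zpow']
  congr 4

variable (ρ)

/-- `log A(z)` -/
def logA : PowerSeries (Module.End F V) := PowerSeries.mk fun n =>
  ((1 - q ^ n) * (1 - t⁻¹ ^ n) / (n : F)) • (gfrac ρ 1 n - p⁻¹ ^ n • gfrac ρ (-1) n)

/-- `log B(z)` -/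
def logB : PowerSeries (Module.End F V) := PowerSeries.mk fun n =>
  ((1 - q ^ n) * (1 - t⁻¹ ^ n) / (n : F) * (p⁻¹ ^ (2 * n) - p⁻¹ ^ n)) • gfrac ρ (-1) n

variable {ρ}

theorem coeff_logA_mem (n : ℕ) : coeff n (logA ρ) ∈ zen ρ := by
  rw [logA, coeff_mk]
  exact (zen ρ).smul_mem (sub_mem (gfrac_mem_zen ρ _ _) ((zen ρ).smul_mem (gfrac_mem_zen ρ _ _) _)) _

theorem coeff_logB_mem (n : ℕ) : coeff n (logB ρ) ∈ zen ρ := by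
  rw [logB, coeff_mk]
  exact (zen ρ).smul_mem (gfrac_mem_zen ρ _ _) _

theorem isExp_posSeries_of_mem_zen {c : ℕ → Module.End F V} {d : PowerSeries (Module.End F V)}
    (h : ∀ n, 1 ≤ n → c n = coeff n d) (hd : ∀ n, coeff n d ∈ zen ρ) :
    IsExp d (pexp (posSeries c)) := by
  have hz : ∀ n, coeff n (posSeries c) ∈ zen ρ := fun n => by
    rw [coeff_posSeries]
    split_ifs with hn
    · exact zero_mem _
    · rw [h n (Nat.one_le_iff_ne_zero.2 hn)]; exact hd n
  refine (isExp_pexp (by rw [coeff_posSeries, if_pos rfl])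
    (coeffCommute_of_mem_zen hz fun n => zen_le_dcen (hz n))).congr_log fun n hn => ?_
  rw [coeff_posSeries, if_neg (by omega), h n hn]

theorem isExp_Aser (hγ : ∀ n : ℕ, 1 ≤ n → IsUnit (gammaDiff ρ n)) : IsExp (logA ρ) (Aser ρ) :=
  isExp_posSeries_of_mem_zen (ρ := ρ) (fun n hn => by
    rw [inverse_one_sub hγ hn, logA, coeff_mk, sub_mul 1 (_ • _) (gfrac ρ 1 n), one_mul,
      smul_mul_assoc, gamma_inv_mul_gfrac]
    rfl) coeff_logA_mem

theorem isExp_Bser (hγ : ∀ n : ℕ, 1 ≤ n → IsUnit (gammaDiff ρ n)) : IsExp (logB ρ) (Bser ρ) :=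
  isExp_posSeries_of_mem_zen (ρ := ρ) (fun n hn => by
    rw [inverse_one_sub hγ hn, logB, coeff_mk, smul_mul_assoc, gamma_inv_mul_gfrac, smul_smul]
    rfl) coeff_logB_mem

theorem Aser_mem_zen (hγ : ∀ n : ℕ, 1 ≤ n → IsUnit (gammaDiff ρ n)) (k : ℕ) :
    coeff k (Aser ρ) ∈ zen ρ := (isExp_Aser hγ).mem_subalgebra _ (fun n _ => coeff_logA_mem n) k

theorem Bser_mem_zen (hγ : ∀ n : ℕ, 1 ≤ n → IsUnit (gammaDiff ρ n)) (k : ℕ) :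
    coeff k (Bser ρ) ∈ zen ρ := (isExp_Bser hγ).mem_subalgebra _ (fun n _ => coeff_logB_mem n) k

theorem bdilScale_mem_zen :
    ((gamma ρ ^ 2 * pU ^ 2 : (Module.End F V)ˣ) : Module.End F V) ∈ zen ρ :=
  units_mul_mem_zen (units_pow_mem_zen (gamma_mem_zen ρ) 2) (units_pow_mem_zen (pU_mem_zen ρ) 2)

theorem isExp_Bdil (hγ : ∀ n : ℕ, 1 ≤ n → IsUnit (gammaDiff ρ n)) :
    IsExp (dil (gamma ρ ^ 2 * pU ^ 2) (logB ρ)) (Bdil ρ) :=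
  (isExp_Bser hγ).dil fun n => zen_commute bdilScale_mem_zen (zen_le_dcen (coeff_logB_mem n))

theorem Bdil_mem_zen (hγ : ∀ n : ℕ, 1 ≤ n → IsUnit (gammaDiff ρ n)) (k : ℕ) :
    coeff k (Bdil ρ) ∈ zen ρ := by
  rw [Bdil, coeff_dil]
  exact mul_mem (units_pow_mem_zen bdilScale_mem_zen k) (Bser_mem_zen hγ k)

theorem pU_zpow_mul (k : ℤ) (T : Module.End F V) :
    ((pU ^ k : (Module.End F V)ˣ) : Module.End F V) * T = p ^ k • T := by
  have : (pU ^ k : (Module.End F V)ˣ) = Units.map (algebraMap F (Module.End F V)).toMonoidHom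
      (Units.mk0 p p_ne_zero ^ k) := by rw [map_zpow, pU]
  rw [this, Units.coe_map, Algebra.smul_def, Units.val_zpow_eq_zpow_val]
  rfl

theorem mon_mul_gfrac (a b k : ℤ) (n : ℕ) :
    ((mon ρ (a * n) (b * n) : (Module.End F V)ˣ) : Module.End F V) * gfrac ρ k n
      = p ^ (a * n) • gfrac ρ (b + k) n := by
  rw [mon, Units.val_mul, mul_assoc, gamma_zpow_mul_gfrac, pU_zpow_mul]

theorem exists_isExp {d : PowerSeries (Module.End F V)} (hd : ∀ n, coeff n d ∈ zen ρ) :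
    ∃ f, IsExp d f :=
  ⟨_, isExp_posSeries_of_mem_zen (c := fun n => coeff n d) (fun _ _ => rfl) hd⟩

theorem isExp_mul_eq {d d' a f K b : PowerSeries (Module.End F V)} (ha : IsExp d a)
    (hf : IsExp d' f) (hd : ∀ n, coeff n d ∈ zen ρ) (hd' : ∀ n, coeff n d' ∈ zen ρ)
    (hK : IsExp b K) (h : ∀ n, 1 ≤ n → coeff n d + coeff n d' = coeff n b) : a * f = K :=
  ((ha.mul hf (coeffCommute_of_mem_zen hd' fun k => ha.mem_subalgebra _
    (fun n _ => zen_le_dcen (hd n)) k)).congr_log fun n hn => by rw [map_add, h n hn]).unique hK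

end StructureSeries


/-! ### The quadratic relations -/

section Quadratic

variable {V : Type*} [AddCommGroup V] [Module F V] {ρ : U →ₐ[F] Module.End F V}

theorem Gplus_eq_cubic : Gplus = cubic q t⁻¹ := by
  rw [Gplus, cubic, mul_inv, inv_inv]

theorem Gminus_eq_cubic : Gminus = cubic q⁻¹ t := by
  rw [Gminus, cubic, mul_inv, inv_inv]

theorem pU_zpow_apply (k : ℤ) (v : V) :
    ((pU ^ k : (Module.End F V)ˣ) : Module.End F V) v = p ^ k • v := by
  have := LinearMap.congr_fun (pU_zpow_mul k (1 : Module.End F V)) v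
  rwa [mul_one] at this

theorem deltaZ_pU_inv (f : Cur V) (m n : ℤ) (v : V) : deltaZ pU⁻¹ f m n v = p ^ n • f (m + n) v := by
  rw [deltaZ, inv_zpow', neg_neg, pU_zpow_apply]

theorem deltaZ_pU (f : Cur V) (m n : ℤ) (v : V) : deltaZ pU f m n v = p⁻¹ ^ n • f (m + n) v := by
  rw [deltaZ, pU_zpow_apply, inv_zpow']

theorem deltaW_eq (c : (Module.End F V)ˣ) (f : Cur V) (m n : ℤ) (v : V) :
    deltaW c f m n v = deltaZ c⁻¹ f n m v := by
  rw [deltaW, deltaZ, inv_zpow', neg_neg, add_comm]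

theorem exists_square_xp (hadm : Admissible ρ) :
    ∃ y : ℤ → Module.End F V, CurDeg (filt ρ hadm) 0 (toCur y) ∧
      (∀ n v, HasRationalSum p⁻¹ (fun m => xP ρ m (xP ρ (n - m) v)) (y n v)) ∧
      ∀ m n v, exch (PowerSeries.map (algebraMap F _) (crossSeries q t⁻¹)) (toCur (xp ρ))
          (toCur (xp ρ)) m n v
        - exch (PowerSeries.map (algebraMap F _) (crossSeries q t⁻¹)) (toCur (xp ρ))
          (toCur (xp ρ)) n m v
        = ((1 - q) * (1 - t⁻¹) / (1 - p)) •
          (deltaZ pU⁻¹ (toCur y) m n v - deltaZ pU⁻¹ (toCur y) n m v) := by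
  have hp : q * t⁻¹ = p := (div_eq_mul_inv q t).symm
  obtain ⟨y, h1, h2, h3⟩ := exists_square (curDeg_xp hadm) (a := q) (b := t⁻¹)
    (by rw [hp]; exact p_ne_zero) (by rw [hp]; exact sub_ne_zero.2 p_ne_one.symm)
    (by rw [hp]; exact sub_ne_zero.2 p_sq_ne_one.symm) (sub_ne_zero.2 q_ne_one.symm)
    (sub_ne_zero.2 (by rw [Ne, eq_comm, inv_eq_one]; exact t_ne_one))
    (fun m n => by rw [inv_inv, ← Gplus_eq_cubic, ← Gminus_eq_cubic]; exact xp_mul_xp ρ m n)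
  rw [hp] at h2 h3
  refine ⟨y, h1, h2, fun m n v => ?_⟩
  rw [h3, deltaZ_pU_inv, deltaZ_pU_inv, add_comm n m]

theorem exists_square_xm (hadm : Admissible ρ) :
    ∃ y : ℤ → Module.End F V, CurDeg (filt ρ hadm) 0 (toCur y) ∧
      (∀ n v, HasRationalSum p (fun m => xM ρ m (xM ρ (n - m) v)) (y n v)) ∧
      ∀ m n v, exch (PowerSeries.map (algebraMap F _) (crossSeries q⁻¹ t)) (toCur (xm ρ))
          (toCur (xm ρ)) m n v
        - exch (PowerSeries.map (algebraMap F _) (crossSeries q⁻¹ t)) (toCur (xm ρ))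
          (toCur (xm ρ)) n m v
        = ((1 - q⁻¹) * (1 - t) / (1 - p⁻¹)) •
          (deltaZ pU (toCur y) m n v - deltaZ pU (toCur y) n m v) := by
  have hp : q⁻¹ * t = p⁻¹ := by rw [p, inv_div, div_eq_mul_inv, mul_comm]
  obtain ⟨y, h1, h2, h3⟩ := exists_square (curDeg_xm hadm) (a := q⁻¹) (b := t)
    (by rw [hp]; exact inv_ne_zero p_ne_zero)
    (by rw [hp]; exact sub_ne_zero.2 (by rw [Ne, eq_comm, inv_eq_one]; exact p_ne_one))
    (by
      rw [hp, inv_pow]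
      exact sub_ne_zero.2 (by rw [Ne, eq_comm, inv_eq_one]; exact p_sq_ne_one))
    (sub_ne_zero.2 (by rw [Ne, eq_comm, inv_eq_one]; exact q_ne_one)) (sub_ne_zero.2 t_ne_one.symm)
    (fun m n => by rw [inv_inv, ← Gplus_eq_cubic, ← Gminus_eq_cubic]; exact xm_mul_xm ρ m n)
  rw [hp] at h3
  rw [hp, inv_inv] at h2
  refine ⟨y, h1, h2, fun m n v => ?_⟩
  rw [h3, deltaZ_pU, deltaZ_pU, add_comm n m]

theorem starShift_mem_zen : ((pU⁻¹ * (gamma ρ)⁻¹ : (Module.End F V)ˣ) : Module.End F V) ∈ zen ρ :=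
  units_mul_mem_zen pU_inv_mem_zen gamma_inv_mem_zen

/-- Rescaling both currents of an exchange product. -/
theorem exch_xs (hadm : Admissible ρ) (f : PowerSeries F) (m n : ℤ) (v : V) :
    exch (PowerSeries.map (algebraMap F _) f) (toCur (xs ρ)) (toCur (xs ρ)) m n v
      = (((pU⁻¹ * (gamma ρ)⁻¹) ^ (-(m + n)) : (Module.End F V)ˣ) : Module.End F V)
        (exch (PowerSeries.map (algebraMap F _) f) (toCur (xm ρ)) (toCur (xm ρ)) m n v) := by
  rw [exch, exch, map_finsum _ (exchTerm_finite (curDeg_xm hadm) (curDeg_xm hadm) m n v)]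
  refine finsum_congr fun k => ?_
  have hc := (zen_commute (units_zpow_mem_zen (starShift_mem_zen (ρ := ρ)) (-(n + k)))
    (xm_mem_dcen ρ (m - k))).eq
  have e1 := LinearMap.congr_fun hc (xm ρ (n + k) v)
  rw [Module.End.mul_apply, Module.End.mul_apply] at e1
  simp only [exchTerm, coeff_map, Module.algebraMap_end_apply, map_smul]
  congr 1
  change (xs ρ (m - k)) (xs ρ (n + k) v) = (((pU⁻¹ * (gamma ρ)⁻¹) ^ (-(m + n)) :
    (Module.End F V)ˣ) : Module.End F V) (xm ρ (m - k) (xm ρ (n + k) v))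
  rw [xs, xs, Module.End.mul_apply, Module.End.mul_apply, ← e1, ← Module.End.mul_apply,
    ← Units.val_mul, ← zpow_add]
  congr 4
  ring

theorem pU_zpow_commute (k : ℤ) (T : Module.End F V) :
    Commute ((pU ^ k : (Module.End F V)ˣ) : Module.End F V) T := by
  have : ((pU ^ k : (Module.End F V)ˣ) : Module.End F V) = p ^ k • 1 := by
    rw [← pU_zpow_mul, mul_one]
  rw [this]
  exact (Commute.one_left T).smul_left _

theorem CoeffCommute.dil_left {f h : PowerSeries (Module.End F V)} (H : CoeffCommute f h)
    (hh : ∀ n, coeff n h ∈ dcen ρ) {u : (Module.End F V)ˣ}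
    (hu : (u : Module.End F V) ∈ zen ρ) : CoeffCommute (DingIohara.dil u f) h := fun i j => by
  rw [coeff_dil]
  exact (zen_commute (units_pow_mem_zen hu i) (hh j)).mul_left (H i j)

theorem IsExp.mul_eq {d d' a f K b : PowerSeries (Module.End F V)} (ha : IsExp d a)
    (hf : IsExp d' f) (hc : CoeffCommute d' d) (hK : IsExp b K)
    (h : ∀ n, 1 ≤ n → coeff n d + coeff n d' = coeff n b) : a * f = K :=
  ((ha.mul hf fun i j => ha.commute_of_log (fun n _ => hc i n) j).congr_log fun n hn => by
    rw [map_add, h n hn]).unique hK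

theorem IsExp.mul_comm {d d' a f : PowerSeries (Module.End F V)} (ha : IsExp d a)
    (hf : IsExp d' f) (hc : CoeffCommute d' d) : a * f = f * a :=
  ha.mul_eq hf hc (hf.mul ha fun i j => hf.commute_of_log (fun n _ => hc.symm i n) j)
    fun n _ => by rw [map_add, add_comm]

theorem coeff_exp_crossSeries (a b : F) : IsExp (PowerSeries.map (algebraMap F (Module.End F V))
    (PowerSeries.mk fun n => (1 - a ^ n) * (1 - b ^ n) / n))
    (PowerSeries.map (algebraMap F (Module.End F V)) (crossSeries a b)) :=
  (isExp_crossSeries a b).map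

theorem heisNeg_mem_zen (k : ℤ) (n : ℕ) :
    coeff n (PowerSeries.mk fun n => -heis ρ k n) ∈ zen ρ := by
  rw [coeff_mk]; exact neg_mem (heis_mem_zen ρ k n)

/-- Used for `t` with `b = p⁻ⁿ`, `X = gfrac ρ 1 n` and `Y = gfrac ρ (-1) n`: `log A` and the
contraction add up to a multiple of `X - Y`, which is `1`. The version with `X` in the last term
serves `t*`. -/
theorem smul_sub_smul_cancel_left {K M : Type*} [CommRing K] [AddCommGroup M] [Module K M] (a b : K)
    (X Y : M) : a • (X - b • Y) + -((a * (1 - b)) • Y) = a • (X - Y) := by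
  module

theorem smul_sub_smul_cancel_right {K M : Type*} [CommRing K] [AddCommGroup M] [Module K M]
    (a b : K) (X Y : M) : a • (X - b • Y) + -((a * (1 - b)) • X) = (a * b) • (X - Y) := by
  module

theorem kap_eq (n : ℕ) : kap n = (1 - q ^ n) * (1 - t⁻¹ ^ n) / (n : F) * (1 - p⁻¹ ^ n) := by
  rw [kap]; ring

/-- The quadratic relation of `t(z)`. -/
theorem t_quadratic (hadm : Admissible ρ) (hψP : IsUnit (psiP0 ρ)) (hψM : IsUnit (psiM0 ρ))
    (hγ : ∀ n : ℕ, 1 ≤ n → IsUnit (gammaDiff ρ n)) (m n : ℤ) (v : V) :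
    exch (Aser ρ) (tCur ρ) (tCur ρ) m n v - exch (Aser ρ) (tCur ρ) (tCur ρ) n m v =
      ((1 - q) * (1 - t⁻¹) / (1 - p)) •
        (deltaZ pU⁻¹ (t2 ρ) m n v - deltaW pU (t2 ρ) m n v) := by
  obtain ⟨y, hy, hsum, hswap⟩ := exists_square_xp hadm
  have hd := heisNeg_mem_zen (ρ := ρ) (-1)
  obtain ⟨f, hf⟩ := exists_isExp hd
  -- Here `A` meets the contraction factor of two copies of `t`; `γ` drops out and the cross series
  -- with parameters `q`, `t⁻¹` remains.
  have hK := isExp_mul_eq (isExp_Aser hγ) hf coeff_logA_mem hd (coeff_exp_crossSeries q t⁻¹)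
    (fun k hk => by
      rw [logA, coeff_mk, coeff_mk, coeff_map, coeff_mk, heis_eq, Algebra.algebraMap_eq_smul_one,
        ← gfrac_sub hγ hk, kap_eq]
      exact smul_sub_smul_cancel_left _ _ _ _)
  rw [deltaW_eq, t2, t2Data, DressData.cur, curSq_eq p_ne_zero hsum]
  have h := (isDressing_t hadm hψP hψM hγ).exch_sub_swap hf hd (Aser_mem_zen hγ)
    (fun k hk n => by
      rw [logBeta_mul_xp ρ hψP k hk, coeff_mk, neg_mul, sub_eq_add_neg])
    (fun k => (tCur_commutesWith hadm hψP hψM hγ k).1) hK hy pU_inv_mem_zen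
    (fun n => zpow_neg_one (pU : (Module.End F V)ˣ) ▸ pU_zpow_commute (-1) (y n)) _ hswap m n v
  rw [inv_inv] at h
  rw [tCur_eq, h]
  -- The two factors `β` commute and are put into the order used in `t⁽²⁾`.
  have e : beta ρ * dil pU⁻¹ (beta ρ) = betaAt ρ pU * beta ρ :=
    (isExp_beta ρ hψP).mul_comm (isExp_betaAt hψP (pU_mem_zen ρ))
      ((logBeta_commute ρ hψP).dil_left (coeff_logBeta_mem ρ hψP) pU_inv_mem_zen)
  rw [e]
  rfl

/-- The quadratic relation of `t*(z)`. -/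
theorem tStar_quadratic (hadm : Admissible ρ) (hψP : IsUnit (psiP0 ρ)) (hψM : IsUnit (psiM0 ρ))
    (hγ : ∀ n : ℕ, 1 ≤ n → IsUnit (gammaDiff ρ n)) (m n : ℤ) (v : V) :
    exch (Aser ρ) (tStar ρ) (tStar ρ) m n v - exch (Aser ρ) (tStar ρ) (tStar ρ) n m v =
      ((1 - q⁻¹) * (1 - t) / (1 - p⁻¹)) •
        (deltaZ pU (tStar2 ρ) m n v - deltaW pU⁻¹ (tStar2 ρ) m n v) := by
  obtain ⟨y, hy, hsum, hswap⟩ := exists_square_xm hadm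
  have hd := heisNeg_mem_zen (ρ := ρ) 1
  obtain ⟨f, hf⟩ := exists_isExp hd
  have hK := isExp_mul_eq (isExp_Aser hγ) hf coeff_logA_mem hd (coeff_exp_crossSeries q⁻¹ t)
    (fun k hk => by
      -- Inverting both parameters costs `(q⁻¹ t)^k = p⁻¹ ^ k`, which is the factor left by
      -- `smul_sub_smul_cancel_right`.
      have e : (1 - q⁻¹ ^ k) * (1 - t ^ k) / (k : F)
          = (1 - q ^ k) * (1 - t⁻¹ ^ k) / (k : F) * p⁻¹ ^ k := by
        have h1 := pow_ne_zero k q_ne_zero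
        have h2 := pow_ne_zero k t_ne_zero
        have h3 : (k : F) ≠ 0 := Nat.cast_ne_zero.2 (by omega)
        rw [p, inv_div, div_pow, inv_pow, inv_pow]
        field_simp
        ring
      rw [logA, coeff_mk, coeff_mk, coeff_map, coeff_mk, heis_eq, Algebra.algebraMap_eq_smul_one,
        ← gfrac_sub hγ hk, kap_eq, e]
      exact smul_sub_smul_cancel_right _ _ _ _)
  set y' : ℤ → Module.End F V := fun n =>
    (((pU⁻¹ * (gamma ρ)⁻¹) ^ (-n) : (Module.End F V)ˣ) : Module.End F V) * y n with hy'
  have hyc : (curSq p⁻¹ (xM ρ)).subst ((gamma ρ)⁻¹ * pU⁻¹) = toCur y' := by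
    rw [curSq_eq (inv_ne_zero p_ne_zero) (by rw [inv_inv]; exact hsum),
      ← (pU_commute (gamma ρ)).inv_inv.eq]
    rfl
  rw [deltaW_eq, inv_inv, tStar2, tStar2Data, DressData.cur, hyc]
  have h := (isDressing_star hadm hψP hψM hγ).exch_sub_swap hf hd (Aser_mem_zen hγ)
    (fun k hk n => by
      rw [(isDressing_star hadm hψP hψM hγ).right_mid k hk, coeff_mk, neg_mul, sub_eq_add_neg])
    (tStar_commutesWith_alphaStar hadm hψP hψM hγ) hK (y := y')
    (fun n => by
      have := (opDeg_zen hadm (units_zpow_mem_zen (starShift_mem_zen (ρ := ρ)) (-n)))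
      rw [mem_degSub] at this
      have := this.comp (hy n)
      rwa [zero_add] at this) (pU_mem_zen ρ)
    (fun n => zpow_one (pU : (Module.End F V)ˣ) ▸ pU_zpow_commute 1 (y' n))
    ((1 - q⁻¹) * (1 - t) / (1 - p⁻¹)) (fun m n v => by
      -- Rescaling both currents multiplies the kernel by a central operator depending on `m + n`
      -- alone, which is absorbed in `y'`.
      rw [exch_xs hadm, exch_xs hadm, add_comm n m, ← map_sub, hswap]
      simp only [deltaZ_pU, add_comm n m]
      simp only [hy', map_smul, map_sub, Module.End.mul_apply]) m n v
  -- On the support `w = p⁻¹z` the dressings of the second factor become `α(p⁻²z)⁻¹` and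
  -- `β(γ⁻²p⁻²z)⁻¹`.
  have e1 : dil pU⁻¹ (alphaStar ρ) * alphaStar ρ
      = Ring.inverse (alphaAt ρ (pU⁻¹ ^ 2)) * Ring.inverse (alphaAt ρ pU⁻¹) := by
    have h1 := (isExp_inv_alphaAt hψM (pU_inv_mem_zen (ρ := ρ))).dil (c := pU⁻¹) (fun n =>
      zen_commute pU_inv_mem_zen ((isDressing_star hadm hψP hψM hγ).mem_left n))
    rw [dil_neg, dil_dil _ _ (Commute.refl _), ← sq] at h1
    rw [(isExp_inv_alphaAt hψM (units_pow_mem_zen pU_inv_mem_zen 2)).unique h1]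
    rfl
  have e2 : betaStar ρ * dil pU (betaStar ρ)
      = Ring.inverse (betaAt ρ ((gamma ρ)⁻¹ ^ 2 * pU⁻¹ ^ 2)) *
      Ring.inverse (betaAt ρ ((gamma ρ)⁻¹ ^ 2 * pU⁻¹)) := by
    have h0 := (isDressing_star hadm hψP hψM hγ)
    have h1 := h0.exp_right.dil (c := pU) (fun n => zen_commute (pU_mem_zen ρ) (h0.mem_right n))
    have h2 := h0.exp_right.mul_comm h1
      (h0.comm_right.dil_left h0.mem_right (pU_mem_zen ρ))
    rw [h2]
    congr 1
    rw [logBetaStar, dil_neg, dil_dil _ _ (pU_commute _)] at h1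
    refine h1.unique ?_
    convert isExp_inv_betaAt hψP (units_mul_mem_zen
      (units_pow_mem_zen (gamma_inv_mem_zen (ρ := ρ)) 2)
      (units_pow_mem_zen (pU_inv_mem_zen (ρ := ρ)) 2)) using 3
    rw [mul_inv_rev, mul_inv_rev, inv_inv, inv_pow pU, inv_inv, ← mul_assoc, sq pU]
  rw [tStar_eq, h, e1, e2]

end Quadratic


/-! ### One-sided currents and the bracket of `x⁺` with the rescaled `x⁻` -/

section Mixed

variable {V : Type*} [AddCommGroup V] [Module F V] {ρ : U →ₐ[F] Module.End F V}

/-- The operators of a series in `z⁻¹`, as a current. -/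
def curPlus (Y : PowerSeries (Module.End F V)) (n : ℤ) : Module.End F V :=
  if 0 ≤ n then coeff n.toNat Y else 0

/-- The operators of a series in `z`, as a current. -/
def curMinus (Y : PowerSeries (Module.End F V)) (n : ℤ) : Module.End F V :=
  if n ≤ 0 then coeff (-n).toNat Y else 0

theorem curPlus_of_nonneg (Y : PowerSeries (Module.End F V)) {n : ℤ} (h : 0 ≤ n) :
    curPlus Y n = coeff n.toNat Y := if_pos h

theorem curPlus_of_neg (Y : PowerSeries (Module.End F V)) {n : ℤ} (h : n < 0) :
    curPlus Y n = 0 := if_neg (by omega)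

theorem curMinus_of_nonpos (Y : PowerSeries (Module.End F V)) {n : ℤ} (h : n ≤ 0) :
    curMinus Y n = coeff (-n).toNat Y := if_pos h

theorem curMinus_of_pos (Y : PowerSeries (Module.End F V)) {n : ℤ} (h : 0 < n) :
    curMinus Y n = 0 := if_neg (by omega)

/-- With trivial left factor, only series in `z⁻¹` remain, and dressing is their ordinary product.
`dress_curMinus` is the counterpart for series in `z`. -/
theorem dress_curPlus (Y b : PowerSeries (Module.End F V)) :
    dress 1 (toCur (curPlus Y)) b = toCur (curPlus (Y * b)) := by
  funext n v
  have hterm : ∀ i j : ℕ, i ≠ 0 ∨ n < j →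
      dressTerm 1 (toCur (curPlus Y)) b n v (i, j) = 0 := by
    intro i j h
    rcases Nat.eq_zero_or_pos i with rfl | hi
    · rw [dressTerm, toCur, curPlus_of_neg _ (by push_cast; omega), LinearMap.zero_apply, map_zero]
    · rw [dressTerm, coeff_one, if_neg (by omega)]; rfl
  rw [dress, finsum_eq_sum_of_support_subset (s := range 1 ×ˢ range (n + 1).toNat), sum_product,
    sum_range_one]
  · rcases lt_or_ge n 0 with hn | hn
    · rw [toCur, curPlus_of_neg _ hn, show (n + 1).toNat = 0 by omega, sum_range_zero]; rfl
    · lift n to ℕ using hn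
      rw [toCur, curPlus_of_nonneg _ (by omega), Int.toNat_natCast, coeff_mul,
        Finset.Nat.sum_antidiagonal_eq_sum_range_succ_mk, LinearMap.sum_apply, ← sum_range_reflect]
      refine sum_congr (by congr 1) fun j hj => ?_
      have hj' := mem_range.1 hj
      rw [Module.End.mul_apply, dressTerm, toCur, curPlus_of_nonneg _ (by push_cast; omega),
        coeff_one, if_pos rfl, Module.End.one_apply,
        show (n + 1 : ℤ).toNat - 1 - j = n - j by omega]
      congr 3
      push_cast; omega
  · rintro ⟨i, j⟩ hij
    by_contra h
    refine hij (hterm i j ?_)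
    simp only [coe_product, coe_range, Set.mem_prod, Set.mem_Iio, not_and_or, not_lt] at h
    omega

theorem dress_curMinus (a Y : PowerSeries (Module.End F V)) :
    dress a (toCur (curMinus Y)) 1 = toCur (curMinus (a * Y)) := by
  funext n v
  have hterm : ∀ i j : ℕ, j ≠ 0 ∨ -n < i →
      dressTerm a (toCur (curMinus Y)) 1 n v (i, j) = 0 := by
    intro i j h
    rcases Nat.eq_zero_or_pos j with rfl | hj
    · rw [dressTerm, toCur, curMinus_of_pos _ (by push_cast; omega), LinearMap.zero_apply, map_zero]
    · rw [dressTerm, coeff_one, if_neg (by omega), toCur, LinearMap.zero_apply, map_zero, map_zero]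
  rw [dress, finsum_eq_sum_of_support_subset (s := range (-n + 1).toNat ×ˢ range 1), sum_product]
  · rcases lt_or_ge 0 n with hn | hn
    · rw [toCur, curMinus_of_pos _ hn, show (-n + 1).toNat = 0 by omega, sum_range_zero]; rfl
    · obtain ⟨l, rfl⟩ : ∃ l : ℕ, n = -l := ⟨(-n).toNat, by omega⟩
      rw [toCur, curMinus_of_nonpos _ hn, neg_neg, Int.toNat_natCast, coeff_mul,
        Finset.Nat.sum_antidiagonal_eq_sum_range_succ_mk, LinearMap.sum_apply]
      refine sum_congr (by congr 1) fun i hi => ?_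
      have hi' := mem_range.1 hi
      rw [sum_range_one, Module.End.mul_apply, dressTerm, toCur,
        curMinus_of_nonpos _ (by push_cast; omega), coeff_one, if_pos rfl, Module.End.one_apply]
      congr 3
      push_cast; congr 1; omega
  · rintro ⟨i, j⟩ hij
    by_contra h
    refine hij (hterm i j ?_)
    simp only [coe_product, coe_range, Set.mem_prod, Set.mem_Iio, not_and_or, not_lt] at h
    omega

theorem curPlus_C (T : Module.End F V) : toCur (curPlus (C T)) = Cur.const T := by
  funext n v
  rw [Cur.const, toCur, curPlus, coeff_C]
  split_ifs with h1 h2 h3 h3 <;> first | rfl | omega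

theorem curMinus_C (T : Module.End F V) : toCur (curMinus (C T)) = Cur.const T := by
  funext n v
  rw [Cur.const, toCur, curMinus, coeff_C]
  split_ifs with h1 h2 h3 h3 <;> first | rfl | omega

theorem exch_one (f h : Cur V) (m n : ℤ) (v : V) : exch 1 f h m n v = f m (h n v) := by
  rw [exch, finsum_eq_single _ 0]
  · rw [exchTerm, coeff_one, if_pos rfl]; simp
  · intro k hk
    rw [exchTerm, coeff_one, if_neg hk]; rfl

variable {hadm : Admissible ρ} {M P α β M' P' α' β' : PowerSeries (Module.End F V)}
  {c c' : ℕ → Module.End F V} {x x' : ℤ → Module.End F V}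

theorem IsDressing.dress₂_delta (h : IsDressing ρ hadm M P c x α β)
    (h' : IsDressing ρ hadm M' P' c' x' α' β') {y : ℤ → Module.End F V}
    (hy : CurDeg (filt ρ hadm) 0 (toCur y)) (hyd : ∀ n, y n ∈ dcen ρ) {u : (Module.End F V)ˣ}
    (hu : (u : Module.End F V) ∈ zen ρ) (m n : ℤ) (v : V) :
    dress₂ α β α' β' (deltaZ u (toCur y)) m n v
      = deltaZ u (dress (dil u⁻¹ α' * α) (toCur y) (β * dil u β')) m n v :=
  DingIohara.dress₂_delta hy (opDeg_zen hadm hu) (opDeg_zen hadm (units_inv_mem_zen hu))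
    (fun i => zen_commute hu (h.coeff_left_mem i)) (fun i => zen_commute hu (h'.coeff_left_mem i))
    (fun n => zen_commute hu (hyd n)) (fun i => zen_commute hu (h.coeff_right_mem i))
    h.leftDeg h.rightDeg h'.rightDeg
    (h.seriesDeg_right.mul fun k => by
      rw [coeff_dil]
      exact zen_mul_mem_degSub hadm (units_pow_mem_zen hu k) (h'.seriesDeg_right k)).rightDeg m n v

theorem deltaZ_opDeg {y : ℤ → Module.End F V}
    (hy : CurDeg (filt ρ hadm) 0 (toCur y)) {u : (Module.End F V)ˣ}
    (hu : (u : Module.End F V) ∈ zen ρ) (m n : ℤ) :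
    OpDeg (filt ρ hadm) (m + n) (deltaZ u (toCur y) m n) := by
  have h1 : OpDeg (filt ρ hadm) 0 ⇑((u ^ (-n) : (Module.End F V)ˣ) : Module.End F V) :=
    opDeg_zen hadm (units_zpow_mem_zen hu (-n))
  have := h1.comp (hy (m + n))
  rwa [zero_add, add_zero] at this

/-- The exchange relation of two dressed currents whose undressed commutator is a combination of
delta functions. -/
theorem IsDressing.exch_sub_exch (h : IsDressing ρ hadm M P c x α β)
    (h' : IsDressing ρ hadm M' P' c' x' α' β') {d d' f f' a a' : PowerSeries (Module.End F V)}
    (hf : IsExp d f) (hd : ∀ k, coeff k d ∈ zen ρ) (ha : ∀ k, coeff k a ∈ zen ρ)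
    (hf' : IsExp d' f') (hd' : ∀ k, coeff k d' ∈ zen ρ) (ha' : ∀ k, coeff k a' ∈ zen ρ)
    (hrel : ∀ k, 1 ≤ k → ∀ n, coeff k P * x' n = x' n * coeff k P + coeff k d * x' (n + k))
    (hrel' : ∀ k, 1 ≤ k → ∀ n, coeff k P' * x n = x n * coeff k P' + coeff k d' * x (n + k))
    (hcomm : ∀ k, CommutesWith (dress α (toCur x) β) (coeff k α'))
    (hcomm' : ∀ k, CommutesWith (dress α' (toCur x') β') (coeff k α))
    (hMM : CoeffCommute M M') (hPP : CoeffCommute P P') (haf : a * f = 1) (haf' : a' * f' = 1)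
    {y y' : ℤ → Module.End F V} (hy : CurDeg (filt ρ hadm) 0 (toCur y)) (hyd : ∀ n, y n ∈ dcen ρ)
    (hy' : CurDeg (filt ρ hadm) 0 (toCur y')) (hyd' : ∀ n, y' n ∈ dcen ρ)
    {u u' : (Module.End F V)ˣ} (hu : (u : Module.End F V) ∈ zen ρ)
    (hu' : (u' : Module.End F V) ∈ zen ρ) (C : F)
    (hbr : ∀ m n v, x m (x' n v) - x' n (x m v)
      = C • (deltaZ u (toCur y) m n v - deltaZ u' (toCur y') m n v)) (m n : ℤ) (v : V) :
    DingIohara.exch a (dress α (toCur x) β) (dress α' (toCur x') β') m n v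
      - DingIohara.exch a' (dress α' (toCur x') β') (dress α (toCur x) β) n m v
      = C • (deltaZ u (dress (dil u⁻¹ α' * α) (toCur y) (β * dil u β')) m n v
        - deltaZ u' (dress (dil u'⁻¹ α' * α) (toCur y') (β * dil u' β')) m n v) := by
  have hK : ∀ m n, OpDeg (filt ρ hadm) (m + n) (DingIohara.exch 1 (toCur x) (toCur x') m n) :=
    exch_opDeg h.deg_mid h'.deg_mid (scalarDeg_of_mem_zen fun k => by
      rw [coeff_one]; split_ifs; exacts [one_mem _, zero_mem _])
  have hK' : ∀ m n, OpDeg (filt ρ hadm) (m + n) (DingIohara.exch 1 (toCur x') (toCur x) m n) :=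
    exch_opDeg h'.deg_mid h.deg_mid (scalarDeg_of_mem_zen fun k => by
      rw [coeff_one]; split_ifs; exacts [one_mem _, zero_mem _])
  have hcc : ∀ {b b' Φ Φ' : PowerSeries (Module.End F V)}, IsExp b Φ → IsExp b' Φ' →
      CoeffCommute b b' → CoeffCommute Φ Φ' := fun hb hb' H i j =>
    hb'.commute_of_log (fun k _ => (hb.commute_of_log (fun l _ => (H l k).symm) i).symm) j
  have hKs : ∀ m n, OpDeg (filt ρ hadm) (m + n)
      ((fun m n => DingIohara.exch 1 (toCur x') (toCur x) n m) m n) := fun m n => by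
    rw [add_comm m n]; exact hK' n m
  have hD := deltaZ_opDeg hy hu
  have hD' := deltaZ_opDeg hy' hu'
  -- Since `a f = 1` and `a' f' = 1`, the normally ordered kernels are bare products and their
  -- difference is the bracket.
  rw [h.exch h' hf hd ha hrel hcomm, h'.exch h hf' hd' ha' hrel' hcomm', haf, haf',
    dress₂_swap hK' h'.leftDeg h.leftDeg h'.rightDeg h.rightDeg
      (hcc h'.exp_left h.exp_left hMM.symm) (hcc h'.exp_right h.exp_right hPP.symm) n m,
    dress₂_sub hK hKs h.leftDeg h.rightDeg h'.rightDeg]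
  simp only [exch_one, hbr]
  rw [dress₂_smul (fun m n N v hv => sub_mem (hD m n N v hv) (hD' m n N v hv)) C h.leftDeg
    h.rightDeg h'.rightDeg, ← dress₂_sub hD hD' h.leftDeg h.rightDeg h'.rightDeg,
    h.dress₂_delta h' hy hyd hu, h.dress₂_delta h' hy' hyd' hu']

/-- Coefficient by coefficient, this gives `ψ⁺(γ^{-1/2}z) = ψ⁺_0 β(γ⁻²z) β(z)⁻¹` and `ψ⁻(γ^{1/2}z) =
ψ⁻_0 α(γ²z) α(z)⁻¹` in logarithmic form. -/
theorem zpow_gh_mul_self_mul_gammaDiff (k : ℕ) (L : Module.End F V) :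
    ((gh ρ ^ k : (Module.End F V)ˣ) : Module.End F V) *
      (((gh ρ ^ k : (Module.End F V)ˣ) : Module.End F V) * gammaDiff ρ k * L)
      = ((mon ρ 0 (2 * k) : (Module.End F V)ˣ) : Module.End F V) * L - L := by
  rw [← mul_assoc, ← mul_assoc, ← Units.val_mul, ← pow_add, ← two_mul, pow_mul, ← gamma, gammaDiff,
    mul_sub, ← Units.val_mul, ← Units.val_mul, inv_pow, mul_inv_cancel, Units.val_one, sub_mul,
    one_mul, ← pow_add, ← gamma_zpow_eq_mon, ← zpow_natCast]
  congr 5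
  push_cast; ring

theorem coeff_dil_gh_psiPn (hψP : IsUnit (psiP0 ρ))
    (hγ : ∀ n : ℕ, 1 ≤ n → IsUnit (gammaDiff ρ n)) {k : ℕ} (hk : 1 ≤ k) :
    coeff k (dil (gh ρ) (plog (psiPn ρ)))
      = ((mon ρ 0 (2 * k) : (Module.End F V)ˣ) : Module.End F V) * coeff k (logBeta ρ)
        - coeff k (logBeta ρ) := by
  rw [coeff_dil, coeff_plog_psiPn_eq hψP hγ hk, zpow_gh_mul_self_mul_gammaDiff]

theorem coeff_dil_gh_psiMn (hψM : IsUnit (psiM0 ρ))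
    (hγ : ∀ n : ℕ, 1 ≤ n → IsUnit (gammaDiff ρ n)) {k : ℕ} (hk : 1 ≤ k) :
    coeff k (dil (gh ρ) (plog (psiMn ρ)))
      = ((mon ρ 0 (2 * k) : (Module.End F V)ˣ) : Module.End F V) * coeff k (logAlpha ρ)
        - coeff k (logAlpha ρ) := by
  rw [coeff_dil, coeff_plog_psiMn_eq hψM hγ hk, zpow_gh_mul_self_mul_gammaDiff]

theorem logBeta_plog_commute (hψP : IsUnit (psiP0 ρ)) :
    CoeffCommute (logBeta ρ) (plog (psiPn ρ)) := fun i j => by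
  rw [coeff_logBeta ρ hψP]
  exact (zen_commute (logScale_mem_zen ρ i) (coeff_plog_psiPn_mem ρ hψP j)).mul_left
    (plog_psiPn_commute ρ hψP i j)

theorem logAlpha_plog_commute (hψM : IsUnit (psiM0 ρ)) :
    CoeffCommute (logAlpha ρ) (plog (psiMn ρ)) := fun i j => by
  rw [coeff_logAlpha ρ hψM]
  exact (zen_commute (logScale_mem_zen ρ i) (coeff_plog_psiMn_mem ρ hψM j)).mul_left
    (plog_psiMn_commute ρ hψM i j)

/-- `[x⁺(z), x⁻(p⁻¹γ⁻¹w)]` -/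
theorem xp_bracket_xs (m n : ℤ) (v : V) : xp ρ m (xs ρ n v) - xs ρ n (xp ρ m v)
    = ((1 - q) * (1 - t⁻¹) / (1 - p)) •
      (deltaZ pU⁻¹ (toCur (curPlus (dil (gh ρ) (psiP ρ)))) m n v
        - deltaZ ((gamma ρ)⁻¹ ^ 2 * pU⁻¹) (toCur (curMinus (dil (gh ρ) (psiM ρ)))) m n v) := by
  have hc := (zen_commute (units_zpow_mem_zen (starShift_mem_zen (ρ := ρ)) (-n))
    (xp_mem_dcen ρ m)).eq
  have h1 : xp ρ m * xs ρ n - xs ρ n * xp ρ m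
      = (((pU⁻¹ * (gamma ρ)⁻¹) ^ (-n) : (Module.End F V)ˣ) : Module.End F V) *
        (xp ρ m * xm ρ n - xm ρ n * xp ρ m) := by
    rw [xs, ← mul_assoc, ← hc, mul_assoc, mul_assoc, mul_sub]
  have h2 := LinearMap.congr_fun h1 v
  rw [LinearMap.sub_apply, Module.End.mul_apply, Module.End.mul_apply] at h2
  rw [h2, xp_bracket_xm, mul_smul_comm, LinearMap.smul_apply, mul_sub (Units.val _),
    LinearMap.sub_apply]
  congr 2
  · rw [deltaZ, toCur, curPlus]
    split_ifs with h
    · rw [coeff_dil, ← Module.End.mul_apply, ← mul_assoc, ← mul_assoc, ← Units.val_mul,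
        ← Units.val_mul, ← zpow_natCast, Int.toNat_of_nonneg h, psiP, coeff_mk, pp]
      congr 3
      rw [(pU_commute (gamma ρ)).inv_inv.mul_zpow, mul_assoc, inv_zpow', inv_zpow', gamma, neg_neg,
        ← zpow_natCast, ← zpow_mul, ← zpow_add]
      congr 2
      push_cast; ring
    · rw [mul_zero, mul_zero, LinearMap.zero_apply, map_zero]
  · rw [deltaZ, toCur, curMinus]
    split_ifs with h
    · rw [coeff_dil, ← Module.End.mul_apply, ← mul_assoc, ← mul_assoc, ← Units.val_mul,
        ← Units.val_mul, ← zpow_natCast (gh ρ), Int.toNat_of_nonneg (by omega), psiM, coeff_mk, pm]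
      congr 3
      rw [betaScale_eq_mon, starShift_eq_mon, mon_zpow, mon_zpow, mon, mon, gamma,
        ← zpow_natCast, ← zpow_mul, ← zpow_mul, mul_assoc, mul_assoc, ← zpow_add, ← zpow_add]
      congr 2
      push_cast; ring
    · rw [mul_zero, mul_zero, LinearMap.zero_apply, map_zero]

theorem curDeg_curPlus {Y : PowerSeries (Module.End F V)} (h : SeriesDeg (filt ρ hadm) 1 Y) :
    CurDeg (filt ρ hadm) 0 (toCur (curPlus Y)) := fun n => by
  change curPlus Y n ∈ degSub (filt ρ hadm) (n + 0)
  rw [curPlus]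
  split_ifs with hn
  · have := h n.toNat
    rw [add_zero]
    rwa [one_mul, Int.toNat_of_nonneg hn] at this
  · exact zero_mem _

theorem curDeg_curMinus {Y : PowerSeries (Module.End F V)} (h : SeriesDeg (filt ρ hadm) (-1) Y) :
    CurDeg (filt ρ hadm) 0 (toCur (curMinus Y)) := fun n => by
  change curMinus Y n ∈ degSub (filt ρ hadm) (n + 0)
  rw [curMinus]
  split_ifs with hn
  · have := h (-n).toNat
    rw [add_zero]
    rwa [neg_one_mul, Int.toNat_of_nonneg (by omega), neg_neg] at this
  · exact zero_mem _

theorem seriesDeg_dil {ε : ℤ} {Y : PowerSeries (Module.End F V)}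
    (h : SeriesDeg (filt ρ hadm) ε Y) {u : (Module.End F V)ˣ}
    (hu : (u : Module.End F V) ∈ zen ρ) : SeriesDeg (filt ρ hadm) ε (dil u Y) := fun k => by
  rw [coeff_dil]
  exact zen_mul_mem_degSub hadm (units_pow_mem_zen hu k) (h k)

theorem C_mul_comm {z : Module.End F V} (hz : z ∈ zen ρ) {f : PowerSeries (Module.End F V)}
    (hf : ∀ n, coeff n f ∈ dcen ρ) : f * C z = C z * f :=
  (coeffCommute_of_mem_zen (fun k => by
    rw [coeff_C]; split_ifs; exacts [hz, zero_mem _]) hf).commute.eq.symm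

theorem dil_C_mul (u : (Module.End F V)ˣ) {z : Module.End F V} (hz : z ∈ zen ρ)
    (hu : (u : Module.End F V) ∈ zen ρ) (f : PowerSeries (Module.End F V)) :
    dil u (C z * f) = C z * dil u f := by
  ext1 n
  rw [coeff_dil, coeff_C_mul, coeff_C_mul, coeff_dil, ← mul_assoc, ← mul_assoc,
    (zen_commute hz (zen_le_dcen (units_pow_mem_zen hu n))).eq]

end Mixed


/-! ### The mixed relation of `t` and `t*` -/

section MixedRelation

variable {V : Type*} [AddCommGroup V] [Module F V] {ρ : U →ₐ[F] Module.End F V}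

/-- `log f(z)` for the structure function `f` of `t(z) t*(w)` -/
def logMixed (ρ : U →ₐ[F] Module.End F V) : PowerSeries (Module.End F V) :=
  PowerSeries.mk fun n => p⁻¹ ^ n • heis ρ (-1) n

/-- `log f(z)` for the structure function `f` of `t*(z) t(w)` -/
def logMixedStar (ρ : U →ₐ[F] Module.End F V) : PowerSeries (Module.End F V) :=
  PowerSeries.mk fun n => p ^ n • heis ρ 1 n

theorem coeff_logMixed_mem (n : ℕ) : coeff n (logMixed ρ) ∈ zen ρ := by
  rw [logMixed, coeff_mk]; exact (zen ρ).smul_mem (heis_mem_zen ρ _ n) _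

theorem coeff_logMixedStar_mem (n : ℕ) : coeff n (logMixedStar ρ) ∈ zen ρ := by
  rw [logMixedStar, coeff_mk]; exact (zen ρ).smul_mem (heis_mem_zen ρ _ n) _

theorem mon_mul_heis (a b k : ℤ) (n : ℕ) :
    ((mon ρ (a * n) (b * n) : (Module.End F V)ˣ) : Module.End F V) * heis ρ k n
      = p ^ (a * n) • heis ρ (b + k) n := by
  rw [heis_eq, mul_smul_comm, mon_mul_gfrac, smul_comm, heis_eq]

/-- The rescaling factors of `xs` at the modes `n` and `n + k` differ by `p⁻ᵏγ⁻ᵏ`, which turns `heis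
ρ 0` into `p⁻ᵏ` times `heis ρ (-1)`. -/
theorem logBeta_mul_xs (hψP : IsUnit (psiP0 ρ)) (k : ℕ) (hk : 1 ≤ k) (n : ℤ) :
    coeff k (logBeta ρ) * xs ρ n
      = xs ρ n * coeff k (logBeta ρ) + coeff k (logMixed ρ) * xs ρ (n + k) := by
  have hz := units_zpow_mem_zen (starShift_mem_zen (ρ := ρ)) (-n)
  have hz' := units_zpow_mem_zen (starShift_mem_zen (ρ := ρ)) (-(n + k))
  have hm := mon_mul_heis (ρ := ρ) (-1) (-1) 0 k
  have e : ((mon ρ (-1 * k) (-1 * k) : (Module.End F V)ˣ) : Module.End F V) *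
      (((pU⁻¹ * (gamma ρ)⁻¹) ^ (-(n + k)) : (Module.End F V)ˣ) : Module.End F V)
      = (((pU⁻¹ * (gamma ρ)⁻¹) ^ (-n) : (Module.End F V)ˣ) : Module.End F V) := by
    rw [← Units.val_mul, starShift_eq_mon, mon_zpow, mon_zpow, mon_mul]
    congr 2 <;> ring
  have e2 : p⁻¹ ^ k • heis ρ (-1) k
      = heis ρ 0 k * ((mon ρ (-1 * k) (-1 * k) : (Module.End F V)ˣ) : Module.End F V) := by
    rw [(zen_commute (heis_mem_zen ρ 0 k) (zen_le_dcen (?_ : _ ∈ zen ρ))).eq, hm, neg_one_mul,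
      zpow_neg, zpow_natCast, inv_pow, add_zero]
    exact units_mul_mem_zen (units_zpow_mem_zen (pU_mem_zen ρ) _)
      (units_zpow_mem_zen (gamma_mem_zen ρ) _)
  rw [xs, xs, ← mul_assoc, ← (zen_commute hz (coeff_logBeta_mem ρ hψP k)).eq, mul_assoc,
    logBeta_mul_xm ρ hψP k hk, mul_add, mul_assoc]
  congr 1
  rw [logMixed, coeff_mk, e2, mul_assoc, ← mul_assoc (Units.val (mon ρ _ _)), e, ← mul_assoc,
    ← mul_assoc, (zen_commute hz (zen_le_dcen (heis_mem_zen ρ 0 k))).eq]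

theorem logBetaStar_mul_xp (hψP : IsUnit (psiP0 ρ)) (k : ℕ) (hk : 1 ≤ k) (n : ℤ) :
    coeff k (logBetaStar ρ) * xp ρ n
      = xp ρ n * coeff k (logBetaStar ρ) + coeff k (logMixedStar ρ) * xp ρ (n + k) := by
  have hw := units_pow_mem_zen (units_inv_mem_zen (betaScale_mem_zen (ρ := ρ))) k
  have e : coeff k (logMixedStar ρ)
      = (((((gamma ρ)⁻¹ ^ 2 * pU⁻¹)⁻¹) ^ k : (Module.End F V)ˣ) : Module.End F V) * heis ρ (-1) k := by
    have := mon_mul_heis (ρ := ρ) 1 2 (-1) k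
    rw [betaScale_eq_mon, mon_inv, mon_pow, neg_neg, neg_neg, this, logMixedStar, coeff_mk, one_mul,
      zpow_natCast]
    rfl
  rw [e, logBetaStar, map_neg, coeff_dil, neg_mul, mul_neg,
    mul_eq_of_central hw (xp_mem_dcen ρ n) ((logBeta_mul_xp ρ hψP k hk n).trans
      (sub_eq_add_neg _ _)), neg_add, mul_neg, neg_neg, mul_assoc]

theorem smul_mixed_cancel {K M : Type*} [Field K] [AddCommGroup M] [Module K M] (a b : K) (X : M) :
    (a * (b ^ 2 - b)) • X + b • (a * (1 - b)) • X = 0 := by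
  module

/-- `B` is designed as the inverse of the contraction factor of `t(z) t*(w)`: in its logarithm,
`p⁻²ⁿ - p⁻ⁿ` equals `-p⁻ⁿ(1 - p⁻ⁿ)`. -/
theorem Bser_mul {f : PowerSeries (Module.End F V)}
    (hγ : ∀ n : ℕ, 1 ≤ n → IsUnit (gammaDiff ρ n)) (hf : IsExp (logMixed ρ) f) : Bser ρ * f = 1 :=
  isExp_mul_eq (isExp_Bser hγ) hf coeff_logB_mem coeff_logMixed_mem IsExp.one fun n hn => by
    rw [logB, logMixed, coeff_mk, coeff_mk, heis_eq, kap_eq, map_zero, mul_comm 2 n, pow_mul]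
    exact smul_mixed_cancel _ _ _

/-- The dilation by `γ²p²` turns `p⁻²ⁿ - p⁻ⁿ` into `1 - pⁿ` and `gfrac ρ (-1)` into `gfrac ρ 1`, the
negative of what `t*(z) t(w)` contributes. -/
theorem Bdil_mul {f : PowerSeries (Module.End F V)}
    (hγ : ∀ n : ℕ, 1 ≤ n → IsUnit (gammaDiff ρ n)) (hf : IsExp (logMixedStar ρ) f) :
    Bdil ρ * f = 1 := by
  have hd : ∀ n, coeff n (dil (gamma ρ ^ 2 * pU ^ 2) (logB ρ)) ∈ zen ρ := fun n => by
    rw [coeff_dil]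
    exact mul_mem (units_pow_mem_zen bdilScale_mem_zen n) (coeff_logB_mem n)
  refine isExp_mul_eq (isExp_Bdil hγ) hf hd coeff_logMixedStar_mem IsExp.one fun n hn => ?_
  have e : (gamma ρ ^ 2 * pU ^ 2 : (Module.End F V)ˣ) ^ n = mon ρ (2 * n) (2 * n) := by
    rw [← (pU_commute (gamma ρ)).pow_pow 2 2, ← mon_pow]
    rfl
  have hp := pow_ne_zero n p_ne_zero
  rw [coeff_dil, e, logB, logMixedStar, coeff_mk, coeff_mk, heis_eq, kap_eq, map_zero,
    mul_smul_comm, mon_mul_gfrac, smul_smul, smul_smul, show (2 : ℤ) + -1 = 1 by norm_num, ← add_smul]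
  convert zero_smul F _
  have hb : p ^ n * p⁻¹ ^ n = 1 := by rw [inv_pow, mul_inv_cancel₀ hp]
  rw [mul_comm 2 n, pow_mul, mul_comm (2 : ℤ), zpow_mul, zpow_natCast,
    show (p ^ n) ^ (2 : ℤ) = (p ^ n) ^ 2 by norm_cast]
  generalize (1 - q ^ n) * (1 - t⁻¹ ^ n) / (n : F) = a
  linear_combination a * (p ^ n * p⁻¹ ^ n - p ^ n) * hb

theorem IsExp.mul_of_commute {d d' a f : PowerSeries (Module.End F V)} (ha : IsExp d a)
    (hf : IsExp d' f) (hc : CoeffCommute d' d) : IsExp (d + d') (a * f) :=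
  ha.mul hf fun i j => ha.commute_of_log (fun n _ => hc i n) j

theorem CoeffCommute.neg_left {f h : PowerSeries (Module.End F V)} (H : CoeffCommute f h) :
    CoeffCommute (-f) h := fun i j => by
  rw [map_neg]; exact (H i j).neg_left

theorem CoeffCommute.add_left {f f' h : PowerSeries (Module.End F V)} (H : CoeffCommute f h)
    (H' : CoeffCommute f' h) : CoeffCommute (f + f') h := fun i j => by
  rw [map_add]; exact (H i j).add_left (H' i j)

/-- The mixed relation of `t(z)` and `t*(z)`. -/
theorem mixed_relation (hadm : Admissible ρ) (hψP : IsUnit (psiP0 ρ)) (hψM : IsUnit (psiM0 ρ))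
    (hγ : ∀ n : ℕ, 1 ≤ n → IsUnit (gammaDiff ρ n)) (m n : ℤ) (v : V) :
    exch (Bser ρ) (tCur ρ) (tStar ρ) m n v - exch (Bdil ρ) (tStar ρ) (tCur ρ) n m v =
      ((1 - q) * (1 - t⁻¹) / (1 - p)) •
        (deltaZ pU⁻¹ (Cur.const (psiP0 ρ)) m n v -
          deltaZ ((gamma ρ)⁻¹ ^ 2 * pU⁻¹) (Cur.const (psiM0 ρ)) m n v) := by
  have ht := isDressing_t hadm hψP hψM hγ
  have hs := isDressing_star hadm hψP hψM hγ
  obtain ⟨f, hf⟩ := exists_isExp (coeff_logMixed_mem (ρ := ρ))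
  obtain ⟨f', hf'⟩ := exists_isExp (coeff_logMixedStar_mem (ρ := ρ))
  have hMM : CoeffCommute (logAlpha ρ) (logAlphaStar ρ) := 
    ((logAlpha_commute ρ hψM).dil_left ht.mem_left pU_inv_mem_zen).neg_left.symm
  have hPP : CoeffCommute (logBeta ρ) (logBetaStar ρ) := 
    ((logBeta_commute ρ hψP).dil_left ht.mem_right
      (units_inv_mem_zen betaScale_mem_zen)).neg_left.symm
  have hghz := gh_mem_zen ρ
  have hP : SeriesDeg (filt ρ hadm) 1 (psiP ρ) := fun k => by
    rw [one_mul, psiP, coeff_mk]; exact opDeg_gen hadm (Gen.psip k)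
  have hM : SeriesDeg (filt ρ hadm) (-1) (psiM ρ) := fun k => by
    rw [neg_one_mul, psiM, coeff_mk]; exact opDeg_gen hadm (Gen.psim k)
  have hPd : ∀ k, coeff k (dil (gh ρ) (psiP ρ)) ∈ dcen ρ := fun k => by
    rw [coeff_dil, psiP, coeff_mk]
    exact mul_mem (zen_le_dcen (units_pow_mem_zen hghz k)) (mem_dcen _)
  have hMd : ∀ k, coeff k (dil (gh ρ) (psiM ρ)) ∈ dcen ρ := fun k => by
    rw [coeff_dil, psiM, coeff_mk]
    exact mul_mem (zen_le_dcen (units_pow_mem_zen hghz k)) (mem_dcen _)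
  have h := ht.exch_sub_exch hs hf coeff_logMixed_mem (Bser_mem_zen hγ) hf' coeff_logMixedStar_mem
    (Bdil_mem_zen hγ) (logBeta_mul_xs hψP) (logBetaStar_mul_xp hψP)
    (tCur_commutesWith_alphaStar hadm hψP hψM hγ)
    (fun k => (tStar_commutesWith hadm hψP hψM hγ k).1) hMM hPP (Bser_mul hγ hf) (Bdil_mul hγ hf')
    (curDeg_curPlus (seriesDeg_dil hP hghz))
    (fun n => by rw [curPlus]; split_ifs; exacts [hPd _, zero_mem _])
    (curDeg_curMinus (seriesDeg_dil hM hghz))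
    (fun n => by rw [curMinus]; split_ifs; exacts [hMd _, zero_mem _])
    pU_inv_mem_zen betaScale_mem_zen _ xp_bracket_xs m n v
  have eP : dil (gh ρ) (psiP ρ) = C (psiP0 ρ) * dil (gh ρ) (psiPn ρ) := by
    rw [← dil_C_mul (z := psiP0 ρ) _ (pp_zero_mem_zen ρ) hghz, psiPn, ← mul_assoc, ← map_mul,
      Ring.mul_inverse_cancel _ hψP, map_one, one_mul]
  have eM : dil (gh ρ) (psiM ρ) = C (psiM0 ρ) * dil (gh ρ) (psiMn ρ) := by
    rw [← dil_C_mul (z := psiM0 ρ) _ (pm_zero_mem_zen ρ) hghz, psiMn, ← mul_assoc, ← map_mul,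
      Ring.mul_inverse_cancel _ hψM, map_one, one_mul]
  have hPn := (isExp_psiPn ρ hψP).dil (c := gh ρ) fun n =>
    zen_commute hghz (coeff_plog_psiPn_mem ρ hψP n)
  have hMn := (isExp_psiMn ρ hψM).dil (c := gh ρ) fun n =>
    zen_commute hghz (coeff_plog_psiMn_mem ρ hψM n)
  have hone : (((1 : (Module.End F V)ˣ)) : Module.End F V) ∈ zen ρ := one_mem _
  have hu : (((gamma ρ)⁻¹ ^ 2 * pU⁻¹)⁻¹ * pU⁻¹ : (Module.End F V)ˣ) = mon ρ 0 2 := by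
    rw [betaScale_eq_mon, pU_inv_eq_mon (ρ := ρ), mon_inv, mon_mul]
    rfl
  have huz := units_mul_mem_zen (units_inv_mem_zen (betaScale_mem_zen (ρ := ρ))) pU_inv_mem_zen
  have hu' : (pU⁻¹ * ((gamma ρ)⁻¹ ^ 2 * pU⁻¹)⁻¹ : (Module.End F V)ˣ) = mon ρ 0 2 := by
    rw [betaScale_eq_mon, pU_inv_eq_mon (ρ := ρ), mon_inv, mon_mul]
    rfl
  have huz' := units_mul_mem_zen pU_inv_mem_zen (units_inv_mem_zen (betaScale_mem_zen (ρ := ρ)))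
  have hu_pow : ∀ k : ℕ, mon ρ 0 2 ^ k = mon ρ 0 (2 * k) := fun k => by rw [mon_pow, zero_mul]
  -- First delta function, `w = p z`: the left dressings `α(p⁻¹w)⁻¹` and `α(z)` cancel.
  have left_one : dil (pU⁻¹)⁻¹ (alphaStar ρ) * alpha ρ = 1 := by
    have h1 := hs.exp_left.dil (c := (pU⁻¹)⁻¹) fun n =>
      zen_commute (units_inv_mem_zen pU_inv_mem_zen) (hs.mem_left n)
    rw [logAlphaStar, dil_neg, dil_dil _ _ (Commute.refl _).inv_left, inv_mul_cancel] at h1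
    refine h1.mul_eq ht.exp_left ?_ IsExp.one fun n _ => ?_
    · exact ((logAlpha_commute ρ hψM).dil_left ht.mem_left hone).neg_left.symm
    · rw [map_neg, coeff_dil, one_pow, Units.val_one, one_mul, neg_add_cancel, map_zero]
  -- Second delta function, `w = γ²p z`: the right dressings `β(z)` and `β(γ⁻²p⁻¹w)⁻¹` cancel.
  have right_one : beta ρ * dil ((gamma ρ)⁻¹ ^ 2 * pU⁻¹) (betaStar ρ) = 1 := by
    have h1 := hs.exp_right.dil (c := (gamma ρ)⁻¹ ^ 2 * pU⁻¹) fun n =>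
      zen_commute betaScale_mem_zen (hs.mem_right n)
    rw [logBetaStar, dil_neg, dil_dil _ _ (Commute.refl _).inv_right, mul_inv_cancel] at h1
    refine ht.exp_right.mul_eq h1 ?_ IsExp.one fun n _ => ?_
    · exact ((logBeta_commute ρ hψP).dil_left ht.mem_right hone).neg_left
    · rw [map_neg, coeff_dil, one_pow, Units.val_one, one_mul, add_neg_cancel, map_zero]
  -- At `w = p z` the right dressings give `β(z) β(γ⁻²z)⁻¹`, the inverse of `ψ⁺(γ^{-1/2}z)` up to
  -- its zero mode.
  have right_psi : dil (gh ρ) (psiPn ρ) * (beta ρ * dil pU⁻¹ (betaStar ρ)) = 1 := by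
    have h1 := hs.exp_right.dil (c := pU⁻¹) fun n => zen_commute pU_inv_mem_zen (hs.mem_right n)
    rw [logBetaStar, dil_neg, dil_dil _ _ ((pU_commute _).inv_left)] at h1
    have h2 := ht.exp_right.mul_of_commute h1
      ((logBeta_commute ρ hψP).dil_left ht.mem_right huz').neg_left
    have hc := ((logBeta_plog_commute hψP).symm.dil_left ht.mem_right hghz).symm
    refine hPn.mul_eq h2 (hc.add_left (hc.dil_left (fun n => ?_) huz').neg_left) IsExp.one
      fun n hn => ?_
    · rw [coeff_dil]
      exact mul_mem (zen_le_dcen (units_pow_mem_zen hghz n)) (coeff_plog_psiPn_mem ρ hψP n)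
    · rw [coeff_dil_gh_psiPn hψP hγ hn, map_add, map_neg, coeff_dil, hu', hu_pow, map_zero]
      abel
  -- At `w = γ²p z` the left dressings give `α(γ²z)⁻¹ α(z)`, the inverse of `ψ⁻(γ^{1/2}z)` up to its
  -- zero mode.
  have left_psi : dil ((gamma ρ)⁻¹ ^ 2 * pU⁻¹)⁻¹ (alphaStar ρ) * alpha ρ *
      dil (gh ρ) (psiMn ρ) = 1 := by
    have h1 := hs.exp_left.dil (c := ((gamma ρ)⁻¹ ^ 2 * pU⁻¹)⁻¹) fun n =>
      zen_commute (units_inv_mem_zen betaScale_mem_zen) (hs.mem_left n)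
    rw [logAlphaStar, dil_neg, dil_dil _ _ ((pU_commute _).inv_left.symm)] at h1
    have h2 := h1.mul_of_commute ht.exp_left
      ((logAlpha_commute ρ hψM).dil_left ht.mem_left huz).neg_left.symm
    have hc := ((logAlpha_plog_commute hψM).symm.dil_left ht.mem_left hghz).symm
    refine h2.mul_eq hMn ((hc.dil_left (fun n => ?_) huz).neg_left.add_left hc).symm IsExp.one
      fun n hn => ?_
    · rw [coeff_dil]
      exact mul_mem (zen_le_dcen (units_pow_mem_zen hghz n)) (coeff_plog_psiMn_mem ρ hψM n)
    · rw [coeff_dil_gh_psiMn hψM hγ hn, map_add, map_neg, coeff_dil, hu, hu_pow, map_zero]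
      abel
  have hleft : ∀ k, coeff k (dil ((gamma ρ)⁻¹ ^ 2 * pU⁻¹)⁻¹ (alphaStar ρ) * alpha ρ) ∈ dcen ρ :=
    fun k => by
      rw [coeff_mul]
      refine sum_mem fun ij _ => mul_mem ?_ (ht.coeff_left_mem _)
      rw [coeff_dil]
      exact mul_mem (zen_le_dcen (units_pow_mem_zen (units_inv_mem_zen betaScale_mem_zen) _))
        (hs.coeff_left_mem _)
  rw [left_one, dress_curPlus, eP, mul_assoc, right_psi, mul_one, curPlus_C, right_one,
    dress_curMinus, eM, ← mul_assoc, C_mul_comm (z := psiM0 ρ) (pm_zero_mem_zen ρ) hleft, mul_assoc,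
    left_psi, mul_one, curMinus_C] at h
  exact h

end MixedRelation


/-! ### Finiteness of all sums -/

section WellDefined

variable {V : Type*} [AddCommGroup V] [Module F V] {ρ : U →ₐ[F] Module.End F V}
  {hadm : Admissible ρ}

theorem CurDeg.subst {f : Cur V} (hf : CurDeg (filt ρ hadm) 0 f) {c : (Module.End F V)ˣ}
    (hc : (c : Module.End F V) ∈ zen ρ) : CurDeg (filt ρ hadm) 0 (f.subst c) := fun n => by
  have h : OpDeg (filt ρ hadm) 0 ⇑((c ^ (-n) : (Module.End F V)ˣ) : Module.End F V) :=
    opDeg_zen hadm (units_zpow_mem_zen hc (-n))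
  have := h.comp (hf n)
  rwa [zero_add] at this

theorem seriesDeg_inv_betaAt (hψP : IsUnit (psiP0 ρ)) {c : (Module.End F V)ˣ}
    (hc : (c : Module.End F V) ∈ zen ρ) :
    SeriesDeg (filt ρ hadm) 1 (Ring.inverse (betaAt ρ c)) :=
  SeriesDeg.exp (isExp_inv_betaAt hψP hc) fun k hk => by
    rw [map_neg, coeff_dil]
    exact neg_mem (zen_mul_mem_degSub hadm (units_pow_mem_zen (units_inv_mem_zen hc) k)
      (deg_logBeta hadm hψP k hk))

theorem allSumsDefined (hadm : Admissible ρ) (hψP : IsUnit (psiP0 ρ)) (hψM : IsUnit (psiM0 ρ))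
    (hγ : ∀ n : ℕ, 1 ≤ n → IsUnit (gammaDiff ρ n)) : AllSumsDefined ρ := by
  have ht := isDressing_t hadm hψP hψM hγ
  have hs := isDressing_star hadm hψP hψM hγ
  obtain ⟨y, hy, hsum, -⟩ := exists_square_xp hadm
  obtain ⟨y', hy', hsum', -⟩ := exists_square_xm hadm
  have hu2 := units_pow_mem_zen (gamma_inv_mem_zen (ρ := ρ)) 2
  refine ⟨fun n v => ⟨_, hsum n v⟩, fun n v => ⟨_, hsum' n v⟩,
    fun n v => dressTerm_finite ht.deg_mid ht.rightDeg n v,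
    fun n v => dressTerm_finite hs.deg_mid hs.rightDeg n v,
    fun n v => ?_, fun n v => ?_, exchTerm_finite ht.curDeg ht.curDeg,
    exchTerm_finite hs.curDeg hs.curDeg, exchTerm_finite ht.curDeg hs.curDeg,
    exchTerm_finite hs.curDeg ht.curDeg⟩
  -- The degree bounds apply to the specialized square only once it is identified with the
  -- homogeneous current `y`.
  · rw [t2Data, curSq_eq p_ne_zero hsum]
    exact dressTerm_finite hy ((seriesDeg_dil ht.seriesDeg_right
      (units_inv_mem_zen (pU_mem_zen ρ))).mul ht.seriesDeg_right).rightDeg n v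
  · rw [tStar2Data, curSq_eq (inv_ne_zero p_ne_zero) (by rw [inv_inv]; exact hsum')]
    exact dressTerm_finite (hy'.subst (units_mul_mem_zen gamma_inv_mem_zen pU_inv_mem_zen))
      ((seriesDeg_inv_betaAt hψP (units_mul_mem_zen hu2
        (units_pow_mem_zen pU_inv_mem_zen 2))).mul
        (seriesDeg_inv_betaAt hψP betaScale_mem_zen)).rightDeg n v

end WellDefined

end DingIohara

end

theorem mainTheorem5 {V : Type*} [AddCommGroup V] [Module F V]
    (ρ : U →ₐ[F] Module.End F V)
    (hadm : Admissible ρ)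
    (hγ : ∀ n : ℕ, 1 ≤ n → IsUnit (gammaDiff ρ n))
    (hψP : IsUnit (psiP0 ρ)) (hψM : IsUnit (psiM0 ρ)) :
    -- the objects are well defined
    (AllSumsDefined ρ ∧
      psiP ρ = PowerSeries.C (psiP0 ρ) *
        pexp (posSeries fun n => bP ρ n * ((gh ρ ^ n : (Module.End F V)ˣ) : Module.End F V)) ∧
      psiM ρ = PowerSeries.C (psiM0 ρ) *
        pexp (-posSeries fun n => bM ρ n * ((gh ρ ^ n : (Module.End F V)ˣ) : Module.End F V)) ∧
      IsUnit (alpha ρ) ∧ IsUnit (beta ρ)) ∧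
    -- (1)
    (∀ k : ℕ,
      CommutesWith (tCur ρ) (PowerSeries.coeff k (alpha ρ)) ∧
      CommutesWith (tCur ρ) (PowerSeries.coeff k (beta ρ)) ∧
      CommutesWith (tStar ρ) (PowerSeries.coeff k (alpha ρ)) ∧
      CommutesWith (tStar ρ) (PowerSeries.coeff k (beta ρ)) ∧
      CommutesWith (tCur ρ) (PowerSeries.coeff k (psiP ρ)) ∧
      CommutesWith (tCur ρ) (PowerSeries.coeff k (psiM ρ)) ∧
      CommutesWith (tStar ρ) (PowerSeries.coeff k (psiP ρ)) ∧
      CommutesWith (tStar ρ) (PowerSeries.coeff k (psiM ρ))) ∧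
    -- (2), coefficient of z^{-m} w^{-n}
    (∀ (m n : ℤ) (v : V),
      exch (Aser ρ) (tCur ρ) (tCur ρ) m n v - exch (Aser ρ) (tCur ρ) (tCur ρ) n m v =
        ((1 - q) * (1 - t⁻¹) / (1 - p)) •
          (deltaZ pU⁻¹ (t2 ρ) m n v - deltaW pU (t2 ρ) m n v)) ∧
    (∀ (m n : ℤ) (v : V),
      exch (Aser ρ) (tStar ρ) (tStar ρ) m n v - exch (Aser ρ) (tStar ρ) (tStar ρ) n m v =
        ((1 - q⁻¹) * (1 - t) / (1 - p⁻¹)) •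
          (deltaZ pU (tStar2 ρ) m n v - deltaW pU⁻¹ (tStar2 ρ) m n v)) ∧
    -- (3), coefficient of z^{-m} w^{-n}
    (∀ (m n : ℤ) (v : V),
      exch (Bser ρ) (tCur ρ) (tStar ρ) m n v - exch (Bdil ρ) (tStar ρ) (tCur ρ) n m v =
        ((1 - q) * (1 - t⁻¹) / (1 - p)) •
          (deltaZ pU⁻¹ (Cur.const (psiP0 ρ)) m n v -
            deltaZ ((gamma ρ)⁻¹ ^ 2 * pU⁻¹) (Cur.const (psiM0 ρ)) m n v)) := by
  refine ⟨⟨allSumsDefined hadm hψP hψM hγ, psiP_eq_exp hψP, psiM_eq_exp hψM, isUnit_alpha hψM,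
    isUnit_beta hψP⟩, fun k => ?_, t_quadratic hadm hψP hψM hγ, tStar_quadratic hadm hψP hψM hγ,
    mixed_relation hadm hψP hψM hγ⟩
  obtain ⟨h1, h2, h3, h4⟩ := tCur_commutesWith hadm hψP hψM hγ k
  obtain ⟨h5, h6, h7, h8⟩ := tStar_commutesWith hadm hψP hψM hγ k
  exact ⟨h1, h2, h5, h6, h3, h4, h7, h8⟩
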